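/- Let $G$ be a group of type $F_\infty$ (there is a CW complex $K(G,1)$ with finitely many cells in each dimension), and fix a finite symmetric generating set of $G$ with word length $|\cdot|$. Assume that $G$ has polynomially bounded higher-order Dehn functions: there is a simplicial complex $BG$ with finite skeleta, with universal covering $EG$, such that for every $N\ge 1$ there is a polynomial $P_N$ with $d^N(k)\le P_N(k)$ for all $k\in\mathbb N$. Here $$d^N(k)=\sup_{b}\ \min\{\,|a|_1 : a \text{ an integral simplicial } (N+1)\text{-chain of } EG,\ \partial a=b\,\}\in\mathbb N\cup\{\infty\},$$ where $b$ runs over all integral simplicial $N$-boundaries of $EG$ of $\ell^1$-norm $|b|_1\le k$. For a conjugacy class $x$ of $G$ let $C_\bullet(\mathbb CG)_x$ be the subcomplex of the Hochschild complex $C_n(\mathbb CG)=(\mathbb CG)^{\otimes(n+1)}\cong\mathbb C[G^{n+1}]$ spanned by the tuples $(g_0,\dots,g_n)$ with $g_0\cdots g_n\in x$; its homology is denoted $HH_*(\mathbb CG)_x$. Let $C_n(\ell^1_\infty G)_x$ be the completion of $C_n(\mathbb CG)_x$ with respect to the norms $$\|c\|_k=\sum |c(g_0,\dots,g_n)|\prod_{i=0}^n(1+|g_i|)^k,\qquad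 k\in\mathbb N,$$ that is, the norms induced from the completed projective tensor product $\ell^1_\infty G\,\hat\otimes\cdots\hat\otimes\,\ell^1_\infty G$, where $\ell^1_\infty G$ is the completion of $\mathbb CG$ with respect to the norms $\sum_g|f(g)|(1+|g|)^k$. The homology of the complex $C_\bullet(\ell^1_\infty G)_x$, with the continuously extended Hochschild boundary, is denoted $HH^{\mathrm{cont}}_*(\ell^1_\infty G)_x$. Then for the conjugacy class $[e]$ of the neutral element and every $n\ge 0$ the map $$HH_n(\mathbb CG)_{[e]}\longrightarrow HH^{\mathrm{cont}}_n(\ell^1_\infty G)_{[e]}$$ induced by the inclusion $C_\bullet(\mathbb CG)_{[e]}\to C_\bullet(\ell^1_\infty G)_{[e]}$ is an isomorphism of complex vector spaces. -/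

import Mathlib

open CategoryTheory Topology

universe u

noncomputable section

/-! ## Groups of type F_∞ -/

/-- `G` is of type F_∞: there is an Eilenberg-MacLane space `K(G,1)` that is a CW complex with
finitely many cells in every dimension. -/
def IsTypeFInfty (G : Type u) [Group G] : Prop :=
  ∃ (X : Type u) (_ : TopologicalSpace X) (_ : T2Space X)
    (_ : CWComplex (Set.univ : Set X)),
    RelCWComplex.FiniteType (Set.univ : Set X) ∧ PathConnectedSpace X ∧
    ∃ x : X, Nonempty (FundamentalGroup X x ≃* G) ∧
      ∀ n : ℕ, 2 ≤ n → Subsingleton (HomotopyGroup.Pi n X x)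

/-! ## Simplicial complexes: geometric realization, chains, Dehn functions -/

namespace AbstractSimplicialComplex

/-- The points of the geometric realization of `K`, in barycentric coordinates. -/
def Realization {V : Type u} (K : AbstractSimplicialComplex V) : Type u :=
  {t : V → ℝ // (∀ v, 0 ≤ t v) ∧
    ∃ s ∈ K.faces, (∀ v, v ∉ s → t v = 0) ∧ ∑ v ∈ s, t v = 1}

open Classical in
/-- The inclusion of the closed simplex spanned by the face `s` into the realization. -/
def simplexMap {V : Type u} (K : AbstractSimplicialComplex V) (s : K.faces) :
    stdSimplex ℝ (s : Finset V) → K.Realization := fun t =>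
  ⟨fun v => if h : v ∈ (s : Finset V) then t.1 ⟨v, h⟩ else 0, by
    refine ⟨fun v => ?_, s, s.2, fun v hv => dif_neg hv, ?_⟩
    · by_cases h : v ∈ (s : Finset V)
      · simpa [h] using t.2.1 ⟨v, h⟩
      · simp [h]
    · rw [← Finset.sum_coe_sort]
      simpa using t.2.2⟩

/-- The weak topology of the geometric realization: the finest topology for which the inclusions
of all closed simplices are continuous. -/
instance {V : Type u} (K : AbstractSimplicialComplex V) : TopologicalSpace K.Realization :=
  ⨆ s : K.faces, TopologicalSpace.coinduced (K.simplexMap s) inferInstance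

/-- The `N`-dimensional simplices of `K`. -/
def Simplex {V : Type u} (K : AbstractSimplicialComplex V) (N : ℕ) : Type u :=
  {s : Finset V // s ∈ K.faces ∧ s.card = N + 1}

/-- Integral simplicial `N`-chains. Every simplex is oriented by a linear order on the vertices;
another order changes some signs in the basis and hence not the `ℓ¹`-norm. -/
abbrev Chain {V : Type u} (K : AbstractSimplicialComplex V) (N : ℕ) : Type u :=
  K.Simplex N →₀ ℤ

/-- The codimension one face of a simplex opposite to its vertex `v`. -/
def Simplex.face {V : Type u} [LinearOrder V] {K : AbstractSimplicialComplex V} {N : ℕ}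
    (s : K.Simplex (N + 1)) (v : s.1) : K.Simplex N :=
  ⟨s.1.erase v, by
    have hc : (s.1.erase v).card = N + 1 := by
      rw [Finset.card_erase_of_mem v.2, s.2.2]; rfl
    exact ⟨(K.isRelLowerSet_faces s.2.1).2 (Finset.erase_subset _ _)
      (Finset.card_pos.mp (by omega)), hc⟩⟩

/-- The simplicial boundary operator; the vertex `v` of `s` has the number
`#{w ∈ s | w < v}` in the order of the vertices of `s`. -/
def boundary {V : Type u} [LinearOrder V] (K : AbstractSimplicialComplex V) (N : ℕ) :
    K.Chain (N + 1) →ₗ[ℤ] K.Chain N :=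
  Finsupp.linearCombination ℤ fun s : K.Simplex (N + 1) =>
    ∑ v : s.1, (-1 : ℤ) ^ (s.1.filter (· < (v : V))).card • Finsupp.single (s.face v) (1 : ℤ)

/-- The `ℓ¹`-norm of an integral chain. -/
def chainNorm {V : Type u} {K : AbstractSimplicialComplex V} {N : ℕ} (c : K.Chain N) : ℕ :=
  c.sum fun _ z => z.natAbs

/-- The least `ℓ¹`-norm of an `(N+1)`-chain with boundary `b`. -/
def fillingNorm {V : Type u} [LinearOrder V] (K : AbstractSimplicialComplex V) (N : ℕ)
    (b : K.Chain N) : ℕ∞ :=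
  ⨅ (a : K.Chain (N + 1)) (_ : K.boundary N a = b), (chainNorm a : ℕ∞)

/-- The `N`-th Dehn function `d^N : ℕ → ℕ ∪ {∞}` of a simplicial complex. -/
def dehnFunction {V : Type u} [LinearOrder V] (K : AbstractSimplicialComplex V) (N : ℕ)
    (k : ℕ) : ℕ∞ :=
  ⨆ (b : K.Chain N) (_ : b ∈ LinearMap.range (K.boundary N)) (_ : chainNorm b ≤ k),
    K.fillingNorm N b

end AbstractSimplicialComplex

/-- The simplicial complex `K` with the given action of `G` on its vertices is a simplicial `EG`,
that is, the universal covering (with its deck transformations) of a simplicial complex `BG`.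
The fields `eq_of_smul_eq` and `exists_smul_eq` say that `K / G` is again a simplicial complex, the
simplices of which are the `G`-orbits of simplices of `K`. -/
structure IsSimplicialEG (G : Type u) [Group G] {V : Type u} [MulAction G V]
    (K : AbstractSimplicialComplex V) : Prop where
  smul_mem : ∀ (g : G), ∀ s ∈ K.faces, s.map (MulAction.toPerm g).toEmbedding ∈ K.faces
  free : ∀ (g : G) (v : V), g • v = v → g = 1
  eq_of_smul_eq : ∀ s ∈ K.faces, ∀ v ∈ s, ∀ w ∈ s, ∀ g : G, g • v = w → v = w
  exists_smul_eq : ∀ s ∈ K.faces, ∀ t ∈ K.faces,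
    (∀ v ∈ s, ∃ g : G, g • v ∈ t) → (∀ w ∈ t, ∃ g : G, g • w ∈ s) →
      ∃ g : G, s.map (MulAction.toPerm g).toEmbedding = t
  contractible : ContractibleSpace K.Realization

/-- `K / G` has finitely many simplices in every dimension. -/
def HasFiniteSkeleta (G : Type u) [Group G] {V : Type u} [MulAction G V]
    (K : AbstractSimplicialComplex V) : Prop :=
  ∀ n : ℕ, ∃ F : Finset (Finset V), ∀ s ∈ K.faces, s.card = n + 1 →
    ∃ t ∈ F, ∃ g : G, s = t.map (MulAction.toPerm g).toEmbedding

/-- `G` has polynomially bounded higher-order Dehn functions: there is a simplicial `EG`, coming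
from a simplicial `BG` with finite skeleta, all of whose Dehn functions `d^N`, `N ≥ 1`, are bounded
from above by polynomials. (The function `d^0` measures fillings of pairs of points by paths, it is
infinite for every infinite group, and it is not a higher-order Dehn function.) -/
def HasPolynomiallyBoundedDehnFunctions (G : Type u) [Group G] : Prop :=
  ∃ (V : Type u) (_ : LinearOrder V) (_ : MulAction G V) (K : AbstractSimplicialComplex V),
    IsSimplicialEG G K ∧ HasFiniteSkeleta G K ∧
    ∀ N : ℕ, 1 ≤ N → ∃ P : Polynomial ℕ, ∀ k : ℕ, K.dehnFunction N k ≤ ((P.eval k : ℕ) : ℕ∞)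

/-! ## Word lengths -/

/-- A finite symmetric generating set of `G`. -/
structure FinSymmGenSet (G : Type u) [Group G] where
  carrier : Finset G
  inv_mem : ∀ s ∈ carrier, s⁻¹ ∈ carrier
  closure_eq_top : Subgroup.closure (carrier : Set G) = ⊤

namespace FinSymmGenSet

variable {G : Type u} [Group G] (S : FinSymmGenSet G)

/-- The word length: the least length of a word in the generators that represents `g`. -/
def length (g : G) : ℕ :=
  sInf {n | ∃ l : List G, (∀ s ∈ l, s ∈ S.carrier) ∧ l.prod = g ∧ l.length = n}

theorem exists_word (g : G) :
    ∃ l : List G, (∀ s ∈ l, s ∈ S.carrier) ∧ l.prod = g ∧ l.length = S.length g := by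
  have hne : {n | ∃ l : List G, (∀ s ∈ l, s ∈ S.carrier) ∧ l.prod = g ∧ l.length = n}.Nonempty := by
    have hg : g ∈ Subgroup.closure (S.carrier : Set G) := by
      rw [S.closure_eq_top]; trivial
    rw [← Subgroup.mem_toSubmonoid, Subgroup.closure_toSubmonoid] at hg
    obtain ⟨l, hl, rfl⟩ := Submonoid.exists_list_of_mem_closure hg
    refine ⟨l.length, l, fun s hs => ?_, rfl, rfl⟩
    rcases hl s hs with h | h
    · exact h
    · simpa using S.inv_mem _ h
  exact Nat.sInf_mem hne

theorem length_mul_le (g h : G) : S.length (g * h) ≤ S.length g + S.length h := by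
  obtain ⟨l, hl, hlg, hn⟩ := S.exists_word g
  obtain ⟨m, hm, hmh, hk⟩ := S.exists_word h
  refine Nat.sInf_le ⟨l ++ m, fun s hs => ?_, by simp [hlg, hmh], by simp [hn, hk]⟩
  rcases List.mem_append.mp hs with h' | h'
  · exact hl s h'
  · exact hm s h'

end FinSymmGenSet

/-! ## The faces of the Hochschild complex of a group ring -/

section Faces

variable {G : Type u} [Group G]

/-- The `j`-th term of the Hochschild boundary of `(g₀, …, gₙ₊₁)`: it is
`(g₀, …, gⱼ gⱼ₊₁, …, gₙ₊₁)` for `j ≤ n`, and `(gₙ₊₁ g₀, g₁, …, gₙ)` for `j = n + 1`. -/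
def hochschildFace {n : ℕ} (j : Fin (n + 2)) (g : Fin (n + 2) → G) : Fin (n + 1) → G :=
  if j = Fin.last (n + 1) then
    fun k => if k = 0 then g (Fin.last (n + 1)) * g 0 else g k.castSucc
  else Fin.contractNth j (· * ·) g

theorem hochschildFace_apply {n : ℕ} (j : Fin (n + 2)) (g : Fin (n + 2) → G) (k : Fin (n+1)) :
    hochschildFace j g k = 
     if j = Fin.last (n + 1) then (if k = 0 then g (Fin.last (n + 1)) * g 0 else g k.castSucc)
     else if (k : ℕ) < j then g k.castSucc else if (k:ℕ) = j then g k.castSucc * g k.succ else g k.succ := by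
  unfold hochschildFace Fin.contractNth
  split_ifs <;> simp_all

theorem hochschildFace_comp {n : ℕ} (i j : Fin (n + 2)) (hij : i ≤ j) (g : Fin (n + 3) → G) :
    hochschildFace i (hochschildFace j.succ g) =
      hochschildFace j (hochschildFace i.castSucc g) := by
  obtain ⟨a, ha⟩ : ∃ a : ℕ → G, ∀ m : Fin (n + 3), g m = a m :=
    ⟨fun m => if h : m < n + 3 then g ⟨m, h⟩ else 1, fun m => by simp [m.2]⟩
  funext k
  obtain ⟨i, hi⟩ := i
  obtain ⟨j, hj⟩ := j
  obtain ⟨k, hk⟩ := k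
  simp only [Fin.mk_le_mk] at hij
  simp only [hochschildFace_apply, ha, Fin.ext_iff, Fin.val_last, Fin.val_castSucc, Fin.val_succ,
    Fin.val_zero]
  grind

/-- The product `g₀ ⋯ gₙ`. -/
def tupleProd {n : ℕ} (g : Fin (n + 1) → G) : G := (List.ofFn g).prod

theorem mk_tupleProd_hochschildFace {n : ℕ} (j : Fin (n + 2)) (g : Fin (n + 2) → G) :
    ConjClasses.mk (tupleProd (hochschildFace j g)) = ConjClasses.mk (tupleProd g) := by
  by_cases h : j = Fin.last (n + 1)
  · subst h
    rw [ConjClasses.mk_eq_mk_iff_isConj]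
    have h1 : tupleProd (hochschildFace (Fin.last (n + 1)) g) =
        g (Fin.last (n + 1)) * tupleProd (fun k : Fin (n + 1) => g k.castSucc) := by
      simp [tupleProd, hochschildFace, List.ofFn_succ, mul_assoc]
    have h2 : tupleProd g =
        tupleProd (fun k : Fin (n + 1) => g k.castSucc) * g (Fin.last (n + 1)) := by
      rw [tupleProd, List.ofFn_succ', List.concat_eq_append, List.prod_append]
      simp [tupleProd]
    rw [h1, h2, isConj_iff]
    exact ⟨(g (Fin.last (n + 1)))⁻¹, by group⟩
  · have key : ∀ (m : ℕ) (f : Fin m → G), (List.ofFn f).prod = Fin.partialProd f (Fin.last m) := by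
      intro m f
      rw [Fin.partialProd, Fin.val_last, List.take_of_length_le (by simp)]
    congr 1
    rw [tupleProd, tupleProd, key, key, hochschildFace, if_neg h]
    rw [Fin.partialProd_contractNth, Function.comp_apply]
    congr 1
    obtain ⟨i, rfl⟩ := Fin.exists_castSucc_eq.mpr h
    simp [Fin.ext_iff, Fin.succAbove, Fin.lt_def]
    omega

theorem prod_hochschildFace_le {n : ℕ} (w : G → ℕ)
    (h2 : ∀ g h, w (g * h) ≤ w g * w h) (j : Fin (n + 2)) (g : Fin (n + 2) → G) :
    ∏ i, w (hochschildFace j g i) ≤ ∏ i, w (g i) := by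
  induction j using Fin.lastCases with
  | last =>
    rw [Fin.prod_univ_castSucc (f := fun i => w (g i)), Fin.prod_univ_succ, Fin.prod_univ_succ,
      mul_comm _ (w (g (Fin.last _))), ← mul_assoc]
    have h0 : hochschildFace (Fin.last (n + 1)) g 0 = g (Fin.last (n + 1)) * g 0 := by
      simp [hochschildFace]
    have hs : ∀ i : Fin n, hochschildFace (Fin.last (n + 1)) g i.succ = g i.succ.castSucc := by
      intro i
      simp [hochschildFace]
    simp only [h0, hs, Fin.castSucc_zero]
    exact Nat.mul_le_mul_right _ (h2 _ _)
  | cast j =>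
    rw [Fin.prod_univ_succAbove (fun i => w (g i)) j.succ,
      Fin.prod_univ_succAbove (fun i => w (g (j.succ.succAbove i))) j,
      Fin.prod_univ_succAbove _ j, ← mul_assoc, mul_comm (w (g j.succ))]
    have h0 : hochschildFace j.castSucc g j = g (j.succ.succAbove j) * g j.succ := by
      simp [hochschildFace, Fin.contractNth]
    have hs : ∀ k : Fin n, hochschildFace j.castSucc g (j.succAbove k) =
        g (j.succ.succAbove (j.succAbove k)) := by
      intro k
      rw [hochschildFace, if_neg (Fin.castSucc_ne_last j), Fin.contractNth]
      have hne : ((j.succAbove k : Fin (n + 1)) : ℕ) ≠ j := by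
        simpa [Fin.ext_iff] using Fin.succAbove_ne j k
      rcases lt_or_gt_of_ne hne with h | h
      · rw [if_pos (by simpa using h), Fin.succAbove_of_castSucc_lt j.succ (j.succAbove k) (by
          simp only [Fin.lt_def, Fin.val_castSucc, Fin.val_succ]; omega)]
      · rw [if_neg (by simpa using h.le), if_neg (by simpa using hne),
          Fin.succAbove_of_le_castSucc j.succ (j.succAbove k) (by
            simp only [Fin.le_def, Fin.val_castSucc, Fin.val_succ]; omega)]
    simp only [h0, hs]
    exact Nat.mul_le_mul_right _ (h2 _ _)

/-- The tuples `(g₀, …, gₙ)` with `g₀ ⋯ gₙ ∈ x`. -/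
def ClassTuple (x : ConjClasses G) (n : ℕ) : Type u :=
  {g : Fin (n + 1) → G // ConjClasses.mk (tupleProd g) = x}

/-- The faces on the tuples with product in `x`. -/
def ClassTuple.face {x : ConjClasses G} {n : ℕ} (j : Fin (n + 2)) (g : ClassTuple x (n + 1)) :
    ClassTuple x n :=
  ⟨hochschildFace j g.1, (mk_tupleProd_hochschildFace j g.1).trans g.2⟩

theorem ClassTuple.face_comp {x : ConjClasses G} {n : ℕ} (i j : Fin (n + 2)) (hij : i ≤ j) :
    (ClassTuple.face i ∘ ClassTuple.face j.succ : ClassTuple x (n + 2) → ClassTuple x n) =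
      ClassTuple.face j ∘ ClassTuple.face i.castSucc :=
  funext fun g => Subtype.ext (hochschildFace_comp i j hij g.1)

/-- The weight `∏ᵢ (1 + |gᵢ|)` of a tuple. -/
def ClassTuple.weight (S : FinSymmGenSet G) {x : ConjClasses G} {n : ℕ}
    (g : ClassTuple x n) : ℕ :=
  ∏ i, (1 + S.length (g.1 i))

theorem ClassTuple.weight_face_le (S : FinSymmGenSet G) {x : ConjClasses G} {n : ℕ}
    (j : Fin (n + 2)) (g : ClassTuple x (n + 1)) : (g.face j).weight S ≤ g.weight S := by
  refine prod_hochschildFace_le (fun a => 1 + S.length a) (fun a b => ?_) j g.1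
  have := S.length_mul_le a b
  nlinarith [Nat.zero_le (S.length a * S.length b)]

end Faces

/-! ## Weighted `ℓ¹`-spaces -/

section Weighted

variable {I J L : Type u}

/-- The functions `c` on `I` for which `‖c‖_k = ∑ᵢ |c i| w(i)^k` is finite for every `k`. For
`w ≥ 1` this is the completion of the space of finitely supported functions with respect to the
family of norms `‖-‖_k`. -/
def RapidDecay (w : I → ℕ) : Submodule ℂ (I → ℂ) where
  carrier := {c | ∀ k : ℕ, Summable fun i => ‖c i‖ * (w i : ℝ) ^ k}
  zero_mem' := fun k => by simp
  add_mem' := fun {a b} ha hb k => by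
    refine Summable.of_nonneg_of_le (fun i => by positivity) (fun i => ?_) ((ha k).add (hb k))
    rw [← add_mul]
    exact mul_le_mul_of_nonneg_right (norm_add_le _ _) (by positivity)
  smul_mem' := fun r a ha k => by
    simpa [mul_assoc] using (ha k).mul_left ‖r‖

namespace RapidDecay

theorem summable {w : I → ℕ} (c : RapidDecay w) : Summable c.1 :=
  Summable.of_norm (by simpa using c.2 0)

theorem summable_fiber {w : I → ℕ} (c : RapidDecay w) (f : I → J) (j : J) :
    Summable fun i : {i // f i = j} => c.1 i :=
  (summable c).comp_injective Subtype.val_injective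

theorem push_mem {w : I → ℕ} {w' : J → ℕ} (f : I → J) (hf : ∀ i, w' (f i) ≤ w i)
    (c : RapidDecay w) : (fun j => ∑' i : {i // f i = j}, c.1 i) ∈ RapidDecay w' := by
  intro k
  have hs : Summable fun p : (Σ j : J, {i // f i = j}) => ‖c.1 p.2‖ * (w p.2 : ℝ) ^ k :=
    (Equiv.sigmaFiberEquiv f).summable_iff.mpr (c.2 k)
  have hs0 : ∀ j, Summable fun i : {i // f i = j} => ‖c.1 i‖ := fun j =>
    (summable_fiber c f j).norm
  refine Summable.of_nonneg_of_le (fun j => by positivity) (fun j => ?_) hs.sigma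
  calc ‖∑' i : {i // f i = j}, c.1 i‖ * (w' j : ℝ) ^ k
      ≤ (∑' i : {i // f i = j}, ‖c.1 i‖) * (w' j : ℝ) ^ k :=
        mul_le_mul_of_nonneg_right (norm_tsum_le_tsum_norm (hs0 j)) (by positivity)
    _ = ∑' i : {i // f i = j}, ‖c.1 i‖ * (w' j : ℝ) ^ k := tsum_mul_right.symm
    _ ≤ ∑' i : {i // f i = j}, ‖c.1 i‖ * (w i : ℝ) ^ k := by
        refine Summable.tsum_le_tsum (fun i => ?_) ((hs0 j).mul_right _) (hs.sigma_factor j)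
        obtain ⟨i, rfl⟩ := i
        have := hf i
        gcongr

/-- The continuous linear extension of the map that sends the basis element `i` to the basis
element `f i`, namely the push-forward `j ↦ ∑_{f i = j} c i` of functions. -/
def push {w : I → ℕ} {w' : J → ℕ} (f : I → J) (hf : ∀ i, w' (f i) ≤ w i) :
    RapidDecay w →ₗ[ℂ] RapidDecay w' where
  toFun c := ⟨fun j => ∑' i : {i // f i = j}, c.1 i, push_mem f hf c⟩
  map_add' a b := Subtype.ext <| funext fun j =>
    (summable_fiber a f j).tsum_add (summable_fiber b f j)
  map_smul' _ _ := Subtype.ext <| funext fun _ => tsum_mul_left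

theorem push_comp_push {w : I → ℕ} {w' : J → ℕ} {w'' : L → ℕ} (f : I → J) (g : J → L)
    (hf : ∀ i, w' (f i) ≤ w i) (hg : ∀ i, w'' (g i) ≤ w' i) :
    push g hg ∘ₗ push f hf = push (g ∘ f) (fun i => (hg (f i)).trans (hf i)) := by
  ext c l
  change ∑' j : {j // g j = l}, ∑' i : {i // f i = j}, c.1 i =
    ∑' i : {i // g (f i) = l}, c.1 i
  let e : {i // g (f i) = l} ≃ (Σ j : {j // g j = l}, {i // f i = j}) :=
    { toFun := fun i => ⟨⟨f i.1, i.2⟩, ⟨i.1, rfl⟩⟩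
      invFun := fun p => ⟨p.2.1, by rw [p.2.2]; exact p.1.2⟩
      left_inv := fun i => rfl
      right_inv := by
        rintro ⟨⟨j, hj⟩, ⟨i, hi⟩⟩
        dsimp only at hi
        subst hi
        rfl }
  have hs : Summable fun p : (Σ j : {j // g j = l}, {i // f i = j}) => c.1 p.2 := by
    rw [← e.summable_iff]
    exact summable_fiber c (g ∘ f) l
  rw [← hs.tsum_sigma, ← e.tsum_eq]
  rfl

/-- The inclusion of the finitely supported functions. -/
def incl (w : I → ℕ) : (I →₀ ℂ) →ₗ[ℂ] RapidDecay w where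
  toFun c := ⟨c, fun k => summable_of_ne_finset_zero (s := c.support) fun i hi => by
    simp [Finsupp.notMem_support_iff.mp hi]⟩
  map_add' _ _ := rfl
  map_smul' _ _ := rfl

theorem push_comp_incl {w : I → ℕ} {w' : J → ℕ} (f : I → J) (hf : ∀ i, w' (f i) ≤ w i) :
    push f hf ∘ₗ incl w = incl w' ∘ₗ Finsupp.lmapDomain ℂ ℂ f := by
  classical
  ext i j
  change ∑' i' : {i' // f i' = j}, Finsupp.single i (1 : ℂ) i' =
    Finsupp.mapDomain f (Finsupp.single i (1 : ℂ)) j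
  rw [Finsupp.mapDomain_single]
  by_cases h : f i = j
  · rw [tsum_eq_single ⟨i, h⟩]
    · simp [h]
    · intro b hb
      exact Finsupp.single_eq_of_ne fun hbi => hb (Subtype.ext hbi)
  · rw [Finsupp.single_eq_of_ne (Ne.symm h)]
    rw [tsum_congr (g := fun _ => 0), tsum_zero]
    intro b
    exact Finsupp.single_eq_of_ne fun hbi => h (by rw [← hbi]; exact b.2)

end RapidDecay

end Weighted

/-! ## Complexes with an alternating sum of faces as differential -/

section Alternating
variable {M : ℕ → Type u} [∀ n, AddCommGroup (M n)] [∀ n, Module ℂ (M n)]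

/-- The alternating sum `∑ⱼ (-1)^j δⱼ`. -/
def alternatingSum (δ : ∀ n : ℕ, Fin (n + 2) → M (n + 1) →ₗ[ℂ] M n) (n : ℕ) :
    M (n + 1) →ₗ[ℂ] M n :=
  ∑ j : Fin (n + 2), (-1 : ℂ) ^ (j : ℕ) • δ n j

theorem alternatingSum_comp (δ : ∀ n : ℕ, Fin (n + 2) → M (n + 1) →ₗ[ℂ] M n)
    (hδ : ∀ (n : ℕ) (i j : Fin (n + 2)), i ≤ j →
      δ n i ∘ₗ δ (n + 1) j.succ = δ n j ∘ₗ δ (n + 1) i.castSucc) (n : ℕ) :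
    alternatingSum δ n ∘ₗ alternatingSum δ (n + 1) = 0 := by
  ext c
  simp only [alternatingSum, LinearMap.comp_apply, LinearMap.sum_apply, map_sum,
    LinearMap.smul_apply, map_smul, LinearMap.zero_apply, Finset.smul_sum, smul_smul]
  rw [Finset.sum_comm]
  simp only [← Finset.sum_product']
  let P := Fin (n + 2) × Fin (n + 3)
  let S : Finset P := {ij : P | (ij.2 : ℕ) ≤ (ij.1 : ℕ)}
  rw [Finset.univ_product_univ, ← Finset.sum_add_sum_compl S, ← eq_neg_iff_add_eq_zero,
    ← Finset.sum_neg_distrib]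
  let φ : ∀ ij : P, ij ∈ S → P := fun ij hij =>
    (Fin.castLT ij.2 (lt_of_le_of_lt (Finset.mem_filter.mp hij).right (Fin.is_lt ij.1)), ij.1.succ)
  apply Finset.sum_bij φ
  · intro ij hij
    simp_rw [S, φ, Finset.compl_filter, Finset.mem_filter_univ, Fin.val_succ,
      Fin.val_castLT] at hij ⊢
    lia
  · rintro ⟨i, j⟩ hij ⟨i', j'⟩ hij' h
    rw [Prod.mk_inj]
    exact ⟨by simpa [φ] using! congr_arg Prod.snd h,
      by simpa [φ, Fin.castSucc_castLT] using! congr_arg Fin.castSucc (congr_arg Prod.fst h)⟩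
  · rintro ⟨i', j'⟩ hij'
    simp_rw [S, Finset.compl_filter, Finset.mem_filter_univ, not_le] at hij'
    refine ⟨(j'.pred <| ?_, Fin.castSucc i'), ?_, ?_⟩
    · rintro rfl
      simp only [Fin.val_zero, not_lt_zero] at hij'
    · simpa [S] using! Nat.le_sub_one_of_lt hij'
    · simp only [φ, Fin.castLT_castSucc, Fin.succ_pred]
  · rintro ⟨i, j⟩ hij
    have hij' : (j : ℕ) ≤ i := by simpa [S] using! hij
    have h := LinearMap.congr_fun (hδ n (j.castLT (lt_of_le_of_lt hij' i.2)) i hij') c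
    rw [Fin.castSucc_castLT, LinearMap.comp_apply, LinearMap.comp_apply] at h
    simp only [← neg_smul, φ, h]
    congr 1
    simp only [Fin.val_succ, Fin.val_castLT, pow_succ]
    ring

/-- The chain complex with differentials `∑ⱼ (-1)^j δⱼ`. -/
def alternatingComplex (δ : ∀ n : ℕ, Fin (n + 2) → M (n + 1) →ₗ[ℂ] M n)
    (hδ : ∀ (n : ℕ) (i j : Fin (n + 2)), i ≤ j →
      δ n i ∘ₗ δ (n + 1) j.succ = δ n j ∘ₗ δ (n + 1) i.castSucc) :
    ChainComplex (ModuleCat.{u} ℂ) ℕ :=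
  ChainComplex.of (fun n => ModuleCat.of ℂ (M n)) (fun n => ModuleCat.ofHom (alternatingSum δ n))
    (fun n => by
      rw [← ModuleCat.ofHom_comp, alternatingSum_comp δ hδ]
      rfl)

end Alternating

/-! ## The localized Hochschild complexes and the comparison map -/

section Hochschild

variable {G : Type u} [Group G]

/-- `C_•(ℂG)_x`, the part of the Hochschild complex of the group ring `ℂG` that belongs to the
conjugacy class `x`: under the identification of `ℂG ⊗ ⋯ ⊗ ℂG` with `ℂ[G × ⋯ × G]` it is spanned by
the tuples `(g₀, …, gₙ)` with `g₀ ⋯ gₙ ∈ x`, and the differential is the Hochschild boundary. -/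
def hochschildComplex (x : ConjClasses G) : ChainComplex (ModuleCat.{u} ℂ) ℕ :=
  alternatingComplex (M := fun n => ClassTuple x n →₀ ℂ)
    (fun _ j => Finsupp.lmapDomain ℂ ℂ (ClassTuple.face j))
    (fun n i j hij => by
      rw [← Finsupp.lmapDomain_comp, ← Finsupp.lmapDomain_comp, ClassTuple.face_comp i j hij])

/-- `C_•(ℓ¹_∞ G)_x`, the completion of `C_•(ℂG)_x` with respect to the norms induced from the
completed projective tensor product `ℓ¹_∞ G ⊗ ⋯ ⊗ ℓ¹_∞ G`. The projective tensor product of the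
norms `∑_g |f g| (1 + |g|)^k` is the norm `∑ |c(g₀, …, gₙ)| ∏ᵢ (1 + |gᵢ|)^k` on functions on
`G × ⋯ × G`. The differential is the continuous extension of the Hochschild boundary. -/
def rdHochschildComplex (S : FinSymmGenSet G) (x : ConjClasses G) :
    ChainComplex (ModuleCat.{u} ℂ) ℕ :=
  alternatingComplex (M := fun n => RapidDecay (fun g : ClassTuple x n => g.weight S))
    (fun _ j => RapidDecay.push (ClassTuple.face j) (ClassTuple.weight_face_le S j))
    (fun n i j hij => by
      simp only [RapidDecay.push_comp_push, ClassTuple.face_comp i j hij])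

/-- The chain map `C_•(ℂG)_x → C_•(ℓ¹_∞ G)_x` given by the inclusion into the completion. -/
def hochschildComparison (S : FinSymmGenSet G) (x : ConjClasses G) :
    hochschildComplex x ⟶ rdHochschildComplex S x :=
  ChainComplex.ofHom (fun n => ModuleCat.ofHom (RapidDecay.incl fun g : ClassTuple x n =>
    g.weight S)) fun n => by
      simp only [hochschildComplex, rdHochschildComplex, alternatingComplex, ChainComplex.of_d]
      rw [← ModuleCat.ofHom_comp, ← ModuleCat.ofHom_comp]
      congr 1
      refine LinearMap.ext fun c => ?_
      simp only [alternatingSum, LinearMap.comp_apply, LinearMap.sum_apply, LinearMap.smul_apply,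
        map_sum, map_smul]
      refine Finset.sum_congr rfl fun j _ => ?_
      congr 1
      exact LinearMap.congr_fun
        (RapidDecay.push_comp_incl (ClassTuple.face j) (ClassTuple.weight_face_le S j)) c

/-- The Hochschild homology `HH_n(ℂG)_x`. -/
abbrev HH (x : ConjClasses G) (n : ℕ) : ModuleCat.{u} ℂ :=
  (hochschildComplex x).homology n

/-- The continuous Hochschild homology `HH^cont_n(ℓ¹_∞ G)_x`. -/
abbrev HHcont (S : FinSymmGenSet G) (x : ConjClasses G) (n : ℕ) : ModuleCat.{u} ℂ :=
  (rdHochschildComplex S x).homology n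

/-- The map `HH_n(ℂG)_x → HH^cont_n(ℓ¹_∞ G)_x` induced by the inclusion. -/
def HHcomparison (S : FinSymmGenSet G) (x : ConjClasses G) (n : ℕ) :
    HH x n ⟶ HHcont S x n :=
  HomologicalComplex.homologyMap (hochschildComparison S x) n

end Hochschild

end

/-! The assignment `(t₀, …, tₙ) ↦ (tₙ⁻¹ t₀, t₀⁻¹ t₁, …, tₙ₋₁⁻¹ tₙ)` identifies the Hochschild
complex of class `[e]` with the complex of ordered chains on the vertex set `G` modulo left
translation: Hochschild faces become omission of entries (`hochschildFace_quotientTuple`). Up to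
polynomials, the weight of a Hochschild tuple is the radius of a word ball containing a lift. So an
equivariant map of chains on `G` whose norms and supports grow polynomially descends to Hochschild
chains and extends continuously to the completions (`isBoundedMatrix_descend`,
`isBoundedOp_extend`).

Such a map comes from the simplicial `EG`, called `K`. A chain map `ψ` from chains on `G` to chains
of `K` is built degree by degree, sending `t` to a filling of `ψ (∂t)`. The bounds stay polynomial
because the Dehn functions are (`IsFillingMap.exists_succ`). An equivariant map `φ` from the
vertices to `G` leads back, and `θ = φ ∘ ψ` is homotopic to the identity by an explicit cone
homotopy `η`, again equivariant and polynomially bounded.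

The decisive point is that `K / G` is finite in every dimension, so `θ` takes values in finitely
many `G`-orbits of tuples per degree. Modulo `G` its continuous extension therefore sends every
rapidly decreasing chain to a finitely supported one (`extend_mem_range_incl`). This gives a chain
map from the completed complex back to the algebraic one, inverse to the inclusion up to the
homotopies induced by `η`.

Three things are needed before Dehn functions yield these fillings. Cycles must be boundaries, which
follows from contractibility by subdivision and simplicial approximation
(`exists_bd_eq_of_contractible`). Ordered chains must be traded for oriented ones, by sorting
vertices at bounded cost (`exists_polynomial_filling`). The support of a filling must be controlled
along with its norm, by cutting the filling at a level that none of its simplices crosses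
(`exists_bd_eq_mem_tuples`). Fillings in the two lowest degrees, where no Dehn function is assumed
to be bounded, are a cone and paths along words. -/

noncomputable section

/-! ## `ℓ¹`-norms of integral chains -/

section LOneNorm

variable {I J : Type*}

/-- The `ℓ¹`-norm of a finitely supported integral function. -/
def lOne (c : I →₀ ℤ) : ℕ := c.sum fun _ z => z.natAbs

theorem lOne_eq_sum (c : I →₀ ℤ) : lOne c = ∑ i ∈ c.support, (c i).natAbs := rfl

theorem lOne_eq_sum_of_subset {c : I →₀ ℤ} {s : Finset I} (h : c.support ⊆ s) :
    lOne c = ∑ i ∈ s, (c i).natAbs :=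
  Finsupp.sum_of_support_subset _ h _ (by simp)

@[simp] theorem lOne_zero : lOne (0 : I →₀ ℤ) = 0 := by simp [lOne]

@[simp] theorem lOne_single (i : I) (z : ℤ) : lOne (Finsupp.single i z) = z.natAbs := by
  simp [lOne]

theorem lOne_add_le (a b : I →₀ ℤ) : lOne (a + b) ≤ lOne a + lOne b := by
  classical
  rw [lOne_eq_sum_of_subset (Finsupp.support_add (g₁ := a) (g₂ := b)),
    lOne_eq_sum_of_subset (Finset.subset_union_left (s₁ := a.support) (s₂ := b.support)),
    lOne_eq_sum_of_subset (Finset.subset_union_right (s₁ := a.support) (s₂ := b.support)),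
    ← Finset.sum_add_distrib]
  exact Finset.sum_le_sum fun i _ => Int.natAbs_add_le _ _

theorem lOne_smul (r : ℤ) (a : I →₀ ℤ) : lOne (r • a) = r.natAbs * lOne a := by
  rw [lOne_eq_sum_of_subset (Finsupp.support_smul (b := r) (g := a)), lOne_eq_sum,
    Finset.mul_sum]
  simp [Int.natAbs_mul]

@[simp] theorem lOne_neg (a : I →₀ ℤ) : lOne (-a) = lOne a := by
  simpa using lOne_smul (-1) a

theorem lOne_sub_le (a b : I →₀ ℤ) : lOne (a - b) ≤ lOne a + lOne b := by
  simpa [sub_eq_add_neg] using lOne_add_le a (-b)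

theorem lOne_sum_le {K : Type*} (s : Finset K) (f : K → I →₀ ℤ) :
    lOne (∑ k ∈ s, f k) ≤ ∑ k ∈ s, lOne (f k) := by
  classical
  induction s using Finset.induction_on with
  | empty => simp
  | insert a s ha ih =>
    rw [Finset.sum_insert ha, Finset.sum_insert ha]
    exact (lOne_add_le _ _).trans (by omega)

theorem card_support_le_lOne (c : I →₀ ℤ) : c.support.card ≤ lOne c := by
  rw [lOne_eq_sum, Finset.card_eq_sum_ones]
  exact Finset.sum_le_sum fun i hi =>
    Nat.one_le_iff_ne_zero.mpr (by simpa using hi)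

/-- By the triangle inequality the `ℓ¹` operator norm can be read off on basis elements. Only those
in the support of `c` are tested, so bounds valid on a ball apply to chains supported there. -/
theorem lOne_linearMap_le (F : (I →₀ ℤ) →ₗ[ℤ] (J →₀ ℤ)) (c : I →₀ ℤ) (C : ℕ)
    (h : ∀ i ∈ c.support, lOne (F (Finsupp.single i 1)) ≤ C) : lOne (F c) ≤ C * lOne c := by
  have hc : F c = ∑ i ∈ c.support, c i • F (Finsupp.single i 1) := by
    conv_lhs => rw [← Finsupp.sum_single c]
    rw [Finsupp.sum, map_sum]
    refine Finset.sum_congr rfl fun i _ => ?_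
    rw [← map_smul, Finsupp.smul_single_one]
  rw [hc, lOne_eq_sum c, Finset.mul_sum]
  refine (lOne_sum_le _ _).trans (Finset.sum_le_sum fun i hi => ?_)
  rw [lOne_smul, mul_comm]
  exact Nat.mul_le_mul_right _ (h i hi)

theorem lOne_mapDomain_le (f : I → J) (c : I →₀ ℤ) : lOne (c.mapDomain f) ≤ lOne c := by
  simpa using lOne_linearMap_le (Finsupp.lmapDomain ℤ ℤ f) c 1 (by simp)

/-- A linear map that sends the basis elements in `S` to `N` sends chains supported in `S`
to `N`. -/
theorem map_mem_of_mem_supported {M : Type*} [AddCommGroup M] {S : Set I} {N : Submodule ℤ M}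
    (F : (I →₀ ℤ) →ₗ[ℤ] M) (h : ∀ i ∈ S, F (Finsupp.single i 1) ∈ N) {c : I →₀ ℤ}
    (hc : c ∈ Finsupp.supported ℤ ℤ S) : F c ∈ N := by
  rw [← Finsupp.sum_single c, Finsupp.sum, map_sum]
  refine N.sum_mem fun i hi => ?_
  rw [← Finsupp.smul_single_one, map_smul]
  exact N.smul_mem _ (h i (hc hi))

theorem mapDomain_mem_supported {S : Set I} {T : Set J} {f : I → J} (h : ∀ i ∈ S, f i ∈ T)
    {c : I →₀ ℤ} (hc : c ∈ Finsupp.supported ℤ ℤ S) :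
    c.mapDomain f ∈ Finsupp.supported ℤ ℤ T :=
  map_mem_of_mem_supported (Finsupp.lmapDomain ℤ ℤ f)
    (fun i hi => by simpa using Finsupp.single_mem_supported ℤ 1 (h i hi)) hc

end LOneNorm

/-! ## Augmented ordered chains -/

/-- The integral chains on tuples of `n` elements of `X`. The chains on the empty tuple make this
the augmented complex of ordered chains. -/
abbrev OrdChain (X : Type*) (n : ℕ) : Type _ := (Fin n → X) →₀ ℤ

namespace OrdChain

variable {X Y Z : Type*} {n : ℕ}

/-- The basis element of a tuple. -/
abbrev of (t : Fin n → X) : OrdChain X n := Finsupp.single t 1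

/-- The boundary operator. -/
def bd (n : ℕ) : OrdChain X (n + 1) →ₗ[ℤ] OrdChain X n :=
  ∑ i : Fin (n + 1), (-1 : ℤ) ^ (i : ℕ) • Finsupp.lmapDomain ℤ ℤ (fun t => i.removeNth t)

theorem bd_of (t : Fin (n + 1) → X) :
    bd n (of t) = ∑ i : Fin (n + 1), (-1 : ℤ) ^ (i : ℕ) • of (i.removeNth t) := by
  simp [bd]

/-- The cone with apex `p`. -/
def cone (p : X) : OrdChain X n →ₗ[ℤ] OrdChain X (n + 1) :=
  Finsupp.lmapDomain ℤ ℤ fun t => Fin.cons p t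

@[simp] theorem cone_of (p : X) (t : Fin n → X) : cone p (of t) = of (Fin.cons p t) := by
  simp [cone]

/-- The functoriality of ordered chains. -/
def map (f : X → Y) : OrdChain X n →ₗ[ℤ] OrdChain Y n :=
  Finsupp.lmapDomain ℤ ℤ (f ∘ ·)

@[simp] theorem map_of (f : X → Y) (t : Fin n → X) : map f (of t) = of (f ∘ t) := by
  simp [map]

@[ext] theorem hom_ext {M : Type*} [AddCommGroup M] {F F' : OrdChain X n →ₗ[ℤ] M}
    (h : ∀ t, F (of t) = F' (of t)) : F = F' := by
  ext t
  exact h t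

/-- Omitting the apex gives back `t`; omitting any other entry gives the cone over a face, with the
sign shifted by one. -/
theorem bd_cone_of (p : X) (t : Fin (n + 1) → X) :
    bd (n + 1) (cone p (of t)) = of t - cone p (bd n (of t)) := by
  rw [cone_of, bd_of, bd_of, Fin.sum_univ_succ, map_sum, sub_eq_add_neg, ← Finset.sum_neg_distrib]
  congr 1
  · simp
  · refine Finset.sum_congr rfl fun i _ => ?_
    rw [map_smul, cone_of, Fin.val_succ, pow_succ, mul_neg_one, neg_smul]
    congr 3
    funext j
    refine Fin.cases ?_ (fun j => ?_) j <;> simp [Fin.removeNth]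

theorem bd_cone (p : X) (c : OrdChain X (n + 1)) :
    bd (n + 1) (cone p c) = c - cone p (bd n c) := by
  have : bd (n + 1) ∘ₗ cone p = LinearMap.id - cone p ∘ₗ bd n :=
    hom_ext fun t => bd_cone_of p t
  exact LinearMap.congr_fun this c

theorem bd_cone_zero (p : X) (c : OrdChain X 0) : bd 0 (cone p c) = c := by
  have : bd 0 ∘ₗ cone p = LinearMap.id := hom_ext fun t => by
    rw [LinearMap.comp_apply, cone_of, bd_of]
    simp
  exact LinearMap.congr_fun this c

theorem bd_cone_of_bd_eq_zero (p : X) {c : OrdChain X (n + 1)} (h : bd n c = 0) :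
    bd (n + 1) (cone p c) = c := by
  rw [bd_cone, h, map_zero, sub_zero]

/-- Every nonempty tuple is the cone over its tail with its first entry as apex, so the cone formula
reduces the claim to one degree lower. -/
theorem bd_bd (c : OrdChain X (n + 2)) : bd n (bd (n + 1) c) = 0 := by
  suffices h : ∀ n, (bd n ∘ₗ bd (n + 1) : OrdChain X (n + 2) →ₗ[ℤ] OrdChain X n) = 0 from
    LinearMap.congr_fun (h n) c
  intro n
  induction n with
  | zero =>
    refine hom_ext fun t => ?_
    rw [← Fin.cons_self_tail t, ← cone_of, LinearMap.comp_apply, bd_cone, map_sub, bd_cone_zero,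
      sub_self, LinearMap.zero_apply]
  | succ n ih =>
    refine hom_ext fun t => ?_
    have := LinearMap.congr_fun ih (of (Fin.tail t))
    rw [LinearMap.comp_apply] at this
    rw [← Fin.cons_self_tail t, ← cone_of, LinearMap.comp_apply, bd_cone, map_sub, bd_cone,
      this]
    simp

theorem map_bd (f : X → Y) (c : OrdChain X (n + 1)) : map f (bd n c) = bd n (map f c) := by
  have : map f ∘ₗ bd n = bd n ∘ₗ map f := hom_ext fun t => by
    simp only [LinearMap.comp_apply, bd_of, map_sum, map_smul, map_of]
    rfl
  exact LinearMap.congr_fun this c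

theorem map_cone (f : X → Y) (p : X) (c : OrdChain X n) :
    map f (cone p c) = cone (f p) (map f c) := by
  have : map f ∘ₗ cone p = cone (f p) ∘ₗ map (n := n) f := hom_ext fun t => by
    simp only [LinearMap.comp_apply, cone_of, map_of]
    congr 1
    funext j
    refine Fin.cases ?_ (fun j => ?_) j <;> simp
  exact LinearMap.congr_fun this c

theorem map_map (f : X → Y) (g : Y → Z) (c : OrdChain X n) :
    map g (map f c) = map (g ∘ f) c := by
  have : map g ∘ₗ map f = map (n := n) (g ∘ f) := hom_ext fun t => by
    simp [Function.comp_assoc]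
  exact LinearMap.congr_fun this c

theorem map_id (c : OrdChain X n) : map id c = c := by
  have : map (n := n) (id : X → X) = LinearMap.id := hom_ext fun t => by simp
  exact LinearMap.congr_fun this c

theorem lOne_bd_le (c : OrdChain X (n + 1)) : lOne (bd n c) ≤ (n + 1) * lOne c := by
  refine lOne_linearMap_le _ _ _ fun t _ => ?_
  rw [bd_of]
  refine (lOne_sum_le _ _).trans ?_
  simp [Int.natAbs_pow]

theorem lOne_cone_le (p : X) (c : OrdChain X n) : lOne (cone p c) ≤ lOne c :=
  lOne_mapDomain_le _ _

theorem lOne_map_le (f : X → Y) (c : OrdChain X n) : lOne (map f c) ≤ lOne c :=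
  lOne_mapDomain_le _ _

/-- The linear extension of a map defined on tuples. -/
def lift {M : Type*} [AddCommGroup M] (F : (Fin n → X) → M) : OrdChain X n →ₗ[ℤ] M :=
  Finsupp.linearCombination ℤ F

@[simp] theorem lift_of {M : Type*} [AddCommGroup M] (F : (Fin n → X) → M) (t : Fin n → X) :
    lift F (of t) = F t := by
  simp [lift]

/-- The chains on tuples in `S`. -/
abbrev supp (S : Set (Fin n → X)) : Submodule ℤ (OrdChain X n) := Finsupp.supported ℤ ℤ S

theorem of_mem {S : Set (Fin n → X)} {t : Fin n → X} (h : t ∈ S) : of t ∈ supp S :=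
  Finsupp.single_mem_supported ℤ 1 h

theorem supp_mono {S T : Set (Fin n → X)} {c : OrdChain X n} (hc : c ∈ supp S)
    (h : ∀ t ∈ S, t ∈ T) : c ∈ supp T :=
  Finsupp.supported_mono h hc

theorem map_mem {S : Set (Fin n → X)} {T : Set (Fin n → Y)} {f : X → Y}
    (h : ∀ t ∈ S, f ∘ t ∈ T) {c : OrdChain X n} (hc : c ∈ supp S) : map f c ∈ supp T :=
  mapDomain_mem_supported h hc

theorem cone_mem {S : Set (Fin n → X)} {T : Set (Fin (n + 1) → X)} {p : X}
    (h : ∀ t ∈ S, Fin.cons p t ∈ T) {c : OrdChain X n} (hc : c ∈ supp S) : cone p c ∈ supp T :=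
  mapDomain_mem_supported h hc

theorem bd_mem {S : Set (Fin (n + 1) → X)} {T : Set (Fin n → X)}
    (h : ∀ t ∈ S, ∀ i : Fin (n + 1), i.removeNth t ∈ T) {c : OrdChain X (n + 1)}
    (hc : c ∈ supp S) : bd n c ∈ supp T := by
  refine map_mem_of_mem_supported _ (fun t ht => ?_) hc
  rw [show Finsupp.single t (1 : ℤ) = of t from rfl, bd_of]
  exact Submodule.sum_mem _ fun i _ => Submodule.smul_mem _ _ (of_mem (h t ht i))

/-- The tuples with entries in `U`. -/
def tuples (U : Set X) (n : ℕ) : Set (Fin n → X) := {t | ∀ i, t i ∈ U}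

theorem removeNth_mem_tuples {U : Set X} {t : Fin (n + 1) → X} (h : t ∈ tuples U (n + 1))
    (i : Fin (n + 1)) : i.removeNth t ∈ tuples U n := fun _ => h _

theorem cons_mem_tuples {U : Set X} {t : Fin n → X} {p : X} (hp : p ∈ U) (h : t ∈ tuples U n) :
    (Fin.cons p t : Fin (n + 1) → X) ∈ tuples U (n + 1) :=
  Fin.cases hp h

theorem tuples_mono {U U' : Set X} (h : U ⊆ U') : tuples U n ⊆ tuples U' n :=
  fun _ ht i => h (ht i)

theorem bd_mem_tuples {U : Set X} {c : OrdChain X (n + 1)} (hc : c ∈ supp (tuples U (n + 1))) :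
    bd n c ∈ supp (tuples U n) :=
  bd_mem (fun _ ht i => removeNth_mem_tuples ht i) hc

theorem cone_mem_tuples {U : Set X} {p : X} (hp : p ∈ U) {c : OrdChain X n}
    (hc : c ∈ supp (tuples U n)) : cone p c ∈ supp (tuples U (n + 1)) :=
  cone_mem (fun _ ht => cons_mem_tuples hp ht) hc

/-- The chain homotopy between the identity and a chain map `f` that is defined inductively by
cones with the apices `p`. -/
def coneHomotopy (f : ∀ n, OrdChain X n →ₗ[ℤ] OrdChain X n) (p : ∀ n, (Fin (n + 1) → X) → X) :
    ∀ n : ℕ, OrdChain X n →ₗ[ℤ] OrdChain X (n + 1)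
  | 0 => 0
  | n + 1 => lift fun t =>
      cone (p n t) (of t - f (n + 1) (of t) - coneHomotopy f p n (bd n (of t)))

section ConeHomotopy

variable {f : ∀ n, OrdChain X n →ₗ[ℤ] OrdChain X n} {p : ∀ n, (Fin (n + 1) → X) → X}

theorem coneHomotopy_of (t : Fin (n + 1) → X) : coneHomotopy f p (n + 1) (of t) =
    cone (p n t) (of t - f (n + 1) (of t) - coneHomotopy f p n (bd n (of t))) := by
  rw [coneHomotopy, lift_of]

/-- The chain `t - f t - h (bd t)` under the cone is a cycle: by induction `bd (h (bd t)) = bd t - f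
(bd t)`, the remaining term vanishing because `bd ∘ bd = 0`. The cone over a cycle fills it. In the
lowest degree `h` is zero, which is why `f 0` must be the identity. -/
theorem bd_coneHomotopy (hf₀ : f 0 = LinearMap.id)
    (hf : ∀ n c, bd n (f (n + 1) c) = f n (bd n c)) (c : OrdChain X (n + 1)) :
    bd (n + 1) (coneHomotopy f p (n + 1) c) =
      c - f (n + 1) c - coneHomotopy f p n (bd n c) := by
  suffices h : ∀ n, bd (n + 1) ∘ₗ coneHomotopy f p (n + 1) =
      LinearMap.id - f (n + 1) - coneHomotopy f p n ∘ₗ bd n from LinearMap.congr_fun (h n) c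
  have key : ∀ n (t : Fin (n + 1) → X),
      bd n (coneHomotopy f p n (bd n (of t))) = bd n (of t) - f n (bd n (of t)) →
      (bd (n + 1) ∘ₗ coneHomotopy f p (n + 1)) (of t) =
        of t - f (n + 1) (of t) - coneHomotopy f p n (bd n (of t)) := by
    intro n t h
    simp only [LinearMap.comp_apply, coneHomotopy_of, bd_cone, map_sub, h, hf]
    abel
  intro n
  induction n with
  | zero => exact hom_ext fun t => key 0 t (by simp [coneHomotopy, hf₀])
  | succ n ih =>
    refine hom_ext fun t => key (n + 1) t ?_
    have := LinearMap.congr_fun ih (bd (n + 1) (of t))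
    simpa only [LinearMap.comp_apply, LinearMap.sub_apply, LinearMap.id_apply, bd_bd, map_zero,
      sub_zero] using this

theorem coneHomotopy_mem_tuples {U : Set X} (hp : ∀ n, ∀ t ∈ tuples U (n + 1), p n t ∈ U)
    (hf : ∀ n, ∀ c ∈ supp (tuples U n), f n c ∈ supp (tuples U n)) {c : OrdChain X n}
    (hc : c ∈ supp (tuples U n)) : coneHomotopy f p n c ∈ supp (tuples U (n + 1)) := by
  induction n with
  | zero => exact Submodule.zero_mem _
  | succ n ih =>
    refine map_mem_of_mem_supported _ (fun t ht => ?_) hc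
    have ht' := of_mem ht
    rw [coneHomotopy_of]
    exact cone_mem_tuples (hp n t ht)
      (Submodule.sub_mem _ (Submodule.sub_mem _ ht' (hf _ _ ht')) (ih (bd_mem_tuples ht')))

theorem exists_lOne_coneHomotopy_le {A : ℕ → ℕ} (hf : ∀ n c, lOne (f n c) ≤ A n * lOne c)
    (n : ℕ) : ∃ C, ∀ c, lOne (coneHomotopy f p n c) ≤ C * lOne c := by
  induction n with
  | zero => exact ⟨0, fun c => by simp [coneHomotopy]⟩
  | succ n ih =>
    obtain ⟨C, hC⟩ := ih
    refine ⟨1 + A (n + 1) + C * (n + 1), fun c => lOne_linearMap_le _ _ _ fun t _ => ?_⟩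
    have h1 : lOne (f (n + 1) (of t)) ≤ A (n + 1) := by simpa using hf (n + 1) (of t)
    have h2 : lOne (bd n (of t)) ≤ n + 1 := by simpa using lOne_bd_le (of t)
    have h3 := (hC (bd n (of t))).trans (Nat.mul_le_mul_left C h2)
    rw [show Finsupp.single t (1 : ℤ) = of t from rfl, coneHomotopy_of]
    refine (lOne_cone_le _ _).trans ((lOne_sub_le _ _).trans (Nat.add_le_add ?_ h3))
    exact (lOne_sub_le _ _).trans (Nat.add_le_add (by simp) h1)

end ConeHomotopy

/-- The cycles of the augmented complex. -/
def IsCycle : ∀ {n : ℕ}, OrdChain X n → Prop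
  | 0, _ => True
  | n + 1, c => bd n c = 0

theorem isCycle_bd (c : OrdChain X (n + 1)) : IsCycle (bd n c) := by
  cases n with
  | zero => trivial
  | succ n => exact bd_bd c

theorem bd_cone_of_isCycle (p : X) {c : OrdChain X n} (h : IsCycle c) : bd n (cone p c) = c := by
  cases n with
  | zero => exact bd_cone_zero p c
  | succ n => exact bd_cone_of_bd_eq_zero p h

end OrdChain

/-! ## Barycentric subdivision of ordered chains in a vector space -/

namespace OrdChain

/-- The tuples all entries of which lie in a common member of `𝒞`. -/
def carried {X : Type*} (𝒞 : Set (Set X)) (n : ℕ) : Set (Fin n → X) :=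
  {t | ∃ C ∈ 𝒞, ∀ i, t i ∈ C}

theorem tuples_subset_carried {X : Type*} {𝒞 : Set (Set X)} {C : Set X} (hC : C ∈ 𝒞) (n : ℕ) :
    tuples C n ⊆ carried 𝒞 n :=
  fun _ ht => ⟨C, hC, ht⟩

variable {E : Type*} [AddCommGroup E] [Module ℝ E] {n : ℕ}

/-- The barycenter of a nonempty tuple. -/
def bary (t : Fin (n + 1) → E) : E := ((n : ℝ) + 1)⁻¹ • ∑ i, t i

theorem bary_mem {C : Set E} (hC : Convex ℝ C) {t : Fin (n + 1) → E} (ht : ∀ i, t i ∈ C) :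
    bary t ∈ C := by
  rw [bary, Finset.smul_sum]
  refine hC.sum_mem (fun i _ => by positivity) ?_ (fun i _ => ht i)
  simp
  field_simp

/-- The barycentric subdivision. -/
def sd : ∀ n : ℕ, OrdChain E n →ₗ[ℤ] OrdChain E n
  | 0 => LinearMap.id
  | n + 1 => lift fun t => cone (bary t) (sd n (bd n (of t)))

theorem sd_of (t : Fin (n + 1) → E) :
    sd (n + 1) (of t) = cone (bary t) (sd n (bd n (of t))) := by
  rw [sd, lift_of]

theorem bd_sd (c : OrdChain E (n + 1)) : bd n (sd (n + 1) c) = sd n (bd n c) := by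
  suffices h : ∀ n, bd n ∘ₗ sd (n + 1) = sd n ∘ₗ bd (X := E) n from LinearMap.congr_fun (h n) c
  intro n
  induction n with
  | zero => exact hom_ext fun t => by simp only [LinearMap.comp_apply, sd_of, bd_cone_zero]
  | succ n ih =>
    refine hom_ext fun t => ?_
    have h := LinearMap.congr_fun ih (bd (n + 1) (of t))
    simp only [LinearMap.comp_apply, bd_bd, map_zero] at h
    simp only [LinearMap.comp_apply, sd_of, bd_cone, h, map_zero, sub_zero]

theorem sd_mem_tuples {C : Set E} (hC : Convex ℝ C) {c : OrdChain E n}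
    (hc : c ∈ supp (tuples C n)) : sd n c ∈ supp (tuples C n) := by
  induction n with
  | zero => exact hc
  | succ n ih =>
    refine map_mem_of_mem_supported _ (fun t ht => ?_) hc
    rw [sd_of]
    exact cone_mem_tuples (bary_mem hC ht) (ih (bd_mem_tuples (of_mem ht)))

/-- The chain homotopy between the identity and the barycentric subdivision. -/
abbrev sdHomotopy : ∀ n : ℕ, OrdChain E n →ₗ[ℤ] OrdChain E (n + 1) :=
  coneHomotopy sd fun _ => bary

theorem iterate_sd_mem_tuples {C : Set E} (hC : Convex ℝ C) {c : OrdChain E n}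
    (hc : c ∈ supp (tuples C n)) (m : ℕ) : (sd n ^ m) c ∈ supp (tuples C n) := by
  induction m with
  | zero => simpa using hc
  | succ m ih => rw [pow_succ', Module.End.mul_apply]; exact sd_mem_tuples hC ih

theorem iterate_sd_mem_carried {𝒞 : Set (Set E)} (h𝒞 : ∀ C ∈ 𝒞, Convex ℝ C) {c : OrdChain E n}
    (hc : c ∈ supp (carried 𝒞 n)) (m : ℕ) : (sd n ^ m) c ∈ supp (carried 𝒞 n) := by
  refine map_mem_of_mem_supported _ (fun t ht => ?_) hc
  obtain ⟨C, hC, ht⟩ := ht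
  exact Finsupp.supported_mono (tuples_subset_carried hC n)
    (iterate_sd_mem_tuples (h𝒞 C hC) (of_mem ht) m)

theorem sdHomotopy_mem_carried {𝒞 : Set (Set E)} (h𝒞 : ∀ C ∈ 𝒞, Convex ℝ C) {c : OrdChain E n}
    (hc : c ∈ supp (carried 𝒞 n)) : sdHomotopy n c ∈ supp (carried 𝒞 (n + 1)) := by
  refine map_mem_of_mem_supported _ (fun t ht => ?_) hc
  obtain ⟨C, hC, ht⟩ := ht
  exact Finsupp.supported_mono (tuples_subset_carried hC _)
    (coneHomotopy_mem_tuples (fun _ _ ht' => bary_mem (h𝒞 C hC) ht')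
      (fun _ _ hc' => sd_mem_tuples (h𝒞 C hC) hc') (of_mem ht))

theorem bd_iterate_sd (c : OrdChain E (n + 1)) (m : ℕ) :
    bd n ((sd (n + 1) ^ m) c) = (sd n ^ m) (bd n c) := by
  induction m with
  | zero => simp
  | succ m ih => rw [pow_succ', pow_succ', Module.End.mul_apply, Module.End.mul_apply, bd_sd, ih]

/-- The homotopies of the successive subdivisions add up, and on a cycle the terms containing the
boundary drop out. Convexity of the carriers keeps all barycenters inside them. -/
theorem exists_bd_eq_sub_iterate_sd {𝒞 : Set (Set E)} (h𝒞 : ∀ C ∈ 𝒞, Convex ℝ C)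
    {c : OrdChain E (n + 1)} (hc : c ∈ supp (carried 𝒞 (n + 1))) (h : bd n c = 0) (m : ℕ) :
    ∃ a ∈ supp (carried 𝒞 (n + 2)), bd (n + 1) a = c - (sd (n + 1) ^ m) c := by
  induction m with
  | zero => exact ⟨0, Submodule.zero_mem _, by simp⟩
  | succ m ih =>
    obtain ⟨a, ha, hac⟩ := ih
    refine ⟨a + sdHomotopy (n + 1) ((sd (n + 1) ^ m) c), Submodule.add_mem _ ha
      (sdHomotopy_mem_carried h𝒞 (iterate_sd_mem_carried h𝒞 hc m)), ?_⟩
    rw [map_add, hac, bd_coneHomotopy rfl fun _ => bd_sd, bd_iterate_sd, h, map_zero, map_zero, pow_succ',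
      Module.End.mul_apply]
    abel

/-- The tuples on which the functional `l` varies by at most `d`. -/
def thin (l : E →ₗ[ℝ] ℝ) (d : ℝ) (n : ℕ) : Set (Fin n → E) :=
  {t | ∀ i j, |l (t i) - l (t j)| ≤ d}

/-- The difference is the average of the `n + 1` numbers `l (t j) - l (t i)`, one of which is zero.
This is the source of the contraction factor `n / (n + 1)`. -/
theorem abs_bary_sub_le {l : E →ₗ[ℝ] ℝ} {d : ℝ} {t : Fin (n + 1) → E}
    (ht : t ∈ thin l d (n + 1)) (i : Fin (n + 1)) :
    |l (bary t) - l (t i)| ≤ n / (n + 1) * d := by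
  have h1 : l (bary t) - l (t i) = ((n : ℝ) + 1)⁻¹ * ∑ j, (l (t j) - l (t i)) := by
    rw [bary, map_smul, map_sum, Finset.sum_sub_distrib]
    simp
    field_simp
  have h2 : |∑ j, (l (t j) - l (t i))| ≤ n * d := by
    rw [Fin.sum_univ_succAbove _ i, sub_self, zero_add]
    refine (Finset.abs_sum_le_sum_abs _ _).trans
      ((Finset.sum_le_sum fun j _ => ht (i.succAbove j) i).trans ?_)
    simp
  rw [h1, abs_mul, abs_of_nonneg (by positivity : (0 : ℝ) ≤ ((n : ℝ) + 1)⁻¹),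
    div_eq_inv_mul, mul_assoc]
  exact mul_le_mul_of_nonneg_left h2 (by positivity)

/-- The barycenter is close to every vertex of `t`, hence by convexity to every point of the hull,
where the subdivided faces lie. The faces themselves are subdivided with a smaller ratio. Testing
one functional at a time avoids choosing a norm on `E`. -/
theorem sd_of_mem_thin {n : ℕ} {l : E →ₗ[ℝ] ℝ} {d : ℝ} (hd : 0 ≤ d) {t : Fin (n + 1) → E}
    (ht : t ∈ thin l d (n + 1)) : sd (n + 1) (of t) ∈ supp (thin l (n / (n + 1) * d) (n + 1)) := by
  have hρ : (0 : ℝ) ≤ n / (n + 1) * d := by positivity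
  suffices h : sd n (bd n (of t)) ∈ supp (tuples (convexHull ℝ (Set.range t)) n ∩
      thin l (n / (n + 1) * d) n) by
    rw [sd_of]
    refine cone_mem (fun t' ht' => ?_) h
    have hb : ∀ i, |l (bary t) - l (t' i)| ≤ n / (n + 1) * d := by
      intro i
      have hconv : Convex ℝ {x | |l (bary t) - l x| ≤ n / (n + 1) * d} := by
        have : {x | |l (bary t) - l x| ≤ n / (n + 1) * d} =
            l ⁻¹' Metric.closedBall (l (bary t)) (n / (n + 1) * d) := by
          ext x
          simp [Real.dist_eq, abs_sub_comm]
        rw [this]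
        exact (convex_closedBall _ _).linear_preimage l
      exact convexHull_min (Set.range_subset_iff.mpr fun j => abs_bary_sub_le ht j) hconv (ht'.1 i)
    intro i j
    refine Fin.cases ?_ (fun i => ?_) i <;> refine Fin.cases ?_ (fun j => ?_) j
    · simpa using hρ
    · simpa using hb j
    · simpa [abs_sub_comm] using hb i
    · simpa using ht'.2 i j
  refine (Finsupp.mem_supported _ _).mpr (Set.subset_inter (sd_mem_tuples (convex_convexHull ℝ _) (bd_mem_tuples (of_mem fun i =>
    subset_convexHull ℝ _ ⟨i, rfl⟩))) ?_)
  cases n with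
  | zero =>
    intro t' _ i
    exact i.elim0
  | succ n =>
    -- The recursion is on the number of entries; the ratio `n / (n + 1)` increases with `n`, so the
    -- estimate for faces is at least as good as required.
    have ih : ∀ t' ∈ thin l d (n + 1), sd (n + 1) (of t') ∈
        supp (thin l (n / (n + 1) * d) (n + 1)) := fun t' ht' => sd_of_mem_thin hd ht'
    have hb : bd (n + 1) (of t) ∈ supp (thin l d (n + 1)) :=
      bd_mem (S := thin l d (n + 2)) (T := thin l d (n + 1)) (fun t' ht' i j k => ht' _ _) (of_mem ht)
    refine Finsupp.supported_mono ?_ (map_mem_of_mem_supported _ ih hb)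
    intro t' ht' i j
    refine (ht' i j).trans (mul_le_mul_of_nonneg_right ?_ hd)
    rw [div_le_div_iff₀ (by positivity) (by positivity)]
    push_cast
    nlinarith

theorem iterate_sd_of_mem_thin {l : E →ₗ[ℝ] ℝ} {d : ℝ} (hd : 0 ≤ d) {t : Fin (n + 1) → E}
    (ht : t ∈ thin l d (n + 1)) (m : ℕ) :
    (sd (n + 1) ^ m) (of t) ∈ supp (thin l ((n / (n + 1)) ^ m * d) (n + 1)) := by
  induction m with
  | zero => simpa using of_mem ht
  | succ m ih =>
    rw [pow_succ', pow_succ', Module.End.mul_apply, mul_assoc]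
    exact map_mem_of_mem_supported _ (fun t' ht' => sd_of_mem_thin (by positivity) ht') ih

end OrdChain

/-! ## Acyclicity of simplicial complexes with contractible realization -/

namespace AbstractSimplicialComplex

variable {V : Type u} (K : AbstractSimplicialComplex V)

/-- The tuples of vertices that lie in a common face. -/
def faceTuples (n : ℕ) : Set (Fin n → V) := {t | ∃ s ∈ K.faces, ∀ i, t i ∈ s}

theorem singleton_mem_faces (v : V) : {v} ∈ K.faces := K.singleton_mem v

variable {K}

namespace Realization

theorem nonneg (y : K.Realization) (v : V) : 0 ≤ y.1 v := y.2.1 v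

theorem sum_le_one (y : K.Realization) (u : Finset V) : ∑ v ∈ u, y.1 v ≤ 1 := by
  classical
  obtain ⟨s, -, h0, h1⟩ := y.2.2
  calc ∑ v ∈ u, y.1 v ≤ ∑ v ∈ u ∪ s, y.1 v :=
        Finset.sum_le_sum_of_subset_of_nonneg Finset.subset_union_left fun v _ _ => y.nonneg v
    _ = ∑ v ∈ s, y.1 v :=
        (Finset.sum_subset Finset.subset_union_right fun v _ hv => h0 v hv).symm
    _ = 1 := h1

theorem continuous_coord (v : V) : Continuous fun y : K.Realization => y.1 v := by
  refine continuous_iSup_dom.mpr fun s => continuous_coinduced_dom.mpr ?_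
  by_cases h : v ∈ (s : Finset V)
  · have : ((fun y : K.Realization => y.1 v) ∘ K.simplexMap s) =
        fun t : stdSimplex ℝ (s : Finset V) => t.1 ⟨v, h⟩ := by
      funext t
      simp [simplexMap, h]
    rw [this]
    exact (continuous_apply _).comp continuous_subtype_val
  · have : ((fun y : K.Realization => y.1 v) ∘ K.simplexMap s) = fun _ => 0 := by
      funext t
      simp [simplexMap, h]
    rw [this]
    exact continuous_const

theorem exists_maximal_coord (y : K.Realization) : ∃ v, 0 < y.1 v ∧ ∀ w, y.1 w ≤ y.1 v := by
  obtain ⟨s, hs, h0, h1⟩ := y.2.2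
  obtain ⟨v, hv, hmax⟩ := s.exists_max_image y.1 (K.isRelLowerSet_faces hs).1
  have hmax' : ∀ w, y.1 w ≤ y.1 v := by
    intro w
    by_cases hw : w ∈ s
    · exact hmax w hw
    · rw [h0 w hw]
      exact y.nonneg v
  refine ⟨v, (y.nonneg v).lt_of_ne fun h => ?_, hmax'⟩
  have : ∑ v ∈ s, y.1 v = 0 :=
    Finset.sum_eq_zero fun w _ => le_antisymm ((hmax' w).trans h.ge) (y.nonneg w)
  linarith

/-- A vertex with maximal barycentric coordinate. -/
def topVertex (y : K.Realization) : V := y.exists_maximal_coord.choose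

theorem topVertex_pos (y : K.Realization) : 0 < y.1 y.topVertex :=
  y.exists_maximal_coord.choose_spec.1

theorem le_topVertex (y : K.Realization) (w : V) : y.1 w ≤ y.1 y.topVertex :=
  y.exists_maximal_coord.choose_spec.2 w

/-- The vertex of largest coordinate is not continuous in `y`, but near `y` it stays in one face `s`
containing the support of `y`. Where more than `1 - 1/(|s| + 1)` of the mass lies on `s`, a vertex
outside `s` has coordinate below `1/(|s| + 1)`; were it the largest, the mass on `s` would be less
than `|s|/(|s| + 1)`, a contradiction. -/
theorem exists_isOpen_topVertex_mem (y : K.Realization) :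
    ∃ U : Set K.Realization, IsOpen U ∧ y ∈ U ∧ ∃ s ∈ K.faces, ∀ y' ∈ U, y'.topVertex ∈ s := by
  classical
  obtain ⟨s, hs, h0, h1⟩ := y.2.2
  refine ⟨{y' | 1 - 1 / ((s.card : ℝ) + 1) < ∑ v ∈ s, y'.1 v},
    isOpen_lt continuous_const (continuous_finsetSum s fun v _ => continuous_coord v), ?_,
    s, hs, fun y' hy' => ?_⟩
  · rw [Set.mem_ofPred_eq, h1]
    have : 0 < 1 / ((s.card : ℝ) + 1) := by positivity
    linarith
  · by_contra hw
    rw [Set.mem_ofPred_eq] at hy'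
    have ha := y'.sum_le_one (insert y'.topVertex s)
    rw [Finset.sum_insert hw] at ha
    have hb : ∑ v ∈ s, y'.1 v ≤ s.card * y'.1 y'.topVertex := by
      simpa using Finset.sum_le_card_nsmul s y'.1 _ fun v _ => y'.le_topVertex v
    have hc : y'.1 y'.topVertex < 1 / ((s.card : ℝ) + 1) := by linarith
    have hd : (s.card : ℝ) * y'.1 y'.topVertex ≤ s.card * (1 / ((s.card : ℝ) + 1)) :=
      mul_le_mul_of_nonneg_left hc.le (by positivity)
    have he : (s.card : ℝ) * (1 / ((s.card : ℝ) + 1)) = 1 - 1 / ((s.card : ℝ) + 1) := by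
      field_simp
      ring
    linarith

end Realization

/-- The cone with apex `0` over the simplex spanned by `s`. -/
def coneSet (s : Finset V) : Set (V →₀ ℝ) :=
  {x | (∀ v, 0 ≤ x v) ∧ (∀ v ∉ s, x v = 0) ∧ ∑ v ∈ s, x v ≤ 1}

/-- The simplex spanned by `s`. -/
def simplexSet (s : Finset V) : Set (V →₀ ℝ) :=
  {x | (∀ v, 0 ≤ x v) ∧ (∀ v ∉ s, x v = 0) ∧ ∑ v ∈ s, x v = 1}

theorem convex_coneSet (s : Finset V) : Convex ℝ (coneSet s) := by
  intro x hx y hy a b ha hb hab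
  refine ⟨fun v => ?_, fun v hv => ?_, ?_⟩
  · have := hx.1 v
    have := hy.1 v
    simp only [Finsupp.add_apply, Finsupp.smul_apply, smul_eq_mul]
    positivity
  · simp [hx.2.1 v hv, hy.2.1 v hv]
  · simp only [Finsupp.add_apply, Finsupp.smul_apply, smul_eq_mul, Finset.sum_add_distrib,
      ← Finset.mul_sum]
    nlinarith [hx.2.2, hy.2.2]

theorem convex_simplexSet (s : Finset V) : Convex ℝ (simplexSet s) := by
  intro x hx y hy a b ha hb hab
  refine ⟨fun v => ?_, fun v hv => ?_, ?_⟩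
  · have := hx.1 v
    have := hy.1 v
    simp only [Finsupp.add_apply, Finsupp.smul_apply, smul_eq_mul]
    positivity
  · simp [hx.2.1 v hv, hy.2.1 v hv]
  · simp only [Finsupp.add_apply, Finsupp.smul_apply, smul_eq_mul, Finset.sum_add_distrib,
      ← Finset.mul_sum, hx.2.2, hy.2.2]
    linarith

theorem single_mem_simplexSet {s : Finset V} {v : V} (hv : v ∈ s) :
    Finsupp.single v 1 ∈ simplexSet s := by
  classical
  refine ⟨fun w => ?_, fun w hw => ?_, ?_⟩
  · rw [Finsupp.single_apply]
    split_ifs <;> norm_num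
  · exact Finsupp.single_eq_of_ne fun h => hw (h ▸ hv)
  · simp [Finsupp.single_apply, hv]

theorem le_one_of_mem_coneSet {s : Finset V} {x : V →₀ ℝ} (hx : x ∈ coneSet s) (v : V) :
    x v ≤ 1 := by
  by_cases hv : v ∈ s
  · exact (Finset.single_le_sum (fun w _ => hx.1 w) hv).trans hx.2.2
  · rw [hx.2.1 v hv]
    exact zero_le_one

/-- The sum of the coordinates. -/
def total (x : V →₀ ℝ) : ℝ := x.sum fun _ r => r

theorem total_eq_sum {x : V →₀ ℝ} {s : Finset V} (h : ∀ v ∉ s, x v = 0) :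
    total x = ∑ v ∈ s, x v :=
  Finsupp.sum_of_support_subset _ (fun v hv => by
    by_contra hvs
    exact (Finsupp.mem_support_iff.mp hv) (h v hvs)) _ (by simp)

open Classical in
/-- The point of the realization with barycentric coordinates `x`, or `p` if there is none. -/
def toRealization (p : K.Realization) (x : V →₀ ℝ) : K.Realization :=
  if h : ∃ y : K.Realization, y.1 = x then h.choose else p

theorem toRealization_val {p : K.Realization} {s : Finset V} (hs : s ∈ K.faces) {x : V →₀ ℝ}
    (hx : x ∈ simplexSet s) : (toRealization p x).1 = x := by
  have h : ∃ y : K.Realization, y.1 = x := ⟨⟨x, hx.1, s, hs, hx.2⟩, rfl⟩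
  rw [toRealization, dif_pos h, h.choose_spec]

/-! ### The contraction as a continuous map on cones over simplices -/

section Contraction

variable {p : K.Realization}
  (H : (ContinuousMap.id K.Realization).Homotopy (ContinuousMap.const _ p))

/-- The map from the cone over the realization to the realization given by a contraction. -/
def coneMap (x : V →₀ ℝ) : K.Realization :=
  H (Set.projIcc 0 1 zero_le_one (1 - total x), toRealization p ((total x)⁻¹ • x))

theorem coneMap_of_mem_simplexSet {s : Finset V} (hs : s ∈ K.faces) {x : V →₀ ℝ}
    (hx : x ∈ simplexSet s) : (coneMap H x).1 = x := by
  have h1 : total x = 1 := by rw [total_eq_sum hx.2.1, hx.2.2]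
  have h2 : Set.projIcc (0 : ℝ) 1 zero_le_one 0 = 0 := Set.projIcc_left _
  rw [coneMap, h1, sub_self, inv_one, one_smul, h2]
  simpa using toRealization_val hs hx

/-- The vertex assigned to a point of the cone. -/
def coneVertex (x : V →₀ ℝ) : V := (coneMap H x).topVertex

theorem coneVertex_mem {s : Finset V} (hs : s ∈ K.faces) {x : V →₀ ℝ} (hx : x ∈ simplexSet s) :
    coneVertex H x ∈ s := by
  by_contra h
  have := (coneMap H x).topVertex_pos
  rw [coneMap_of_mem_simplexSet H hs hx] at this
  exact this.ne' (hx.2.1 _ h)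

/-- A vertex is itself a face, and the contraction starts at the identity. Hence pushing a chain of
vertices forward along `coneVertex` returns that chain. -/
theorem coneVertex_single (v : V) : coneVertex H (Finsupp.single v 1) = v := by
  simpa using coneVertex_mem H (K.singleton_mem_faces v)
    (single_mem_simplexSet (Finset.mem_singleton_self v))

open Classical in
/-- The extension by zero of a function on a finite set. -/
def extend (s : Finset V) (x : s → ℝ) : V →₀ ℝ :=
  Finsupp.onFinset s (fun v => if h : v ∈ s then x ⟨v, h⟩ else 0) fun v hv => by
    by_contra h
    simp [h] at hv

theorem extend_apply_mem (s : Finset V) (x : s → ℝ) (v : s) : extend s x v = x v := by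
  simp [extend]

theorem extend_apply_of_notMem (s : Finset V) (x : s → ℝ) {v : V} (hv : v ∉ s) :
    extend s x v = 0 := by
  simp [extend, hv]

theorem sum_extend (s : Finset V) (x : s → ℝ) : ∑ v ∈ s, extend s x v = ∑ v, x v := by
  rw [← Finset.sum_coe_sort]
  exact Finset.sum_congr rfl fun v _ => extend_apply_mem s x v

theorem extend_restrict {s : Finset V} {x : V →₀ ℝ} (hx : ∀ v ∉ s, x v = 0) :
    extend s (fun v => x v) = x := by
  ext v
  by_cases hv : v ∈ s
  · exact extend_apply_mem s _ ⟨v, hv⟩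
  · rw [extend_apply_of_notMem s _ hv, hx v hv]

theorem extend_mem_simplexSet {s : Finset V} {x : s → ℝ} (hx : x ∈ stdSimplex ℝ s) :
    extend s x ∈ simplexSet s := by
  refine ⟨fun v => ?_, fun v hv => extend_apply_of_notMem s x hv, by rw [sum_extend, hx.2]⟩
  by_cases hv : v ∈ s
  · rw [extend_apply_mem s x ⟨v, hv⟩]
    exact hx.1 _
  · rw [extend_apply_of_notMem s x hv]

theorem coneMap_smul_extend (s : K.faces) (r : unitInterval) (x : stdSimplex ℝ (s : Finset V)) :
    coneMap H (extend (s : Finset V) ((r : ℝ) • x.1)) = H (unitInterval.symm r, K.simplexMap s x) := by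
  have hsm : extend (s : Finset V) ((r : ℝ) • x.1) = (r : ℝ) • extend (s : Finset V) x.1 := by
    ext v
    by_cases hv : v ∈ (s : Finset V)
    · simp [extend, hv]
    · simp [extend, hv]
  have ht : total (extend (s : Finset V) ((r : ℝ) • x.1)) = r := by
    rw [total_eq_sum fun v hv => extend_apply_of_notMem _ _ hv, sum_extend]
    simp only [Pi.smul_apply, smul_eq_mul, ← Finset.mul_sum]
    rw [x.2.2, mul_one]
  have hp : Set.projIcc (0 : ℝ) 1 zero_le_one (1 - r) = unitInterval.symm r :=
    Set.projIcc_of_mem zero_le_one (unitInterval.symm r).2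
  rw [coneMap, ht, hp]
  -- At the apex `r = 0` the value of `toRealization` is its default, which is harmless because the
  -- contraction at time `1` is constant.
  by_cases hr : (r : ℝ) = 0
  · have : r = 0 := Subtype.ext hr
    subst this
    simp
  · congr 2
    rw [hsm, smul_smul, inv_mul_cancel₀ hr, one_smul]
    refine Subtype.ext ?_
    rw [toRealization_val s.2 (extend_mem_simplexSet x.2)]
    rfl

/-- The cone over a simplex as a space. -/
abbrev ConeSpace (s : Finset V) : Type u := {x : s → ℝ // (∀ v, 0 ≤ x v) ∧ ∑ v, x v ≤ 1}

/-- The quotient map from the cylinder to the cone. -/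
def cylinderToCone (s : Finset V) (y : unitInterval × stdSimplex ℝ s) : ConeSpace s :=
  ⟨(y.1 : ℝ) • y.2.1, fun v => mul_nonneg y.1.2.1 (y.2.2.1 v), by
    simp only [Pi.smul_apply, smul_eq_mul, ← Finset.mul_sum]
    rw [y.2.2.2, mul_one]
    exact y.1.2.2⟩

theorem continuous_cylinderToCone (s : Finset V) : Continuous (cylinderToCone s) := by
  unfold cylinderToCone
  fun_prop

theorem surjective_cylinderToCone {s : Finset V} (hs : s.Nonempty) :
    Function.Surjective (cylinderToCone s) := by
  classical
  intro x
  by_cases h : ∑ v, x.1 v = 0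
  · obtain ⟨v, hv⟩ := hs
    refine ⟨(0, ⟨Pi.single ⟨v, hv⟩ 1, single_mem_stdSimplex ℝ _⟩), Subtype.ext (funext fun w => ?_)⟩
    have := (Finset.sum_eq_zero_iff_of_nonneg fun w _ => x.2.1 w).mp h w (Finset.mem_univ w)
    simp [cylinderToCone, this]
  · have hpos : 0 < ∑ v, x.1 v := (Finset.sum_nonneg fun v _ => x.2.1 v).lt_of_ne (Ne.symm h)
    refine ⟨(⟨∑ v, x.1 v, hpos.le, x.2.2⟩, ⟨(∑ v, x.1 v)⁻¹ • x.1, fun v => ?_, ?_⟩),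
      Subtype.ext ?_⟩
    · exact mul_nonneg (inv_nonneg.mpr hpos.le) (x.2.1 v)
    · simp only [Pi.smul_apply, smul_eq_mul, ← Finset.mul_sum]
      exact inv_mul_cancel₀ h
    · change (∑ v, x.1 v) • (∑ v, x.1 v)⁻¹ • x.1 = x.1
      rw [smul_smul, mul_inv_cancel₀ h, one_smul]

theorem compactSpace_coneSpace {s : Finset V} (hs : s.Nonempty) : CompactSpace (ConeSpace s) :=
  (surjective_cylinderToCone hs).compactSpace (continuous_cylinderToCone s)

/-- Division by the total is problematic only at the apex. The cylinder over the simplex maps onto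
the cone by a quotient map, being a continuous surjection from a compact space to a Hausdorff space,
and on the cylinder the map is the contraction itself. -/
theorem continuous_coneMap_extend (s : K.faces) :
    Continuous fun x : ConeSpace (s : Finset V) => coneMap H (extend (s : Finset V) x.1) := by
  have hs := (K.isRelLowerSet_faces s.2).1
  have hq : IsQuotientMap (cylinderToCone (s : Finset V)) :=
    (continuous_cylinderToCone _).isClosedMap.isQuotientMap (continuous_cylinderToCone _)
      (surjective_cylinderToCone hs)
  rw [hq.continuous_iff]
  have : (fun x : ConeSpace (s : Finset V) => coneMap H (extend (s : Finset V) x.1)) ∘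
      cylinderToCone (s : Finset V) = fun y => H (unitInterval.symm y.1, K.simplexMap s y.2) :=
    funext fun y => coneMap_smul_extend H s y.1 y.2
  rw [this]
  have hc : Continuous (K.simplexMap s) :=
    continuous_iff_coinduced_le.mpr (le_iSup
      (fun s : K.faces => TopologicalSpace.coinduced (K.simplexMap s) inferInstance) s)
  fun_prop

/-- Here `δ` is a Lebesgue number of the compact cone for the preimages of the open sets on which
the top vertex stays in one face. -/
theorem exists_coneVertex_comp_mem_faceTuples {s : Finset V} (hs : s ∈ K.faces) :
    ∃ δ > 0, ∀ (n : ℕ) (t : Fin n → V →₀ ℝ), (∀ i, t i ∈ coneSet s) →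
      (∀ v i j, |t i v - t j v| < δ) → coneVertex H ∘ t ∈ K.faceTuples n := by
  have hne := (K.isRelLowerSet_faces hs).1
  have := compactSpace_coneSpace hne
  choose U hUo hUmem σ hσ hUσ using fun y : K.Realization => y.exists_isOpen_topVertex_mem
  have hc := continuous_coneMap_extend H ⟨s, hs⟩
  obtain ⟨δ, hδ, hL⟩ := lebesgue_number_lemma_of_metric
    (c := fun y => (fun x : ConeSpace s => coneMap H (extend (s : Finset V) x.1)) ⁻¹' U y)
    isCompact_univ (fun y => (hUo y).preimage hc)
    (fun x _ => Set.mem_iUnion.mpr ⟨_, hUmem _⟩)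
  refine ⟨δ, hδ, fun n t ht hd => ?_⟩
  cases n with
  | zero => exact ⟨s, hs, fun i => i.elim0⟩
  | succ n =>
    let x : Fin (n + 1) → ConeSpace s := fun i => ⟨fun v => t i v, fun v => (ht i).1 v, by
      rw [Finset.sum_coe_sort s fun v => t i v]
      exact (ht i).2.2⟩
    obtain ⟨y, hy⟩ := hL (x 0) trivial
    refine ⟨σ y, hσ y, fun i => ?_⟩
    have hxi : x i ∈ Metric.ball (x 0) δ := by
      rw [Metric.mem_ball, Subtype.dist_eq, dist_pi_lt_iff hδ]
      exact fun v => hd v i 0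
    have := hUσ y _ (hy hxi)
    change (coneMap H (extend s fun v => t i v)).topVertex ∈ σ y at this
    rwa [extend_restrict (ht i).2.1] at this

end Contraction

/-! ### Simplicial approximation of the cone over a cycle -/

open OrdChain

/-- Realize `z` by affine simplices, cone it off at `0`, subdivide until all simplices are small,
and replace each point by its `coneVertex`. This yields a chain of `K` bounding the image of the
subdivided `z`. The image of the subdivision homotopy, which stays inside the simplices of `z`,
connects this with `z`. The complex is augmented, so connectedness is the case `n = 0`. -/
theorem exists_bd_eq_of_contractible (hK : ContractibleSpace K.Realization) {n : ℕ}
    {z : OrdChain V (n + 1)} (hz : z ∈ supp (K.faceTuples (n + 1))) (hbd : bd n z = 0) :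
    ∃ a ∈ supp (K.faceTuples (n + 2)), bd (n + 1) a = z := by
  obtain ⟨p, ⟨H⟩⟩ := id_nullhomotopic K.Realization
  let 𝒞 : Set (Set (V →₀ ℝ)) := simplexSet '' K.faces
  have h𝒞 : ∀ C ∈ 𝒞, Convex ℝ C := by
    rintro _ ⟨s, _, rfl⟩
    exact convex_simplexSet s
  let e : V → V →₀ ℝ := fun v => Finsupp.single v 1
  have hez : map e z ∈ supp (carried 𝒞 (n + 1)) := by
    refine map_mem ?_ hz
    rintro t ⟨s, hs, ht⟩
    exact ⟨_, ⟨s, hs, rfl⟩, fun i => single_mem_simplexSet (ht i)⟩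
  have hezbd : bd n (map e z) = 0 := by rw [← map_bd, hbd, map_zero]
  let w : OrdChain (V →₀ ℝ) (n + 2) := cone 0 (map e z)
  have hw : w ∈ supp {t : Fin (n + 2) → V →₀ ℝ | ∃ s ∈ K.faces, ∀ i, t i ∈ coneSet s} := by
    refine cone_mem ?_ hez
    rintro t ⟨_, ⟨s, hs, rfl⟩, ht⟩
    refine ⟨s, hs, Fin.cases ?_ fun i => ?_⟩
    · simp [coneSet]
    · exact ⟨(ht i).1, (ht i).2.1, (ht i).2.2.le⟩
  have hwbd : bd (n + 1) w = map e z := bd_cone_of_bd_eq_zero 0 hezbd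
  have hsmall : ∀ t ∈ w.support, ∃ m₀, ∀ m ≥ m₀,
      map (coneVertex H) ((sd (n + 2) ^ m) (of t)) ∈ supp (K.faceTuples (n + 2)) := by
    intro t ht
    obtain ⟨s, hs, hts⟩ := hw ht
    obtain ⟨δ, hδ, hface⟩ := exists_coneVertex_comp_mem_faceTuples H hs
    have hlt : ((n + 1 : ℕ) : ℝ) / ((n + 1 : ℕ) + 1) < 1 := by
      rw [div_lt_one (by positivity)]
      linarith
    obtain ⟨m₀, hm₀⟩ := exists_pow_lt_of_lt_one hδ hlt
    refine ⟨m₀, fun m hm => ?_⟩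
    have hlt' : (((n + 1 : ℕ) : ℝ) / ((n + 1 : ℕ) + 1)) ^ m * 1 < δ := by
      rw [mul_one]
      exact (pow_le_pow_of_le_one (by positivity) hlt.le hm).trans_lt hm₀
    have h1 : (sd (n + 2) ^ m) (of t) ∈ supp (tuples (coneSet s) (n + 2)) :=
      iterate_sd_mem_tuples (convex_coneSet s) (of_mem hts) m
    -- All coordinates on the cone lie in `[0, 1]`, so the initial width in each coordinate is at
    -- most `1`.
    have h2 : ∀ v, (sd (n + 2) ^ m) (of t) ∈ supp (thin (Finsupp.lapply v)
        ((((n + 1 : ℕ) : ℝ) / ((n + 1 : ℕ) + 1)) ^ m * 1) (n + 2)) := fun v => by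
      refine iterate_sd_of_mem_thin zero_le_one (fun i j => ?_) m
      have := (hts i).1 v
      have := (hts j).1 v
      have := le_one_of_mem_coneSet (hts i) v
      have := le_one_of_mem_coneSet (hts j) v
      simp only [Finsupp.lapply_apply]
      rw [abs_le]
      constructor <;> linarith
    refine map_mem (S := ((sd (n + 2) ^ m) (of t)).support) (fun t' ht' => ?_)
      (Finsupp.mem_supported_support ℤ _)
    exact hface _ t' (h1 ht') fun v i j => (h2 v ht' i j).trans_lt hlt'
  choose! M hM using hsmall
  -- The number of subdivisions needed depends on the simplex, but `w` has only finitely many.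
  let m := w.support.sup M
  have hsdw : map (coneVertex H) ((sd (n + 2) ^ m) w) ∈ supp (K.faceTuples (n + 2)) :=
    map_mem_of_mem_supported (map (coneVertex H) ∘ₗ (sd (n + 2) ^ m))
      (fun t ht => hM t ht m (Finset.le_sup ht)) (Finsupp.mem_supported_support ℤ w)
  obtain ⟨a, ha, hab⟩ := exists_bd_eq_sub_iterate_sd h𝒞 hez hezbd m
  have ha' : map (coneVertex H) a ∈ supp (K.faceTuples (n + 2)) := by
    refine map_mem ?_ ha
    rintro t ⟨_, ⟨s, hs, rfl⟩, ht⟩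
    exact ⟨s, hs, fun i => coneVertex_mem H hs (ht i)⟩
  refine ⟨map (coneVertex H) ((sd (n + 2) ^ m) w) + map (coneVertex H) a,
    Submodule.add_mem _ hsdw ha', ?_⟩
  have hez' : map (coneVertex H) (map e z) = z := by
    rw [map_map, show coneVertex H ∘ e = id from funext fun v => coneVertex_single H v, map_id]
  rw [map_add, ← map_bd, ← map_bd, bd_iterate_sd, hwbd, hab, map_sub, hez']
  abel

end AbstractSimplicialComplex

/-! ## Sorting the vertices of ordered chains -/

namespace OrdChain

variable {V : Type*} [LinearOrder V] {n : ℕ}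

/-- The smallest entry of a tuple. -/
def minEntry (t : Fin (n + 1) → V) : V := Finset.univ.inf' Finset.univ_nonempty t

theorem minEntry_le (t : Fin (n + 1) → V) (i : Fin (n + 1)) : minEntry t ≤ t i :=
  Finset.inf'_le _ (Finset.mem_univ i)

theorem minEntry_mem {U : Set V} {t : Fin (n + 1) → V} (ht : t ∈ tuples U (n + 1)) :
    minEntry t ∈ U := by
  obtain ⟨i, -, hi⟩ := Finset.exists_mem_eq_inf' (Finset.univ_nonempty (α := Fin (n + 1))) t
  rw [minEntry, hi]
  exact ht i

open Classical in
/-- The cone with apex `m` on the tuples with entries greater than `m`, and `0` on all others. -/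
def minCone (m : V) : OrdChain V n →ₗ[ℤ] OrdChain V (n + 1) :=
  lift fun t => if t ∈ tuples (Set.Ioi m) n then of (Fin.cons m t) else 0

theorem minCone_of_mem {m : V} {t : Fin n → V} (h : t ∈ tuples (Set.Ioi m) n) :
    minCone m (of t) = cone m (of t) := by
  rw [minCone, lift_of, if_pos h, cone_of]

theorem minCone_eq_cone {m : V} {c : OrdChain V n} (hc : c ∈ supp (tuples (Set.Ioi m) n)) :
    minCone m c = cone m c := by
  have : c ∈ LinearMap.eqLocus (minCone m) (cone m) :=
    map_mem_of_mem_supported (N := LinearMap.eqLocus (minCone m) (cone m)) LinearMap.id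
      (fun t ht => minCone_of_mem ht) hc
  exact this

theorem minCone_cone (m : V) (c : OrdChain V n) : minCone m (cone m c) = 0 := by
  have : minCone m ∘ₗ cone m = (0 : OrdChain V n →ₗ[ℤ] OrdChain V (n + 2)) := hom_ext fun t => by
    rw [LinearMap.comp_apply, cone_of, minCone, lift_of, if_neg]
    · rfl
    · intro h
      exact lt_irrefl m (h 0)
  exact LinearMap.congr_fun this c

theorem lOne_minCone_le (m : V) (c : OrdChain V n) : lOne (minCone m c) ≤ lOne c := by
  simpa using lOne_linearMap_le (minCone m) c 1 fun t _ => by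
    rw [show Finsupp.single t (1 : ℤ) = of t from rfl, minCone, lift_of]
    split_ifs <;> simp

/-- The strictly increasing tuples with entries in `U`. -/
def sortedTuples (U : Set V) (n : ℕ) : Set (Fin n → V) := {t | StrictMono t ∧ t ∈ tuples U n}

theorem minCone_mem_sortedTuples {U : Set V} {m : V} (hm : m ∈ U) {c : OrdChain V n}
    (hc : c ∈ supp (sortedTuples U n)) : minCone m c ∈ supp (sortedTuples U (n + 1)) := by
  refine map_mem_of_mem_supported _ (fun t ht => ?_) hc
  rw [show Finsupp.single t (1 : ℤ) = of t from rfl, minCone, lift_of]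
  split_ifs with h
  · refine of_mem ⟨?_, cons_mem_tuples hm ht.2⟩
    intro i j
    refine Fin.cases ?_ (fun i => ?_) i <;> refine Fin.cases ?_ (fun j => ?_) j
    · simp
    · intro _
      simpa using h j
    · simp
    · simpa using fun hij => ht.1 hij
  · exact Submodule.zero_mem _

/-- On increasing tuples with entries at least `m`, `bd ∘ minCone + minCone ∘ bd = id`. If the first
entry exceeds `m`, this is the ordinary cone formula. If it equals `m`, then `minCone` kills the
tuple and recovers it from its tail, while the other faces, still starting with `m`, are killed. -/
theorem bd_minCone {m : V} {c : OrdChain V n}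
    (hc : c ∈ supp (sortedTuples (Set.Ici m) n)) (h : IsCycle c) : bd n (minCone m c) = c := by
  cases n with
  | zero =>
    rw [minCone_eq_cone (Finsupp.supported_mono (fun t _ i => i.elim0) hc)]
    exact bd_cone_zero m c
  | succ n =>
    suffices hs : c ∈ LinearMap.eqLocus (bd (n + 1) ∘ₗ minCone m)
        (LinearMap.id - minCone m ∘ₗ bd n) by
      have h' : bd (n + 1) (minCone m c) = c - minCone m (bd n c) := hs
      rwa [show bd n c = 0 from h, map_zero, sub_zero] at h'
    refine map_mem_of_mem_supported (N := LinearMap.eqLocus (bd (n + 1) ∘ₗ minCone m)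
        (LinearMap.id - minCone m ∘ₗ bd n)) LinearMap.id (fun t ht => ?_) hc
    change bd (n + 1) (minCone m (of t)) = of t - minCone m (bd n (of t))
    rcases (ht.2 0 : m ≤ t 0).lt_or_eq with h0 | h0
    · have htm : t ∈ tuples (Set.Ioi m) (n + 1) := fun i =>
        h0.trans_le (ht.1.monotone (Fin.zero_le i))
      rw [minCone_of_mem htm, minCone_eq_cone (bd_mem_tuples (of_mem htm)), bd_cone]
    · have htail : Fin.tail t ∈ tuples (Set.Ioi m) n := fun i => by
        rw [Set.mem_Ioi, h0]
        exact ht.1 (Fin.succ_pos i)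
      have hcons : of t = cone m (of (Fin.tail t)) := by
        rw [cone_of, h0, Fin.cons_self_tail]
      rw [hcons, minCone_cone, map_zero]
      cases n with
      | zero => rw [bd_cone_zero, minCone_of_mem htail, sub_self]
      | succ n => rw [bd_cone, map_sub, minCone_cone, minCone_of_mem htail, sub_zero, sub_self]

/-- The chain map that replaces a tuple by a signed strictly increasing tuple. -/
def sort : ∀ n : ℕ, OrdChain V n →ₗ[ℤ] OrdChain V n
  | 0 => LinearMap.id
  | n + 1 => lift fun t => minCone (minEntry t) (sort n (bd n (of t)))

theorem sort_of (t : Fin (n + 1) → V) :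
    sort (n + 1) (of t) = minCone (minEntry t) (sort n (bd n (of t))) := by
  rw [sort, lift_of]

theorem sort_mem {U : Set V} {c : OrdChain V n} (hc : c ∈ supp (tuples U n)) :
    sort n c ∈ supp (sortedTuples U n) := by
  induction n with
  | zero => exact supp_mono hc fun t ht => ⟨fun i => i.elim0, ht⟩
  | succ n ih =>
    refine map_mem_of_mem_supported _ (fun t ht => ?_) hc
    rw [sort_of]
    exact minCone_mem_sortedTuples (minEntry_mem ht) (ih (bd_mem_tuples (of_mem ht)))

theorem sort_mem_tuples {U : Set V} {c : OrdChain V n} (hc : c ∈ supp (tuples U n)) :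
    sort n c ∈ supp (tuples U n) :=
  Finsupp.supported_mono (fun _ ht => ht.2) (sort_mem hc)

/-- The sorted boundary of `t` has entries at least `minEntry t` and is a cycle by the same identity
one degree lower, so `minCone` fills it. -/
theorem bd_sort (c : OrdChain V (n + 1)) : bd n (sort (n + 1) c) = sort n (bd n c) := by
  suffices h : ∀ n, bd n ∘ₗ sort (n + 1) = sort n ∘ₗ bd (X := V) n from
    LinearMap.congr_fun (h n) c
  intro n
  refine hom_ext fun t => ?_
  rw [LinearMap.comp_apply, LinearMap.comp_apply, sort_of]
  have ht : t ∈ tuples (Set.Ici (minEntry t)) (n + 1) := minEntry_le t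
  refine bd_minCone (sort_mem (bd_mem_tuples (of_mem ht))) ?_
  induction n with
  | zero => trivial
  | succ n ih =>
    have ih' : bd n ∘ₗ sort (n + 1) = sort n ∘ₗ bd (X := V) n := hom_ext fun t => by
      rw [LinearMap.comp_apply, LinearMap.comp_apply, sort_of]
      have ht : t ∈ tuples (Set.Ici (minEntry t)) (n + 1) := minEntry_le t
      exact bd_minCone (sort_mem (bd_mem_tuples (of_mem ht))) (ih t ht)
    have := LinearMap.congr_fun ih' (bd (n + 1) (of t))
    simpa only [LinearMap.comp_apply, bd_bd, map_zero] using! this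

theorem lOne_sort_le (c : OrdChain V n) : lOne (sort n c) ≤ n.factorial * lOne c := by
  induction n with
  | zero => simp [sort]
  | succ n ih =>
    refine lOne_linearMap_le _ _ _ fun t _ => ?_
    rw [show Finsupp.single t (1 : ℤ) = of t from rfl, sort_of]
    have h : lOne (bd n (of t)) ≤ n + 1 := by simpa using lOne_bd_le (of t)
    calc _ ≤ n.factorial * lOne (bd n (of t)) := (lOne_minCone_le _ _).trans (ih _)
      _ ≤ n.factorial * (n + 1) := Nat.mul_le_mul_left _ h
      _ = (n + 1).factorial := by rw [Nat.factorial_succ, mul_comm]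

/-- The chain homotopy between the identity and `sort`. -/
abbrev sortHomotopy : ∀ n : ℕ, OrdChain V n →ₗ[ℤ] OrdChain V (n + 1) :=
  coneHomotopy sort fun _ t => t 0

end OrdChain

/-! ## Oriented and ordered simplicial chains -/

namespace AbstractSimplicialComplex

open OrdChain

variable {V : Type u} [LinearOrder V] (K : AbstractSimplicialComplex V)

/-- The strictly increasing tuple of the vertices of a simplex. -/
def Simplex.tuple {K : AbstractSimplicialComplex V} {N : ℕ} (s : K.Simplex N) : Fin (N + 1) → V :=
  s.1.orderEmbOfFin s.2.2

/-- The inclusion of the oriented chains into the ordered chains. -/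
def toOrdChain (N : ℕ) : K.Chain N →ₗ[ℤ] OrdChain V (N + 1) :=
  Finsupp.lmapDomain ℤ ℤ Simplex.tuple

theorem toOrdChain_single {N : ℕ} (s : K.Simplex N) :
    K.toOrdChain N (Finsupp.single s 1) = of s.tuple := by
  simp [toOrdChain]

theorem toOrdChain_injective (N : ℕ) : Function.Injective (K.toOrdChain N) := by
  refine Finsupp.mapDomain_injective fun s t h => Subtype.ext ?_
  have h' := congrArg Set.range h
  simpa [Simplex.tuple] using h'

variable {K} in
theorem Simplex.removeNth_tuple {N : ℕ} (s : K.Simplex (N + 1)) (i : Fin (N + 2)) :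
    i.removeNth s.tuple = (s.face ⟨s.tuple i, Finset.orderEmbOfFin_mem _ _ _⟩).tuple := by
  refine Finset.orderEmbOfFin_unique _ (fun j => ?_) ?_
  · refine Finset.mem_erase.mpr ⟨fun h => ?_, Finset.orderEmbOfFin_mem _ _ _⟩
    exact Fin.succAbove_ne i j ((s.1.orderEmbOfFin s.2.2).injective h)
  · exact (s.1.orderEmbOfFin s.2.2).strictMono.comp (Fin.strictMono_succAbove i)

variable {K} in
theorem Simplex.card_filter_lt {N : ℕ} (s : K.Simplex N) (i : Fin (N + 1)) :
    (s.1.filter (· < s.tuple i)).card = i := by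
  have : s.1.filter (· < s.tuple i) =
      (Finset.Iio i).map (s.1.orderEmbOfFin s.2.2).toEmbedding := by
    ext v
    simp only [Finset.mem_filter, Finset.mem_map, Finset.mem_Iio]
    constructor
    · rintro ⟨hv, hlt⟩
      have hv' : v ∈ Set.range (s.1.orderEmbOfFin s.2.2) := by simpa using hv
      obtain ⟨j, rfl⟩ := hv'
      exact ⟨j, (s.1.orderEmbOfFin s.2.2).lt_iff_lt.mp hlt, rfl⟩
    · rintro ⟨j, hj, rfl⟩
      exact ⟨Finset.orderEmbOfFin_mem _ _ _, (s.1.orderEmbOfFin s.2.2).lt_iff_lt.mpr hj⟩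
  rw [this, Finset.card_map, Fin.card_Iio]

theorem toOrdChain_boundary (N : ℕ) (c : K.Chain (N + 1)) :
    K.toOrdChain N (K.boundary N c) = bd (N + 1) (K.toOrdChain (N + 1) c) := by
  suffices h : K.toOrdChain N ∘ₗ K.boundary N = bd (N + 1) ∘ₗ K.toOrdChain (N + 1) from
    LinearMap.congr_fun h c
  refine Finsupp.lhom_ext' fun s => LinearMap.ext_ring ?_
  simp only [LinearMap.comp_apply, Finsupp.lsingle_apply, toOrdChain_single, bd_of, boundary,
    Finsupp.linearCombination_single, one_smul, map_sum, map_smul]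
  refine (Fintype.sum_equiv (s.1.orderIsoOfFin s.2.2).toEquiv _ _ fun i => ?_).symm
  rw [s.removeNth_tuple]
  congr 2
  exact (s.card_filter_lt i).symm

/-- The tuples of vertices of a face in increasing order. -/
def sortedFaceTuples (n : ℕ) : Set (Fin n → V) := {t | ∃ s ∈ K.faces, t ∈ sortedTuples ↑s n}

variable {K}

theorem exists_toOrdChain_eq {N : ℕ} {c : OrdChain V (N + 1)}
    (hc : c ∈ supp (K.sortedFaceTuples (N + 1))) : ∃ β : K.Chain N, K.toOrdChain N β = c := by
  suffices h : c ∈ LinearMap.range (K.toOrdChain N) from h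
  refine map_mem_of_mem_supported (M := OrdChain V (N + 1)) LinearMap.id (fun t ht => ?_) hc
  obtain ⟨s, hs, ht, hts⟩ := ht
  let s' : K.Simplex N := ⟨Finset.univ.map ⟨t, ht.injective⟩,
    (K.isRelLowerSet_faces hs).2 (fun v hv => by
      obtain ⟨i, -, rfl⟩ := Finset.mem_map.mp hv
      exact hts i) (Finset.univ_nonempty.map), by simp⟩
  refine ⟨Finsupp.single s' 1, ?_⟩
  rw [toOrdChain_single, LinearMap.id_apply]
  congr 1
  exact (Finset.orderEmbOfFin_unique _ (fun i => by simp [s']) ht).symm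

theorem chainNorm_eq_lOne {N : ℕ} (c : K.Chain N) : chainNorm c = lOne (K.toOrdChain N c) := by
  have hinj : Function.Injective (Simplex.tuple (K := K) (N := N)) := fun s t h =>
    Subtype.ext (by simpa [Simplex.tuple] using congrArg Set.range h)
  change (c.sum fun _ z => z.natAbs) = (c.mapDomain Simplex.tuple).sum fun _ z => z.natAbs
  rw [Finsupp.sum_mapDomain_index_inj hinj]

theorem sort_mem_sortedFaceTuples {n : ℕ} {c : OrdChain V n} (hc : c ∈ supp (K.faceTuples n)) :
    sort n c ∈ supp (K.sortedFaceTuples n) := by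
  refine map_mem_of_mem_supported _ (fun t ht => ?_) hc
  obtain ⟨s, hs, hts⟩ := ht
  exact supp_mono (sort_mem (U := (s : Set V)) (of_mem hts)) fun t ht => ⟨s, hs, ht⟩

theorem sortHomotopy_mem_faceTuples {n : ℕ} {c : OrdChain V n} (hc : c ∈ supp (K.faceTuples n)) :
    sortHomotopy n c ∈ supp (K.faceTuples (n + 1)) := by
  refine map_mem_of_mem_supported _ (fun t ht => ?_) hc
  obtain ⟨s, hs, hts⟩ := ht
  exact supp_mono (coneHomotopy_mem_tuples (U := (s : Set V)) (fun _ _ ht' => ht' 0)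
    (fun _ _ hc' => sort_mem_tuples hc') (of_mem hts)) fun t ht => ⟨s, hs, ht⟩

theorem toOrdChain_mem_faceTuples {N : ℕ} (c : K.Chain N) :
    K.toOrdChain N c ∈ supp (K.faceTuples (N + 1)) :=
  mapDomain_mem_supported (S := Set.univ) (T := K.faceTuples (N + 1))
    (fun s _ => ⟨s.1, s.2.1, fun _ => Finset.orderEmbOfFin_mem _ _ _⟩) (by simp)

/-- An infimum of natural numbers that is at most `M` is attained: if all fillings had norm at least
`M + 1`, so would the infimum. -/
theorem exists_boundary_eq_chainNorm_le {N k M : ℕ} (h : K.dehnFunction N k ≤ M) {b : K.Chain N}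
    (hb : b ∈ LinearMap.range (K.boundary N)) (hbk : chainNorm b ≤ k) :
    ∃ a, K.boundary N a = b ∧ chainNorm a ≤ M := by
  by_contra! hcon
  have h1 : K.fillingNorm N b ≤ M :=
    (le_iSup_of_le b (le_iSup_of_le hb (le_iSup_of_le (f := fun _ => K.fillingNorm N b) hbk le_rfl))).trans h
  have h2 : ((M + 1 : ℕ) : ℕ∞) ≤ K.fillingNorm N b :=
    le_iInf₂ fun a ha => by exact_mod_cast hcon a ha
  have h3 : ((M + 1 : ℕ) : ℕ∞) ≤ M := h2.trans h1
  have h4 : M + 1 ≤ M := by exact_mod_cast h3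
  omega

/-- Sorting turns `b` into an oriented chain of norm at most `(N + 1)!` times as large. Acyclicity
shows that it is a boundary, so the Dehn function applies. The sorting homotopy, of norm at most `C
* lOne b`, leads back from the sorted chain to `b`. -/
theorem exists_polynomial_filling (hK : ContractibleSpace K.Realization) {N : ℕ}
    {P : Polynomial ℕ} (hP : ∀ k : ℕ, K.dehnFunction N k ≤ ((P.eval k : ℕ) : ℕ∞)) :
    ∃ Q : Polynomial ℕ, ∀ k, ∀ b ∈ supp (K.faceTuples (N + 1)), bd N b = 0 → lOne b ≤ k →
      ∃ a ∈ supp (K.faceTuples (N + 2)), bd (N + 1) a = b ∧ lOne a ≤ Q.eval k := by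
  obtain ⟨C, hC⟩ := exists_lOne_coneHomotopy_le (f := sort (V := V)) (p := fun _ t => t 0)
    (fun n c => lOne_sort_le c) (N + 1)
  refine ⟨P.comp (Polynomial.C (N + 1).factorial * Polynomial.X) +
    Polynomial.C C * Polynomial.X, fun k b hb hbd hbk => ?_⟩
  obtain ⟨z, hz, hzb⟩ := exists_bd_eq_of_contractible hK hb hbd
  obtain ⟨β, hβ⟩ := exists_toOrdChain_eq (sort_mem_sortedFaceTuples hb)
  obtain ⟨ζ, hζ⟩ := exists_toOrdChain_eq (sort_mem_sortedFaceTuples hz)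
  have hβζ : K.boundary N ζ = β := K.toOrdChain_injective N (by
    rw [toOrdChain_boundary, hζ, hβ, bd_sort, hzb])
  have hβk : chainNorm β ≤ (N + 1).factorial * k := by
    rw [chainNorm_eq_lOne, hβ]
    exact (lOne_sort_le b).trans (Nat.mul_le_mul_left _ hbk)
  obtain ⟨α, hα, hαM⟩ := exists_boundary_eq_chainNorm_le (hP _) ⟨ζ, hβζ⟩ hβk
  refine ⟨K.toOrdChain (N + 1) α + sortHomotopy (N + 1) b,
    Submodule.add_mem _ (toOrdChain_mem_faceTuples α) (sortHomotopy_mem_faceTuples hb), ?_, ?_⟩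
  · rw [map_add, ← toOrdChain_boundary, hα, hβ, bd_coneHomotopy rfl fun _ => bd_sort, hbd,
      map_zero]
    abel
  · rw [chainNorm_eq_lOne] at hαM
    simp only [Polynomial.eval_add, Polynomial.eval_comp, Polynomial.eval_mul, Polynomial.eval_C,
      Polynomial.eval_X]
    exact (lOne_add_le _ _).trans
      (Nat.add_le_add hαM ((hC b).trans (Nat.mul_le_mul_left _ hbk)))

end AbstractSimplicialComplex

/-! ## Fillings with controlled support -/

namespace OrdChain

variable {X : Type*} {n : ℕ}

open Classical in
/-- The restriction of chains to the tuples with entries in `U`. -/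
def restrict (U : Set X) : OrdChain X n →ₗ[ℤ] OrdChain X n :=
  lift fun t => if t ∈ tuples U n then of t else 0

theorem restrict_eq_self {U : Set X} {c : OrdChain X n} (hc : c ∈ supp (tuples U n)) :
    restrict U c = c := by
  have : c ∈ LinearMap.eqLocus (restrict U) LinearMap.id :=
    map_mem_of_mem_supported (N := LinearMap.eqLocus (restrict (n := n) U) LinearMap.id)
      LinearMap.id (fun t ht => by
        change restrict U (of t) = of t
        rw [restrict, lift_of, if_pos ht]) hc
  exact this

theorem restrict_eq_zero {U : Set X} {c : OrdChain X (n + 1)}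
    (hc : c ∈ supp (tuples Uᶜ (n + 1))) : restrict U c = 0 := by
  have : c ∈ LinearMap.ker (restrict (n := n + 1) U) :=
    map_mem_of_mem_supported (N := LinearMap.ker (restrict (n := n + 1) U))
      LinearMap.id (fun t ht => by
        change restrict U (of t) = 0
        rw [restrict, lift_of, if_neg fun h => ht 0 (h 0)]) hc
  exact this

theorem restrict_mem_tuples (U : Set X) (c : OrdChain X n) : restrict U c ∈ supp (tuples U n) := by
  refine map_mem_of_mem_supported (S := Set.univ) _ (fun t _ => ?_) (by simp)
  rw [show Finsupp.single t (1 : ℤ) = of t from rfl, restrict, lift_of]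
  split_ifs with h
  · exact of_mem h
  · exact Submodule.zero_mem _

theorem restrict_mem {S : Set (Fin n → X)} (U : Set X) {c : OrdChain X n} (hc : c ∈ supp S) :
    restrict U c ∈ supp S := by
  refine map_mem_of_mem_supported _ (fun t ht => ?_) hc
  rw [show Finsupp.single t (1 : ℤ) = of t from rfl, restrict, lift_of]
  split_ifs with h
  · exact of_mem ht
  · exact Submodule.zero_mem _

theorem lOne_restrict_le (U : Set X) (c : OrdChain X n) : lOne (restrict U c) ≤ lOne c := by
  simpa using lOne_linearMap_le (restrict U) c 1 fun t _ => by
    rw [show Finsupp.single t (1 : ℤ) = of t from rfl, restrict, lift_of]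
    split_ifs <;> simp

/-- Restriction commutes with the boundary if no tuple has entries both in `U` and in its
complement. -/
theorem bd_restrict {U : Set X} {c : OrdChain X (n + 2)}
    (hc : ∀ t ∈ c.support, t ∈ tuples U (n + 2) ∨ t ∈ tuples Uᶜ (n + 2)) :
    bd (n + 1) (restrict U c) = restrict U (bd (n + 1) c) := by
  have : c ∈ LinearMap.eqLocus (bd (n + 1) ∘ₗ restrict U) (restrict U ∘ₗ bd (n + 1)) := by
    refine map_mem_of_mem_supported (N := LinearMap.eqLocus (bd (n + 1) ∘ₗ restrict U)
      (restrict U ∘ₗ bd (n + 1))) LinearMap.id (fun t ht => ?_)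
      (Finsupp.mem_supported_support ℤ c)
    change bd (n + 1) (restrict U (of t)) = restrict U (bd (n + 1) (of t))
    rcases hc t ht with h | h
    · rw [restrict_eq_self (of_mem h), restrict_eq_self (bd_mem_tuples (of_mem h))]
    · rw [restrict_eq_zero (of_mem h), restrict_eq_zero (bd_mem_tuples (of_mem h)), map_zero]
  exact this

/-- Pigeonhole: there are `c.support.card + 1` thresholds `r + j * R`, and a tuple on which `f`
varies by at most `R` can straddle at most one of them. -/
theorem exists_unmixed_level {f : X → ℕ} {R r : ℕ} {c : OrdChain X n}
    (hc : ∀ t ∈ c.support, ∀ i j, f (t i) ≤ f (t j) + R) :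
    ∃ j ≤ c.support.card, ∀ t ∈ c.support, t ∈ tuples {v | f v ≤ r + j * R} n ∨
      t ∈ tuples {v | f v ≤ r + j * R}ᶜ n := by
  by_contra! hcon
  have h : ∀ j : Fin (c.support.card + 1), ∃ t : c.support,
      (∃ i, r + j * R < f (t.1 i)) ∧ ∃ i, f (t.1 i) ≤ r + j * R := by
    intro j
    obtain ⟨t, ht, h1, h2⟩ := hcon j (Nat.lt_succ_iff.mp j.2)
    exact ⟨⟨t, ht⟩, by simpa [tuples] using h1, by simpa [tuples] using h2⟩
  choose T hlt hle using h
  obtain ⟨j, j', hne, heq⟩ := Fintype.exists_ne_map_eq_of_card_lt T (by simp)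
  wlog hjj : j < j' generalizing j j'
  · exact this j' j hne.symm heq.symm (lt_of_le_of_ne (not_lt.mp hjj) hne.symm)
  obtain ⟨i, hi⟩ := hle j
  obtain ⟨i', hi'⟩ := hlt j'
  rw [← heq] at hi'
  have h1 := hc _ (T j).2 i' i
  have h2 : ((j : ℕ) + 1) * R ≤ j' * R := Nat.mul_le_mul_right R hjj
  rw [add_mul, one_mul] at h2
  omega

/-- Discard the part of the filling above an unmixed level. This commutes with the boundary, which
already lies below the level. The level is at most `r + lOne a * R` because the support has at most
`lOne a` elements. -/
theorem exists_bd_eq_mem_tuples {S : Set (Fin (n + 2) → X)} {f : X → ℕ} {R r : ℕ}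
    (hS : ∀ t ∈ S, ∀ i j, f (t i) ≤ f (t j) + R) {a : OrdChain X (n + 2)} (ha : a ∈ supp S)
    (hb : bd (n + 1) a ∈ supp (tuples {v | f v ≤ r} (n + 1))) :
    ∃ a' ∈ supp S, bd (n + 1) a' = bd (n + 1) a ∧ lOne a' ≤ lOne a ∧
      a' ∈ supp (tuples {v | f v ≤ r + lOne a * R} (n + 2)) := by
  obtain ⟨j, hj, hU⟩ := exists_unmixed_level (r := r) (c := a) (f := f) (R := R)
    fun t ht => hS t (ha ht)
  refine ⟨restrict {v | f v ≤ r + j * R} a, restrict_mem _ ha, ?_, lOne_restrict_le _ a,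
    supp_mono (restrict_mem_tuples _ a) (tuples_mono fun v (hv : f v ≤ r + j * R) => hv.trans ?_)⟩
  · rw [bd_restrict hU, restrict_eq_self]
    exact supp_mono hb (tuples_mono fun v (hv : f v ≤ r) => hv.trans (Nat.le_add_right _ _))
  · exact Nat.add_le_add_left (Nat.mul_le_mul_right R (hj.trans (card_support_le_lOne a))) r

theorem exists_mem_tuples_le (f : X → ℕ) (c : OrdChain X n) :
    ∃ r, c ∈ supp (tuples {v | f v ≤ r} n) := by
  refine ⟨c.support.sup fun t => Finset.univ.sup fun i => f (t i), fun t ht i => ?_⟩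
  exact (Finset.le_sup (f := fun i => f (t i)) (Finset.mem_univ i)).trans
    (Finset.le_sup (f := fun t : Fin n → X => Finset.univ.sup fun i => f (t i)) ht)

end OrdChain

/-! ## Word lengths and cocompact free actions -/

namespace FinSymmGenSet

variable {G : Type u} [Group G] (S : FinSymmGenSet G)

theorem length_list_prod_le {l : List G} (h : ∀ s ∈ l, s ∈ S.carrier) :
    S.length l.prod ≤ l.length :=
  Nat.sInf_le ⟨l, h, rfl, rfl⟩

theorem length_one : S.length 1 = 0 :=
  Nat.le_zero.mp (S.length_list_prod_le (l := []) (by simp))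

theorem length_inv_le (g : G) : S.length g⁻¹ ≤ S.length g := by
  obtain ⟨l, hl, rfl, hn⟩ := S.exists_word g
  rw [← hn, List.prod_inv_reverse]
  refine (S.length_list_prod_le fun s hs => ?_).trans (by simp)
  obtain ⟨s, hs', rfl⟩ := List.mem_map.mp (List.mem_reverse.mp hs)
  exact S.inv_mem _ (hl _ hs')

theorem length_le_length_mul_add (g h : G) : S.length g ≤ S.length (g * h) + S.length h := by
  have h1 := S.length_mul_le (g * h) h⁻¹
  rw [mul_inv_cancel_right] at h1
  exact h1.trans (Nat.add_le_add_left (S.length_inv_le h) _)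

end FinSymmGenSet

/-- Choose a representative of each orbit; by freeness every vertex is a unique translate of its
representative. -/
theorem exists_equivariant_map {G V : Type*} [Group G] [MulAction G V]
    (h : ∀ (g : G) (v : V), g • v = v → g = 1) : ∃ φ : V → G, ∀ g v, φ (g • v) = g * φ v := by
  let r : V → V := fun v => (Quotient.mk (MulAction.orbitRel G V) v).out
  have hr : ∀ v, ∃ g : G, g • r v = v := fun v =>
    MulAction.orbitRel_apply.mp ((MulAction.orbitRel G V).symm (Quotient.mk_out v))
  choose φ hφ using hr
  refine ⟨φ, fun g v => ?_⟩
  have hrg : r (g • v) = r v := congrArg Quotient.out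
    (Quotient.sound (s := MulAction.orbitRel G V) (MulAction.orbitRel_apply.mpr ⟨g, rfl⟩))
  have h1 := hφ (g • v)
  rw [hrg] at h1
  have h2 : ((g * φ v)⁻¹ * φ (g • v)) • r v = r v := by
    rw [mul_smul, h1, inv_smul_eq_iff, mul_smul, hφ]
  exact (inv_mul_eq_one.mp (h _ _ h2)).symm

namespace AbstractSimplicialComplex

open OrdChain

section Ball

variable {G V : Type*} [Group G] (S : FinSymmGenSet G)

/-- The vertices of norm at most `r`. -/
def ball (φ : V → G) (r : ℕ) : Set V := {v | S.length (φ v) ≤ r}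

theorem ball_mono (φ : V → G) {r r' : ℕ} (h : r ≤ r') : ball S φ r ⊆ ball S φ r' :=
  fun _ hv => le_trans hv h

end Ball

variable {G : Type u} [Group G] {V : Type u} [MulAction G V] {K : AbstractSimplicialComplex V}

theorem smul_comp_mem_faceTuples (hK : IsSimplicialEG G K) (g : G) {n : ℕ} {t : Fin n → V}
    (ht : t ∈ K.faceTuples n) : (g • ·) ∘ t ∈ K.faceTuples n := by
  obtain ⟨s, hs, hts⟩ := ht
  exact ⟨_, hK.smul_mem g s hs, fun i => Finset.mem_map.mpr ⟨t i, hts i, rfl⟩⟩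

/-- Tuples may repeat vertices, so their vertex sets are faces of any dimension below `n`. Moving
such a face to its orbit representative puts all entries into one finite set of vertices. -/
theorem exists_finset_faceTuples (hF : HasFiniteSkeleta G K) (n : ℕ) :
    ∃ F : Finset (Fin n → V), ∀ t ∈ K.faceTuples n, ∃ t' ∈ F, ∃ g : G, t = (g • ·) ∘ t' := by
  classical
  choose F hF using hF
  let U : Finset V := (Finset.range n).biUnion fun m => (F m).biUnion id
  refine ⟨Fintype.piFinset fun _ => U, fun t ht => ?_⟩
  cases n with
  | zero => exact ⟨t, Fintype.mem_piFinset.mpr fun i => i.elim0, 1, funext fun i => i.elim0⟩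
  | succ n =>
    obtain ⟨s, hs, hts⟩ := ht
    let s' := Finset.univ.image t
    have hne : s'.Nonempty := Finset.univ_nonempty.image t
    have hs' : s' ∈ K.faces := (K.isRelLowerSet_faces hs).2 (fun v hv => by
      obtain ⟨i, -, rfl⟩ := Finset.mem_image.mp hv
      exact hts i) hne
    have hcard : s'.card ≤ n + 1 := Finset.card_image_le.trans (by simp)
    have hpos := hne.card_pos
    obtain ⟨τ, hτ, g, hg⟩ := hF (s'.card - 1) s' hs' (by omega)
    refine ⟨(g⁻¹ • ·) ∘ t, Fintype.mem_piFinset.mpr fun i => ?_, g, by ext; simp⟩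
    have hti : t i ∈ s' := Finset.mem_image_of_mem t (Finset.mem_univ i)
    rw [hg] at hti
    obtain ⟨v, hv, hvt⟩ := Finset.mem_map.mp hti
    have hvt' : g • v = t i := hvt
    refine Finset.mem_biUnion.mpr ⟨s'.card - 1, Finset.mem_range.mpr (by omega),
      Finset.mem_biUnion.mpr ⟨τ, hτ, ?_⟩⟩
    simpa [← hvt'] using hv

/-! ### Fillings with polynomial bounds on norm and radius -/

section Fill

variable {S : FinSymmGenSet G} {φ : V → G}

theorem smul_mem_ball (hφ : ∀ g v, φ (g • v) = g * φ v)
    (g : G) {r : ℕ} {v : V} (hv : v ∈ ball S φ r) :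
    g • v ∈ ball S φ (S.length g + r) := by
  change S.length _ ≤ _
  rw [hφ]
  exact (S.length_mul_le _ _).trans (Nat.add_le_add_left hv _)

theorem map_smul_mem_ball (hφ : ∀ g v, φ (g • v) = g * φ v)
    (g : G) {r n : ℕ} {c : OrdChain V n}
    (hc : c ∈ supp (tuples (ball S φ r) n)) :
    map (g • ·) c ∈ supp (tuples (ball S φ (S.length g + r)) n) :=
  map_mem (f := (g • ·)) (S := tuples (ball S φ r) n)
    (T := tuples (ball S φ (S.length g + r)) n) (fun _ ht i => smul_mem_ball hφ g (ht i)) hc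

/-- For two vertices of a common face, the quotient of their `φ`-values is invariant under `G`, so
it takes finitely many values. -/
theorem exists_length_le_add (hφ : ∀ g v, φ (g • v) = g * φ v)
    (hF : HasFiniteSkeleta G K) :
    ∃ R, ∀ (n : ℕ), ∀ t ∈ K.faceTuples n, ∀ i j,
      S.length (φ (t i)) ≤ S.length (φ (t j)) + R := by
  obtain ⟨F, hF⟩ := exists_finset_faceTuples hF 2
  refine ⟨F.sup fun t => S.length ((φ (t 1))⁻¹ * φ (t 0)), fun n t ht i j => ?_⟩
  obtain ⟨s, hs, hts⟩ := ht
  obtain ⟨t', ht', g, hg⟩ := hF ![t i, t j] ⟨s, hs, fun k => by fin_cases k <;> simp [hts]⟩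
  have h0 : t i = g • t' 0 := congrFun hg 0
  have h1 : t j = g • t' 1 := congrFun hg 1
  have h2 : φ (t i) = φ (t j) * ((φ (t' 1))⁻¹ * φ (t' 0)) := by
    rw [h0, h1, hφ, hφ]
    group
  rw [h2]
  exact (S.length_mul_le _ _).trans (Nat.add_le_add_left
    (Finset.le_sup (f := fun t : Fin 2 → V => S.length ((φ (t 1))⁻¹ * φ (t 0))) ht') _)

/-- The `0`-chain of a vertex. -/
abbrev pt (v : V) : OrdChain V 1 := of fun _ => v

theorem exists_bd_eq_pt_sub_pt (hK : IsSimplicialEG G K) (v w : V) :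
    ∃ c ∈ supp (K.faceTuples 2), bd 1 c = pt v - pt w := by
  refine exists_bd_eq_of_contractible hK.contractible ?_ ?_
  · exact Submodule.sub_mem _ (of_mem ⟨_, K.singleton_mem_faces v, by simp⟩)
      (of_mem ⟨_, K.singleton_mem_faces w, by simp⟩)
  · rw [map_sub, bd_of, bd_of, sub_eq_zero]
    exact Finset.sum_congr rfl fun i _ => by congr 2; funext j; exact j.elim0

theorem cone_bd_pt (v w : V) : cone w (bd 0 (pt v)) = pt w := by
  rw [bd_of, Fin.sum_univ_one, Fin.val_zero, pow_zero, one_smul, cone_of]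
  congr 1
  exact funext (Fin.cases rfl fun i => i.elim0)

/-- The path follows the word: translate the path for the tail by the first generator and append a
fixed path from `s • v₀` to `v₀`. Each generator enlarges the radius by at most one. -/
theorem exists_path_list_prod (hφ : ∀ g v, φ (g • v) = g * φ v)
    (hK : IsSimplicialEG G K) (v₀ : V) :
    ∃ B, ∀ l : List G, (∀ s ∈ l, s ∈ S.carrier) → ∃ c ∈ supp (K.faceTuples 2),
      bd 1 c = pt (l.prod • v₀) - pt v₀ ∧ lOne c ≤ B * l.length ∧
      c ∈ supp (tuples (ball S φ (B + l.length)) 2) := by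
  choose C hC hCbd using fun v => exists_bd_eq_pt_sub_pt hK v v₀
  choose ρ hρ using fun v => exists_mem_tuples_le (fun v => S.length (φ v)) (C v)
  refine ⟨S.carrier.sup fun s => lOne (C (s • v₀)) + ρ (s • v₀), fun l => ?_⟩
  induction l with
  | nil => exact fun _ => ⟨0, Submodule.zero_mem _, by simp, by simp, Submodule.zero_mem _⟩
  | cons s l ih =>
    intro hl
    obtain ⟨c, hc, hcbd, hcl, hcb⟩ := ih fun s' hs' => hl s' (List.mem_cons_of_mem _ hs')
    have hs : s ∈ S.carrier := hl s List.mem_cons_self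
    have hB : lOne (C (s • v₀)) + ρ (s • v₀) ≤
        S.carrier.sup fun s => lOne (C (s • v₀)) + ρ (s • v₀) :=
      Finset.le_sup (f := fun s => lOne (C (s • v₀)) + ρ (s • v₀)) hs
    have hs1 : S.length s ≤ 1 := by
      simpa using S.length_list_prod_le (l := [s]) (by simpa using hs)
    refine ⟨map (s • ·) c + C (s • v₀), Submodule.add_mem _
      (map_mem (fun t ht => smul_comp_mem_faceTuples hK s ht) hc) (hC _), ?_, ?_,
      Submodule.add_mem _ ?_ ?_⟩
    · rw [map_add, ← map_bd, hcbd, hCbd, map_sub, map_of, map_of, List.prod_cons, mul_smul]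
      simp only [pt, Function.comp_def]
      abel
    · rw [List.length_cons, mul_add, mul_one]
      exact (lOne_add_le _ _).trans (Nat.add_le_add ((lOne_map_le _ _).trans hcl) (by omega))
    · refine supp_mono (map_smul_mem_ball hφ s hcb) (tuples_mono (ball_mono S φ ?_))
      rw [List.length_cons]
      omega
    · refine supp_mono (hρ _) (tuples_mono (ball_mono S φ (?_ : ρ (s • v₀) ≤ _)))
      rw [List.length_cons]
      omega

/-- Up to a translation by some `g`, the vertex belongs to a finite set, and `g` has a word of
length at most `S.length (φ v)` plus a constant. Join the translated fixed path to the path along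
that word. -/
theorem exists_path (hφ : ∀ g v, φ (g • v) = g * φ v)
    (hK : IsSimplicialEG G K) (hF : HasFiniteSkeleta G K) (v₀ : V) :
    ∃ B, ∀ v, ∃ c ∈ supp (K.faceTuples 2), bd 1 c = pt v - pt v₀ ∧
      lOne c ≤ B * (S.length (φ v) + 1) ∧
      c ∈ supp (tuples (ball S φ (B * (S.length (φ v) + 1))) 2) := by
  choose C hC hCbd using fun v => exists_bd_eq_pt_sub_pt hK v v₀
  choose ρ hρ using fun v => exists_mem_tuples_le (fun v => S.length (φ v)) (C v)
  obtain ⟨F, hF⟩ := exists_finset_faceTuples hF 1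
  obtain ⟨B, hB⟩ := exists_path_list_prod (S := S) hφ hK v₀
  let D := F.sup fun t => lOne (C (t 0)) + ρ (t 0) + S.length (φ (t 0))
  refine ⟨B + B * D + 2 * D + 1, fun v => ?_⟩
  obtain ⟨t, htF, g, hg⟩ := hF (fun _ => v) ⟨_, K.singleton_mem_faces v, by simp⟩
  have hv : v = g • t 0 := congrFun hg 0
  have hD : lOne (C (t 0)) + ρ (t 0) + S.length (φ (t 0)) ≤ D :=
    Finset.le_sup (f := fun t : Fin 1 → V => lOne (C (t 0)) + ρ (t 0) + S.length (φ (t 0))) htF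
  have hgl : S.length g ≤ S.length (φ v) + D := by
    rw [hv, hφ]
    exact (S.length_le_length_mul_add g (φ (t 0))).trans (by omega)
  obtain ⟨l, hl, hlg, hll⟩ := S.exists_word g
  obtain ⟨c, hc, hcbd, hcl, hcb⟩ := hB l hl
  rw [hlg] at hcbd
  rw [hll] at hcl hcb
  generalize S.length (φ v) = k at *
  refine ⟨map (g • ·) (C (t 0)) + c, Submodule.add_mem _
    (map_mem (fun t ht => smul_comp_mem_faceTuples hK g ht) (hC _)) hc, ?_, ?_,
    Submodule.add_mem _ ?_ ?_⟩
  · rw [map_add, ← map_bd, hcbd, hCbd, map_sub, map_of, map_of, hv]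
    simp only [pt, Function.comp_def]
    abel
  · have h1 : B * S.length g ≤ B * (k + D) := Nat.mul_le_mul_left B hgl
    refine (lOne_add_le _ _).trans
      ((Nat.add_le_add ((lOne_map_le _ _).trans (by omega : _ ≤ D)) (hcl.trans h1)).trans ?_)
    nlinarith [Nat.zero_le (B * D * k), Nat.zero_le (D * k)]
  · refine supp_mono (map_smul_mem_ball (S := S) hφ g (hρ _)) (tuples_mono (ball_mono S φ ?_))
    nlinarith [Nat.zero_le (B * D * k), Nat.zero_le (D * k), Nat.zero_le (B * D),
      Nat.zero_le (B * k)]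
  · refine supp_mono hcb (tuples_mono (ball_mono S φ ?_))
    nlinarith [Nat.zero_le (B * D * k), Nat.zero_le (D * k), Nat.zero_le (B * D),
      Nat.zero_le (B * k)]

/-- With `n` entries, a filling of an `n`-tuple cycle is governed by `d^(n-1)`, which is assumed
polynomial only for `n ≥ 2`. In the augmentation degree a single vertex suffices; for `n = 1` the
points are joined to `v₀` by paths, whose endpoints at `v₀` cancel because the augmentation of `b`
is zero. -/
theorem exists_polynomial_filling_ball [LinearOrder V] (hφ : ∀ g v, φ (g • v) = g * φ v)
    (hK : IsSimplicialEG G K)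
    (hF : HasFiniteSkeleta G K)
    (hD : ∀ N : ℕ, 1 ≤ N → ∃ P : Polynomial ℕ, ∀ k : ℕ,
      K.dehnFunction N k ≤ ((P.eval k : ℕ) : ℕ∞)) (v₀ : V) (n : ℕ) :
    ∃ P : Polynomial ℕ, ∀ k, ∀ b ∈ supp (K.faceTuples n), IsCycle b →
      b ∈ supp (tuples (ball S φ k) n) → lOne b ≤ k →
      ∃ a ∈ supp (K.faceTuples (n + 1)), bd n a = b ∧ lOne a ≤ P.eval k ∧
        a ∈ supp (tuples (ball S φ (P.eval k)) (n + 1)) := by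
  match n with
  | 0 =>
    refine ⟨Polynomial.X + Polynomial.C (S.length (φ v₀)), fun k b _ hbc hbb hbk =>
      ⟨cone v₀ b, ?_, bd_cone_of_isCycle v₀ hbc, ?_, ?_⟩⟩
    · refine cone_mem (S := Set.univ) (T := K.faceTuples 1) (fun t _ => ⟨_, K.singleton_mem_faces v₀, ?_⟩) (by simp)
      exact Fin.cases (by simp) fun i => i.elim0
    · simp only [Polynomial.eval_add, Polynomial.eval_X, Polynomial.eval_C]
      exact (lOne_cone_le _ _).trans (by omega)
    · refine cone_mem_tuples (U := ball S φ _) ?_ (supp_mono hbb fun t _ i => i.elim0)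
      change S.length (φ v₀) ≤ _
      simp
  | 1 =>
    obtain ⟨B, hB⟩ := exists_path (S := S) hφ hK hF v₀
    choose c hc hcbd hcl hcb using hB
    -- There are at most `k` points counted with multiplicity, each joined by a path of norm and
    -- radius at most `B * (k + 1)`.
    refine ⟨Polynomial.C B * (Polynomial.X + 1) * (Polynomial.X + 1), fun k b hb hbc hbb hbk =>
      ⟨lift (fun t => c (t 0)) b, ?_, ?_, ?_, ?_⟩⟩
    · refine map_mem_of_mem_supported _ (fun t _ => ?_) hb
      rw [lift_of]
      exact hc _
    · have : bd 1 ∘ₗ lift (fun t : Fin 1 → V => c (t 0)) = LinearMap.id - cone v₀ ∘ₗ bd 0 := by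
        refine hom_ext fun t => ?_
        have ht : of t = pt (t 0) := by
          congr 1
          exact funext (Fin.cases rfl fun i => i.elim0)
        simp only [LinearMap.comp_apply, LinearMap.sub_apply, LinearMap.id_apply, lift_of, hcbd]
        rw [ht, cone_bd_pt]
      have h := LinearMap.congr_fun this b
      rwa [LinearMap.comp_apply, LinearMap.sub_apply, LinearMap.comp_apply,
        show bd 0 b = 0 from hbc, map_zero, sub_zero] at h
    · simp only [Polynomial.eval_mul, Polynomial.eval_add, Polynomial.eval_X, Polynomial.eval_C,
        Polynomial.eval_one]
      refine (lOne_linearMap_le _ _ (B * (k + 1)) fun t ht => ?_).trans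
        (Nat.mul_le_mul_left _ (by omega))
      rw [lift_of]
      exact (hcl _).trans (Nat.mul_le_mul_left _ (Nat.succ_le_succ (hbb ht 0)))
    · refine map_mem_of_mem_supported _ (fun t ht => ?_) hbb
      rw [lift_of]
      refine supp_mono (hcb _) (tuples_mono (ball_mono S φ ?_))
      simp only [Polynomial.eval_mul, Polynomial.eval_add, Polynomial.eval_X, Polynomial.eval_C,
        Polynomial.eval_one]
      have h1 : S.length (φ (t 0)) ≤ k := ht 0
      exact (Nat.mul_le_mul_left B (Nat.succ_le_succ h1)).trans (Nat.le_mul_of_pos_right _ (by omega))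
  | n + 2 =>
    obtain ⟨P, hP⟩ := hD (n + 1) (by omega)
    obtain ⟨Q, hQ⟩ := exists_polynomial_filling hK.contractible hP
    obtain ⟨R, hR⟩ := exists_length_le_add (S := S) hφ hF
    -- The cut-off leaves a filling of radius `k + lOne a * R` with `lOne a ≤ Q.eval k`.
    refine ⟨Q + Polynomial.X + Q * Polynomial.C R, fun k b hb hbc hbb hbk => ?_⟩
    obtain ⟨a, ha, hab, hal⟩ := hQ k b hb hbc hbk
    obtain ⟨a', ha', hab', hal', hab''⟩ := exists_bd_eq_mem_tuples (r := k)
      (fun t ht => hR _ t ht) ha (by rw [hab]; exact hbb)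
    refine ⟨a', ha', hab'.trans hab, ?_, supp_mono hab'' (tuples_mono (ball_mono S φ ?_))⟩
    · simp only [Polynomial.eval_mul, Polynomial.eval_add, Polynomial.eval_X, Polynomial.eval_C]
      omega
    · simp only [Polynomial.eval_mul, Polynomial.eval_add, Polynomial.eval_X, Polynomial.eval_C]
      have := Nat.mul_le_mul_right R hal
      omega

end Fill

end AbstractSimplicialComplex

/-! ## Polynomially bounded equivariant maps of chains on a group -/

theorem Polynomial.monotone_eval_nat (P : Polynomial ℕ) : Monotone fun k : ℕ => P.eval k := by
  intro a b hab
  simp only [Polynomial.eval_eq_sum, Polynomial.sum]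
  exact Finset.sum_le_sum fun i _ => Nat.mul_le_mul_left _ (Nat.pow_le_pow_left hab i)

namespace OrdChain

section CommuteCone

variable {X : Type*} {n : ℕ} {f : ∀ n, OrdChain X n →ₗ[ℤ] OrdChain X n}
  {p : ∀ n, (Fin (n + 1) → X) → X}

theorem map_coneHomotopy {a : X → X} (hf : ∀ n c, map a (f n c) = f n (map a c))
    (hp : ∀ n t, p n (a ∘ t) = a (p n t)) (c : OrdChain X n) :
    map a (coneHomotopy f p n c) = coneHomotopy f p n (map a c) := by
  suffices h : ∀ n, map a ∘ₗ coneHomotopy f p n = coneHomotopy f p n ∘ₗ map a from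
    LinearMap.congr_fun (h n) c
  intro n
  induction n with
  | zero => simp [coneHomotopy]
  | succ n ih =>
    refine hom_ext fun t => ?_
    have h := LinearMap.congr_fun ih (bd n (of t))
    simp only [LinearMap.comp_apply] at h
    simp only [LinearMap.comp_apply, map_of, coneHomotopy_of, map_cone, map_sub, h, hf, hp,
      map_bd]

end CommuteCone

variable {G : Type*} [Group G] (S : FinSymmGenSet G) {n m : ℕ}

/-- The elements of word length at most `r`. -/
def wordBall (r : ℕ) : Set G := {g | S.length g ≤ r}

theorem wordBall_mono {r r' : ℕ} (h : r ≤ r') : wordBall S r ⊆ wordBall S r' :=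
  fun _ hg => le_trans hg h

/-- The norms and the supports of the images of the tuples in the ball of radius `d` are bounded
by a polynomial in `d`. -/
def PolyBounded (F : OrdChain G n →ₗ[ℤ] OrdChain G m) : Prop :=
  ∃ P : Polynomial ℕ, ∀ d, ∀ t ∈ tuples (wordBall S d) n, lOne (F (of t)) ≤ P.eval d ∧
    F (of t) ∈ supp (tuples (wordBall S (P.eval d)) m)

theorem polyBounded_coneHomotopy {f : ∀ n, OrdChain G n →ₗ[ℤ] OrdChain G n}
    (hf : ∀ n, PolyBounded S (f n)) (n : ℕ) :
    PolyBounded S (coneHomotopy f (fun _ t => t 0) n) := by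
  induction n with
  | zero => exact ⟨0, fun d t _ => ⟨by simp [coneHomotopy], Submodule.zero_mem _⟩⟩
  | succ n ih =>
    obtain ⟨P, hP⟩ := hf (n + 1)
    obtain ⟨Q, hQ⟩ := ih
    refine ⟨1 + Polynomial.X + P + Polynomial.C (n + 1) * Q, fun d t ht => ?_⟩
    obtain ⟨h1, h2⟩ := hP d t ht
    have hb : bd n (of t) ∈ supp (tuples (wordBall S d) n) := bd_mem_tuples (of_mem ht)
    have h3 : lOne (coneHomotopy f (fun _ t => t 0) n (bd n (of t))) ≤ (n + 1) * Q.eval d := by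
      have h := lOne_bd_le (of t)
      rw [lOne_single, Int.natAbs_one, mul_one] at h
      refine (lOne_linearMap_le _ _ (Q.eval d) fun t' ht' => (hQ d t' (hb ht')).1).trans ?_
      rw [mul_comm]
      exact Nat.mul_le_mul_right _ h
    have h4 : coneHomotopy f (fun _ t => t 0) n (bd n (of t)) ∈
        supp (tuples (wordBall S (Q.eval d)) (n + 1)) :=
      map_mem_of_mem_supported _ (fun t' ht' => (hQ d t' ht').2) hb
    have h5 : Q.eval d ≤ (n + 1) * Q.eval d := Nat.le_mul_of_pos_left _ (by omega)
    simp only [Polynomial.eval_add, Polynomial.eval_mul, Polynomial.eval_X, Polynomial.eval_C,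
      Polynomial.eval_one]
    rw [coneHomotopy_of]
    refine ⟨(lOne_cone_le _ _).trans ((lOne_sub_le _ _).trans ?_), cone_mem_tuples ?_
      (Submodule.sub_mem _ (Submodule.sub_mem _ ?_ ?_) ?_)⟩
    · have h6 := lOne_sub_le (of t) (f (n + 1) (of t))
      rw [lOne_single, Int.natAbs_one] at h6
      omega
    · exact wordBall_mono S (by omega) (ht 0)
    · exact of_mem (tuples_mono (wordBall_mono S (by omega)) ht)
    · exact supp_mono h2 (tuples_mono (wordBall_mono S (by omega)))
    · exact supp_mono h4 (tuples_mono (wordBall_mono S (by omega)))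

end OrdChain

/-! ### Equivariant chain maps from the group to the complex -/

namespace AbstractSimplicialComplex

open OrdChain

variable {G : Type u} [Group G] {V : Type u} [MulAction G V] {K : AbstractSimplicialComplex V}
  {S : FinSymmGenSet G} {φ : V → G}

/-- The conditions on the components of the chain map from the chains on `G` to the chains
of `K`. -/
structure IsFillingMap (S : FinSymmGenSet G) (K : AbstractSimplicialComplex V) (φ : V → G) {n : ℕ}
    (ψ : OrdChain G n →ₗ[ℤ] OrdChain V n) : Prop where
  equivariant : ∀ (g : G) c, map (g • ·) (ψ c) = ψ (map (g * ·) c)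
  mem_faceTuples : ∀ c, ψ c ∈ supp (K.faceTuples n)
  isCycle : ∀ c, IsCycle c → IsCycle (ψ c)
  bounded : ∃ P : Polynomial ℕ, ∀ d, ∀ t ∈ tuples (wordBall S d) n, lOne (ψ (of t)) ≤ P.eval d ∧
    ψ (of t) ∈ supp (tuples (ball S φ (P.eval d)) n)

/-- Fill `ψ (bd t)` only for the translate of `t` with first entry `1`, and carry the filling back
by `t 0`. This forces equivariance and preserves the boundary since `ψ` is equivariant. -/
theorem IsFillingMap.exists_succ (hφ : ∀ g v, φ (g • v) = g * φ v) (hK : IsSimplicialEG G K)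
    {n : ℕ} {ψ : OrdChain G n →ₗ[ℤ] OrdChain V n}
    (hψ : IsFillingMap S K φ ψ) {Q : Polynomial ℕ}
    (hQ : ∀ k, ∀ b ∈ supp (K.faceTuples n), IsCycle b →
      b ∈ supp (tuples (ball S φ k) n) → lOne b ≤ k →
      ∃ a ∈ supp (K.faceTuples (n + 1)), bd n a = b ∧ lOne a ≤ Q.eval k ∧
        a ∈ supp (tuples (ball S φ (Q.eval k)) (n + 1))) :
    ∃ ψ' : OrdChain G (n + 1) →ₗ[ℤ] OrdChain V (n + 1), IsFillingMap S K φ ψ' ∧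
      ∀ c, bd n (ψ' c) = ψ (bd n c) := by
  classical
  have hfill : ∀ t : Fin (n + 1) → G, ∃ a ∈ supp (K.faceTuples (n + 1)),
      bd n a = ψ (bd n (of t)) ∧ ∀ k, ψ (bd n (of t)) ∈ supp (tuples (ball S φ k) n) →
        lOne (ψ (bd n (of t))) ≤ k →
        lOne a ≤ Q.eval k ∧ a ∈ supp (tuples (ball S φ (Q.eval k)) (n + 1)) := by
    intro t
    have hex : ∃ k, ψ (bd n (of t)) ∈ supp (tuples (ball S φ k) n) ∧
        lOne (ψ (bd n (of t))) ≤ k := by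
      obtain ⟨r, hr⟩ := exists_mem_tuples_le (fun v => S.length (φ v)) (ψ (bd n (of t)))
      exact ⟨r + lOne (ψ (bd n (of t))),
        supp_mono hr (tuples_mono (ball_mono S φ (Nat.le_add_right _ _))), Nat.le_add_left _ _⟩
    -- The filling must be chosen before `k`. Taking the least admissible bound makes it good for
    -- all `k`, by monotonicity of `Q`.
    obtain ⟨a, ha, hab, hal, has⟩ := hQ (Nat.find hex) _ (hψ.mem_faceTuples _)
      (hψ.isCycle _ (isCycle_bd _)) (Nat.find_spec hex).1 (Nat.find_spec hex).2
    refine ⟨a, ha, hab, fun k h1 h2 => ?_⟩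
    have hle : Q.eval (Nat.find hex) ≤ Q.eval k :=
      Q.monotone_eval_nat (Nat.find_min' hex ⟨h1, h2⟩)
    exact ⟨hal.trans hle, supp_mono has (tuples_mono (ball_mono S φ hle))⟩
  choose A hA hAbd hAk using hfill
  let ψ' : OrdChain G (n + 1) →ₗ[ℤ] OrdChain V (n + 1) :=
    lift fun t => map (t 0 • ·) (A (((t 0)⁻¹ * ·) ∘ t))
  have hbd : ∀ c, bd n (ψ' c) = ψ (bd n c) := by
    intro c
    suffices h : bd n ∘ₗ ψ' = ψ ∘ₗ bd n from LinearMap.congr_fun h c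
    refine hom_ext fun t => ?_
    simp only [LinearMap.comp_apply, ψ', lift_of]
    rw [← map_bd, hAbd, hψ.equivariant, map_bd, map_of]
    congr 3
    funext i
    simp
  refine ⟨ψ', ⟨fun g c => ?_, fun c => ?_, fun c hc => ?_, ?_⟩, hbd⟩
  · suffices h : map (g • ·) ∘ₗ ψ' = ψ' ∘ₗ map (g * ·) from LinearMap.congr_fun h c
    refine hom_ext fun t => ?_
    have h1 : (g • ·) ∘ (t 0 • ·) = fun v : V => (g * t 0) • v :=
      funext fun v => (mul_smul g (t 0) v).symm
    have h2 : ((g * t 0)⁻¹ * ·) ∘ (g * ·) ∘ t = ((t 0)⁻¹ * ·) ∘ t := by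
      funext i
      simp [mul_assoc]
    simp only [LinearMap.comp_apply, ψ', lift_of, map_of, map_map]
    rw [h1, Function.comp_apply, h2]
  · refine map_mem_of_mem_supported (S := Set.univ) _ (fun t _ => ?_) (by simp)
    rw [show Finsupp.single t (1 : ℤ) = of t from rfl, lift_of]
    exact map_mem (fun t' ht' => smul_comp_mem_faceTuples hK _ ht') (hA _)
  · change bd n (ψ' c) = 0
    rw [hbd, show bd n c = 0 from hc, map_zero]
  · obtain ⟨P, hP⟩ := hψ.bounded
    -- Normalizing the first entry doubles the radius, and the boundary has `n + 1` terms.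
    -- Translating back by `t 0` then adds at most `d` to the radius.
    let R : Polynomial ℕ := Polynomial.C (n + 1) * P.comp (2 * Polynomial.X)
    refine ⟨Polynomial.X + Q.comp R, fun d t ht => ?_⟩
    have hR : R.eval d = (n + 1) * P.eval (2 * d) := by simp [R]
    have ht' : ((t 0)⁻¹ * ·) ∘ t ∈ tuples (wordBall S (2 * d)) (n + 1) := fun i => by
      have h0 : S.length (t 0) ≤ d := ht 0
      have hi : S.length (t i) ≤ d := ht i
      have h1 := S.length_mul_le (t 0)⁻¹ (t i)
      have h2 := S.length_inv_le (t 0)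
      change S.length ((t 0)⁻¹ * t i) ≤ 2 * d
      omega
    have hb : bd n (of (((t 0)⁻¹ * ·) ∘ t)) ∈ supp (tuples (wordBall S (2 * d)) n) :=
      bd_mem_tuples (of_mem ht')
    have hPR : P.eval (2 * d) ≤ R.eval d := by
      rw [hR]
      exact Nat.le_mul_of_pos_left _ (by omega)
    obtain ⟨h1, h2⟩ := hAk (((t 0)⁻¹ * ·) ∘ t) (R.eval d)
      (map_mem_of_mem_supported _ (fun t' ht' => supp_mono (hP _ t' ht').2
        (tuples_mono (ball_mono S φ hPR))) hb) (by
        have h := lOne_bd_le (of (((t 0)⁻¹ * ·) ∘ t))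
        rw [lOne_single, Int.natAbs_one, mul_one] at h
        rw [hR, mul_comm]
        exact (lOne_linearMap_le _ _ (P.eval (2 * d)) fun t' ht' => (hP _ t' (hb ht')).1).trans
          (Nat.mul_le_mul_left _ h))
    simp only [ψ', lift_of, Polynomial.eval_add, Polynomial.eval_X, Polynomial.eval_comp]
    refine ⟨(lOne_map_le _ _).trans (h1.trans (Nat.le_add_left _ _)), ?_⟩
    refine supp_mono (map_smul_mem_ball hφ (t 0) h2) (tuples_mono (ball_mono S φ ?_))
    exact Nat.add_le_add_right (ht 0) _

theorem exists_fillingMaps (hφ : ∀ g v, φ (g • v) = g * φ v) (hK : IsSimplicialEG G K) (v₀ : V)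
    (hfill : ∀ n, ∃ P : Polynomial ℕ, ∀ k, ∀ b ∈ supp (K.faceTuples n), IsCycle b →
      b ∈ supp (tuples (ball S φ k) n) → lOne b ≤ k →
      ∃ a ∈ supp (K.faceTuples (n + 1)), bd n a = b ∧ lOne a ≤ P.eval k ∧
        a ∈ supp (tuples (ball S φ (P.eval k)) (n + 1))) :
    ∃ ψ : ∀ n, OrdChain G n →ₗ[ℤ] OrdChain V n, ψ 0 = map (· • v₀) ∧
      (∀ n, IsFillingMap S K φ (ψ n)) ∧ ∀ n c, bd n (ψ (n + 1) c) = ψ n (bd n c) := by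
  have h0 : IsFillingMap S K φ (map (· • v₀) : OrdChain G 0 →ₗ[ℤ] OrdChain V 0) := by
    refine ⟨fun g c => ?_, fun c => ?_, fun _ _ => trivial, 1, fun d t _ => ⟨?_, ?_⟩⟩
    · rw [map_map, map_map]
      congr 2
      funext x
      simp [mul_smul]
    · exact map_mem (S := Set.univ) (T := K.faceTuples 0)
        (fun t _ => ⟨_, K.singleton_mem_faces v₀, fun i => i.elim0⟩) (by simp)
    · simp
    · rw [map_of]
      exact of_mem fun i => i.elim0
  choose Q hQ using hfill
  choose next hnext hnextbd using fun (n : ℕ)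
    (ψ : {ψ : OrdChain G n →ₗ[ℤ] OrdChain V n // IsFillingMap S K φ ψ}) =>
    ψ.2.exists_succ hφ hK (hQ n)
  let seq : ∀ n, {ψ : OrdChain G n →ₗ[ℤ] OrdChain V n // IsFillingMap S K φ ψ} := fun n =>
    Nat.rec ⟨_, h0⟩ (fun n ψ => ⟨next n ψ, hnext n ψ⟩) n
  exact ⟨fun n => (seq n).1, rfl, fun n => (seq n).2, fun n c => hnextbd n (seq n) c⟩

end AbstractSimplicialComplex

open OrdChain in
/-- The chain map on the chains of `G` that factors through a cocompact complex. -/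
theorem HasPolynomiallyBoundedDehnFunctions.exists_chainMap {G : Type u} [Group G]
    (S : FinSymmGenSet G) (h : HasPolynomiallyBoundedDehnFunctions G) :
    ∃ θ : ∀ n, OrdChain G n →ₗ[ℤ] OrdChain G n, θ 0 = LinearMap.id ∧
      (∀ n c, bd n (θ (n + 1) c) = θ n (bd n c)) ∧
      (∀ n (g : G) c, map (g * ·) (θ n c) = θ n (map (g * ·) c)) ∧
      (∀ n, PolyBounded S (θ n)) ∧
      ∀ n, ∃ F : Finset (Fin n → G), ∀ c,
        θ n c ∈ supp {t | ∃ t' ∈ F, ∃ g : G, t = (g * ·) ∘ t'} := by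
  classical
  obtain ⟨V, _, _, K, hK, hF, hD⟩ := h
  obtain ⟨φ, hφ⟩ := exists_equivariant_map hK.free
  have := hK.contractible
  have hne : Nonempty K.Realization := inferInstance
  obtain ⟨v₀, -⟩ := hne.some.exists_maximal_coord
  obtain ⟨ψ, hψ0, hψ, hψbd⟩ := AbstractSimplicialComplex.exists_fillingMaps hφ hK v₀
    fun n => AbstractSimplicialComplex.exists_polynomial_filling_ball (S := S) hφ hK hF hD v₀ n
  refine ⟨fun n => map φ ∘ₗ ψ n, ?_, fun n c => ?_, fun n g c => ?_, fun n => ?_, fun n => ?_⟩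
  · refine hom_ext fun t => ?_
    rw [LinearMap.comp_apply, hψ0, map_of, map_of, LinearMap.id_apply]
    congr 1
    funext i
    exact i.elim0
  · rw [LinearMap.comp_apply, LinearMap.comp_apply, ← map_bd, hψbd]
  · rw [LinearMap.comp_apply, LinearMap.comp_apply, ← (hψ n).equivariant, map_map, map_map]
    congr 2
    funext v
    simp [hφ]
  · obtain ⟨P, hP⟩ := (hψ n).bounded
    refine ⟨P, fun d t ht => ⟨(lOne_map_le _ _).trans (hP d t ht).1, ?_⟩⟩
    exact map_mem (f := φ) (S := tuples (AbstractSimplicialComplex.ball S φ (P.eval d)) n)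
      (T := tuples (wordBall S (P.eval d)) n) (fun t' ht' i => ht' i) (hP d t ht).2
  -- Finiteness modulo `G` comes from `K`: the values of `ψ` are chains on face tuples, which form
  -- finitely many orbits, and `φ` is equivariant.
  · obtain ⟨F, hF⟩ := AbstractSimplicialComplex.exists_finset_faceTuples hF n
    refine ⟨F.image (φ ∘ ·), fun c => map_mem (fun t ht => ?_) ((hψ n).mem_faceTuples c)⟩
    obtain ⟨t', ht', g, rfl⟩ := hF t ht
    exact ⟨φ ∘ t', Finset.mem_image_of_mem _ ht', g, funext fun i => hφ _ _⟩

/-! ## Tuples with trivial product -/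

section TrivialClass

open OrdChain

variable {G : Type u} [Group G] {n m : ℕ}

/-- The tuple `(tₙ⁻¹ t₀, t₀⁻¹ t₁, …, tₙ₋₁⁻¹ tₙ)`. -/
def quotientTuple (t : Fin (n + 1) → G) : Fin (n + 1) → G :=
  Fin.cons ((t (Fin.last n))⁻¹ * t 0) fun i => (t i.castSucc)⁻¹ * t i.succ

theorem tupleProd_eq_partialProd (g : Fin (n + 1) → G) :
    tupleProd g = Fin.partialProd g (Fin.last (n + 1)) := by
  rw [Fin.partialProd, Fin.val_last, List.take_of_length_le (by simp)]
  rfl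

theorem partialProd_quotientTuple (t : Fin (n + 1) → G) (i : Fin (n + 1)) :
    Fin.partialProd (quotientTuple t) i.succ = (t (Fin.last n))⁻¹ * t i := by
  induction i using Fin.induction with
  | zero =>
    rw [Fin.partialProd_succ, Fin.castSucc_zero, Fin.partialProd_zero, one_mul]
    rfl
  | succ i ih =>
    rw [Fin.partialProd_succ, ← Fin.succ_castSucc, ih, quotientTuple, Fin.cons_succ]
    group

theorem tupleProd_quotientTuple (t : Fin (n + 1) → G) : tupleProd (quotientTuple t) = 1 := by
  rw [tupleProd_eq_partialProd, ← Fin.succ_last, partialProd_quotientTuple, inv_mul_cancel]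

theorem quotientTuple_apply (t : Fin (n + 1) → G) (a : ℕ → G) (ha : ∀ i, t i = a i)
    (k : Fin (n + 1)) :
    quotientTuple t k = (a (if (k : ℕ) = 0 then n else k - 1))⁻¹ * a k := by
  refine Fin.cases ?_ (fun k => ?_) k <;> simp [quotientTuple, ha]

/-- Multiplying neighbours telescopes: `(tⱼ₋₁⁻¹ tⱼ)(tⱼ⁻¹ tⱼ₊₁) = tⱼ₋₁⁻¹ tⱼ₊₁`, indices being cyclic.
The last Hochschild face is the wrap-around case. -/
theorem hochschildFace_quotientTuple (j : Fin (n + 2)) (t : Fin (n + 2) → G) :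
    hochschildFace j (quotientTuple t) = quotientTuple (j.removeNth t) := by
  obtain ⟨a, ha⟩ : ∃ a : ℕ → G, ∀ m : Fin (n + 2), t m = a m :=
    ⟨fun m => if h : m < n + 2 then t ⟨m, h⟩ else 1, fun m => by simp [m.2]⟩
  have hb : ∀ k : Fin (n + 1), j.removeNth t k =
      (fun k : ℕ => if k < j then a k else a (k + 1)) k := by
    intro k
    rw [Fin.removeNth_apply, ha]
    simp only [Fin.succAbove, Fin.lt_def, Fin.val_castSucc]
    split_ifs <;> simp
  funext k
  rw [hochschildFace_apply, quotientTuple_apply (j.removeNth t)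
    (fun k : ℕ => if k < j then a k else a (k + 1)) hb]
  simp only [quotientTuple_apply _ _ ha, Fin.ext_iff, Fin.val_last, Fin.val_castSucc, Fin.val_succ,
    Fin.val_zero]
  obtain ⟨j, hj⟩ := j
  obtain ⟨k, hk⟩ := k
  simp only
  by_cases hj' : j = n + 1
  · subst hj'
    rcases k with _ | k
    · simp [mul_assoc]
    · have h1 : k < n + 1 := by omega
      simp [hk, h1]
  · rw [if_neg hj']
    rcases lt_trichotomy k j with h | h | h
    · rcases k with _ | k
      · have h1 : ¬ n < j ∨ n < j := by omega
        have h2 : ¬ n < j := by omega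
        simp [h, h2]
      · have h1 : k < j := by omega
        simp [h, h1]
    · subst h
      rcases k with _ | k
      · simp [mul_assoc]
      · simp [mul_assoc]
    · rcases k with _ | k
      · omega
      · have h1 : ¬ k + 1 < j := by omega
        have h2 : ¬ k + 1 = j := by omega
        have h3 : ¬ k < j := by omega
        simp [h1, h2, h3]

/-- The tuple of class `[e]` of a homogeneous tuple. -/
def toClassTuple (t : Fin (n + 1) → G) : ClassTuple (ConjClasses.mk (1 : G)) n :=
  ⟨quotientTuple t, by rw [tupleProd_quotientTuple]⟩

theorem face_toClassTuple (j : Fin (n + 2)) (t : Fin (n + 2) → G) :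
    (toClassTuple t).face j = toClassTuple (j.removeNth t) :=
  Subtype.ext (hochschildFace_quotientTuple j t)

theorem toClassTuple_mul (g : G) (t : Fin (n + 1) → G) :
    toClassTuple ((g * ·) ∘ t) = toClassTuple t := by
  refine Subtype.ext (funext fun k => ?_)
  refine Fin.cases ?_ (fun k => ?_) k <;>
    simp [toClassTuple, quotientTuple, mul_assoc]

/-- The homogeneous tuple of partial products. -/
def ClassTuple.lift (g : ClassTuple (ConjClasses.mk (1 : G)) n) : Fin (n + 1) → G :=
  fun i => Fin.partialProd g.1 i.succ

/-- The differences of the partial products recover all entries but the first. The first closes the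
cycle because the total product, being conjugate to `1`, equals `1`; this is where the class `[e]`
matters. -/
theorem toClassTuple_lift (g : ClassTuple (ConjClasses.mk (1 : G)) n) :
    toClassTuple g.lift = g := by
  have hg : Fin.partialProd g.1 (Fin.last (n + 1)) = 1 := by
    rw [← tupleProd_eq_partialProd]
    have := g.2
    rwa [ConjClasses.mk_eq_mk_iff_isConj, isConj_one_left] at this
  refine Subtype.ext (funext fun k => ?_)
  refine Fin.cases ?_ (fun k => ?_) k
  · have := Fin.partialProd_succ g.1 0
    rw [Fin.castSucc_zero, Fin.partialProd_zero, one_mul] at this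
    simpa [toClassTuple, quotientTuple, ClassTuple.lift, hg] using this
  · exact Fin.partialProd_right_inv g.1 k.succ

theorem lift_toClassTuple (t : Fin (n + 1) → G) :
    (toClassTuple t).lift = ((t (Fin.last n))⁻¹ * ·) ∘ t :=
  funext fun i => partialProd_quotientTuple t i

theorem one_le_weight (S : FinSymmGenSet G) {x : ConjClasses G} (g : ClassTuple x n) :
    1 ≤ g.weight S :=
  Finset.prod_pos fun i _ => Nat.add_pos_left one_pos (S.length (g.1 i))

theorem FinSymmGenSet.one_add_length_list_prod_le (S : FinSymmGenSet G) (l : List G) :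
    1 + S.length l.prod ≤ (l.map fun g => 1 + S.length g).prod := by
  induction l with
  | nil => simp [S.length_one]
  | cons a l ih =>
    rw [List.prod_cons, List.map_cons, List.prod_cons]
    refine le_trans ?_ (Nat.mul_le_mul_left _ ih)
    have := S.length_mul_le a l.prod
    nlinarith [Nat.zero_le (S.length a * S.length l.prod)]

/-- Since `1 + |gh| ≤ (1 + |g|)(1 + |h|)`, a partial product of the entries is bounded by the
corresponding partial product of factors `1 + |gᵢ|`, which is at most the whole weight as all
factors are at least `1`. -/
theorem lift_mem_wordBall (S : FinSymmGenSet G) (g : ClassTuple (ConjClasses.mk (1 : G)) n) :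
    g.lift ∈ tuples (wordBall S (g.weight S)) (n + 1) := by
  intro i
  have h1 := S.one_add_length_list_prod_le ((List.ofFn g.1).take i.succ)
  have h2 : g.weight S = ((List.ofFn g.1).map fun g => 1 + S.length g).prod := by
    rw [List.map_ofFn, List.prod_ofFn]
    rfl
  have h3 : (((List.ofFn g.1).take i.succ).map fun g => 1 + S.length g).prod ≤ g.weight S := by
    rw [h2]
    conv_rhs => rw [← List.take_append_drop (i.succ : ℕ) (List.ofFn g.1), List.map_append,
      List.prod_append]
    refine Nat.le_mul_of_pos_right _ (List.prod_pos fun a ha => ?_)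
    obtain ⟨b, -, rfl⟩ := List.mem_map.mp ha
    omega
  change S.length _ ≤ _
  rw [ClassTuple.lift, Fin.partialProd]
  omega

theorem weight_toClassTuple_le (S : FinSymmGenSet G) {r : ℕ} {t : Fin (n + 1) → G}
    (ht : t ∈ tuples (wordBall S r) (n + 1)) :
    (toClassTuple t).weight S ≤ (1 + 2 * r) ^ (n + 1) := by
  have hle : ∀ i j, 1 + S.length ((t i)⁻¹ * t j) ≤ 1 + 2 * r := fun i j => by
    have h1 := S.length_mul_le (t i)⁻¹ (t j)
    have h2 := S.length_inv_le (t i)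
    have h3 : S.length (t i) ≤ r := ht i
    have h4 : S.length (t j) ≤ r := ht j
    omega
  refine (Finset.prod_le_pow_card _ _ (1 + 2 * r) fun k _ => ?_).trans (by simp)
  refine Fin.cases ?_ (fun k => ?_) k
  · exact hle _ _
  · exact hle _ _

/-- The map from the chains on `G` to the Hochschild chains of class `[e]`. -/
def toClass : OrdChain G (n + 1) →ₗ[ℤ] (ClassTuple (ConjClasses.mk (1 : G)) n →₀ ℂ) :=
  lift fun t => Finsupp.single (toClassTuple t) 1

theorem toClass_of (t : Fin (n + 1) → G) :
    toClass (of t) = Finsupp.single (toClassTuple t) 1 := by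
  rw [toClass, lift_of]

theorem toClass_map_mul (g : G) (c : OrdChain G (n + 1)) :
    toClass (map (g * ·) c) = toClass c := by
  suffices h : toClass ∘ₗ map (g * ·) = toClass (G := G) (n := n) from LinearMap.congr_fun h c
  exact hom_ext fun t => by
    rw [LinearMap.comp_apply, map_of, toClass_of, toClass_of, toClassTuple_mul]

/-- The map of Hochschild chains of class `[e]` induced by a map of chains on `G`. -/
def descend (F : OrdChain G (n + 1) →ₗ[ℤ] OrdChain G (m + 1)) :
    (ClassTuple (ConjClasses.mk (1 : G)) n →₀ ℂ) →ₗ[ℂ]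
      (ClassTuple (ConjClasses.mk (1 : G)) m →₀ ℂ) :=
  Finsupp.linearCombination ℂ fun g => toClass (F (of g.lift))

theorem descend_single (F : OrdChain G (n + 1) →ₗ[ℤ] OrdChain G (m + 1))
    (g : ClassTuple (ConjClasses.mk (1 : G)) n) :
    descend F (Finsupp.single g 1) = toClass (F (of g.lift)) := by
  rw [descend, Finsupp.linearCombination_single, one_smul]

/-- `descend` uses one particular lift of a class tuple. Any other lift differs by a translation,
which equivariance carries through `F` and `toClass` forgets. -/
theorem descend_toClass {F : OrdChain G (n + 1) →ₗ[ℤ] OrdChain G (m + 1)}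
    (hF : ∀ (g : G) c, map (g * ·) (F c) = F (map (g * ·) c)) (c : OrdChain G (n + 1)) :
    descend F (toClass c) = toClass (F c) := by
  suffices h : (descend F).toAddMonoidHom.toIntLinearMap ∘ₗ toClass = toClass ∘ₗ F from
    LinearMap.congr_fun h c
  refine hom_ext fun t => ?_
  change descend F (toClass (of t)) = toClass (F (of t))
  rw [toClass_of, descend_single, lift_toClassTuple, ← map_of, ← hF, toClass_map_mul]

theorem single_eq_toClass (g : ClassTuple (ConjClasses.mk (1 : G)) n) :
    Finsupp.single g 1 = toClass (of g.lift) := by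
  rw [toClass_of, toClassTuple_lift]

/-- The Hochschild boundary on the chains of class `[e]`. -/
abbrev hochschildBd (n : ℕ) : (ClassTuple (ConjClasses.mk (1 : G)) (n + 1) →₀ ℂ) →ₗ[ℂ]
    (ClassTuple (ConjClasses.mk (1 : G)) n →₀ ℂ) :=
  alternatingSum (M := fun n => ClassTuple (ConjClasses.mk (1 : G)) n →₀ ℂ)
    (fun _ j => Finsupp.lmapDomain ℂ ℂ (ClassTuple.face j)) n

theorem hochschildBd_toClass (c : OrdChain G (n + 2)) :
    hochschildBd n (toClass c) = toClass (bd (n + 1) c) := by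
  suffices h : (hochschildBd n).toAddMonoidHom.toIntLinearMap ∘ₗ toClass =
      toClass ∘ₗ bd (X := G) (n + 1) from LinearMap.congr_fun h c
  refine hom_ext fun t => ?_
  change hochschildBd n (toClass (of t)) = toClass (bd (n + 1) (of t))
  simp only [toClass_of, bd_of, map_sum, hochschildBd, alternatingSum, LinearMap.sum_apply]
  refine Finset.sum_congr rfl fun j _ => ?_
  rw [LinearMap.smul_apply, Finsupp.lmapDomain_apply, Finsupp.mapDomain_single, face_toClassTuple,
    map_smul, toClass_of, ← Int.cast_smul_eq_zsmul ℂ]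
  push_cast
  rfl

end TrivialClass

/-! ## Bounded operators between weighted `ℓ¹`-spaces -/

namespace RapidDecay

variable {I J L : Type u} {w : I → ℕ} {w' : J → ℕ} {w'' : L → ℕ}

/-- The norm `∑ᵢ |c i| w(i)^k`. -/
def rdNorm (k : ℕ) (c : RapidDecay w) : ℝ := ∑' i, ‖c.1 i‖ * (w i : ℝ) ^ k

theorem rdNorm_nonneg (k : ℕ) (c : RapidDecay w) : 0 ≤ rdNorm k c :=
  tsum_nonneg fun i => by positivity

theorem rdNorm_add_le (k : ℕ) (a b : RapidDecay w) :
    rdNorm k (a + b) ≤ rdNorm k a + rdNorm k b := by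
  rw [rdNorm, rdNorm, rdNorm, ← (a.2 k).tsum_add (b.2 k)]
  refine ((a + b).2 k).tsum_le_tsum (fun i => ?_) ((a.2 k).add (b.2 k))
  rw [← add_mul]
  exact mul_le_mul_of_nonneg_right (norm_add_le _ _) (by positivity)

theorem rdNorm_smul (k : ℕ) (r : ℂ) (a : RapidDecay w) :
    rdNorm k (r • a) = ‖r‖ * rdNorm k a := by
  rw [rdNorm, rdNorm, ← tsum_mul_left]
  refine tsum_congr fun i => ?_
  rw [← mul_assoc, ← norm_mul]
  rfl

theorem rdNorm_zero (k : ℕ) : rdNorm k (0 : RapidDecay w) = 0 := by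
  simpa using rdNorm_smul k 0 (0 : RapidDecay w)

theorem rdNorm_mono (hw : ∀ i, 1 ≤ w i) {k l : ℕ} (h : k ≤ l) (c : RapidDecay w) :
    rdNorm k c ≤ rdNorm l c :=
  (c.2 k).tsum_le_tsum (fun i => mul_le_mul_of_nonneg_left
    (pow_le_pow_right₀ (by exact_mod_cast hw i) h) (norm_nonneg _)) (c.2 l)

theorem rdNorm_sum_le {K : Type*} (k : ℕ) (s : Finset K) (f : K → RapidDecay w) :
    rdNorm k (∑ x ∈ s, f x) ≤ ∑ x ∈ s, rdNorm k (f x) := by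
  classical
  induction s using Finset.induction_on with
  | empty => simp [rdNorm_zero]
  | insert a s ha ih =>
    rw [Finset.sum_insert ha, Finset.sum_insert ha]
    exact (rdNorm_add_le _ _ _).trans (by linarith)

theorem rdNorm_incl_single (k : ℕ) (i : I) (z : ℂ) :
    rdNorm k (incl w (Finsupp.single i z)) = ‖z‖ * (w i : ℝ) ^ k := by
  classical
  rw [rdNorm, tsum_eq_single i]
  · change ‖Finsupp.single i z i‖ * _ = _
    rw [Finsupp.single_eq_same]
  · intro j hj
    change ‖Finsupp.single i z j‖ * _ = _
    rw [Finsupp.single_eq_of_ne hj, norm_zero, zero_mul]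

theorem eq_zero_of_rdNorm_eq_zero {c : RapidDecay w} (h : rdNorm 0 c = 0) : c = 0 := by
  refine Subtype.ext (funext fun i => ?_)
  have h' := ((c.2 0).hasSum_iff.mpr h)
  have := (hasSum_zero_iff_of_nonneg (fun i => by positivity)).mp h'
  simpa using congrFun this i

theorem incl_injective (w : I → ℕ) : Function.Injective (incl w) := fun _ _ h =>
  DFunLike.coe_injective (congrArg Subtype.val h)

/-- An operator is bounded if each of the norms of its values is bounded by some norm of the
argument. -/
def IsBoundedOp (T : RapidDecay w →ₗ[ℂ] RapidDecay w') : Prop :=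
  ∀ k, ∃ (C : ℝ) (m : ℕ), 0 ≤ C ∧ ∀ c, rdNorm k (T c) ≤ C * rdNorm m c

/-! ### Operations on bounded operators and uniqueness by density -/

namespace IsBoundedOp

theorem id : IsBoundedOp (LinearMap.id : RapidDecay w →ₗ[ℂ] RapidDecay w) :=
  fun k => ⟨1, k, zero_le_one, fun c => by simp⟩

theorem comp {T : RapidDecay w' →ₗ[ℂ] RapidDecay w''} {T' : RapidDecay w →ₗ[ℂ] RapidDecay w'}
    (hT : IsBoundedOp T) (hT' : IsBoundedOp T') : IsBoundedOp (T ∘ₗ T') := by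
  intro k
  obtain ⟨C, m, hC, h⟩ := hT k
  obtain ⟨C', m', hC', h'⟩ := hT' m
  refine ⟨C * C', m', mul_nonneg hC hC', fun c => (h _).trans ?_⟩
  rw [mul_assoc]
  exact mul_le_mul_of_nonneg_left (h' c) hC

theorem smul {T : RapidDecay w →ₗ[ℂ] RapidDecay w'} (hT : IsBoundedOp T) (r : ℂ) :
    IsBoundedOp (r • T) := by
  intro k
  obtain ⟨C, m, hC, h⟩ := hT k
  refine ⟨‖r‖ * C, m, by positivity, fun c => ?_⟩
  rw [LinearMap.smul_apply, rdNorm_smul, mul_assoc]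
  exact mul_le_mul_of_nonneg_left (h c) (norm_nonneg r)

theorem zero : IsBoundedOp (0 : RapidDecay w →ₗ[ℂ] RapidDecay w') :=
  fun k => ⟨0, 0, le_rfl, fun c => by simp [rdNorm_zero]⟩

theorem add (hw : ∀ i, 1 ≤ w i) {T T' : RapidDecay w →ₗ[ℂ] RapidDecay w'} (hT : IsBoundedOp T)
    (hT' : IsBoundedOp T') : IsBoundedOp (T + T') := by
  intro k
  obtain ⟨C, m, hC, h⟩ := hT k
  obtain ⟨C', m', hC', h'⟩ := hT' k
  refine ⟨C + C', max m m', add_nonneg hC hC', fun c => (rdNorm_add_le _ _ _).trans ?_⟩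
  rw [add_mul]
  exact add_le_add
    ((h c).trans (mul_le_mul_of_nonneg_left (rdNorm_mono hw (le_max_left _ _) c) hC))
    ((h' c).trans (mul_le_mul_of_nonneg_left (rdNorm_mono hw (le_max_right _ _) c) hC'))

theorem sub (hw : ∀ i, 1 ≤ w i) {T T' : RapidDecay w →ₗ[ℂ] RapidDecay w'} (hT : IsBoundedOp T)
    (hT' : IsBoundedOp T') : IsBoundedOp (T - T') := by
  have h : T - T' = T + (-1 : ℂ) • T' := LinearMap.ext fun c => by
    rw [LinearMap.sub_apply, LinearMap.add_apply, LinearMap.smul_apply, neg_one_smul,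
      sub_eq_add_neg]
  rw [h]
  exact hT.add hw (hT'.smul (-1))

theorem sum (hw : ∀ i, 1 ≤ w i) {K : Type*} (s : Finset K)
    {T : K → RapidDecay w →ₗ[ℂ] RapidDecay w'} (hT : ∀ x, IsBoundedOp (T x)) :
    IsBoundedOp (∑ x ∈ s, T x) := by
  classical
  induction s using Finset.induction_on with
  | empty => simpa using zero
  | insert a s ha ih =>
    rw [Finset.sum_insert ha]
    exact (hT a).add hw ih

/-- Truncations of `c` to finite sets converge to `c` in the norm `rdNorm m` that controls `T`, and
`T` kills them. -/
theorem eq_zero {T : RapidDecay w →ₗ[ℂ] RapidDecay w'} (hT : IsBoundedOp T)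
    (h : T ∘ₗ incl w = 0) : T = 0 := by
  classical
  refine LinearMap.ext fun c => eq_zero_of_rdNorm_eq_zero ?_
  obtain ⟨C, m, hC, hCm⟩ := hT 0
  have key : ∀ s : Finset I, rdNorm 0 (T c) ≤
      C * (rdNorm m c - ∑ i ∈ s, ‖c.1 i‖ * (w i : ℝ) ^ m) := by
    intro s
    let y : I →₀ ℂ := Finsupp.onFinset s (fun i => if i ∈ s then c.1 i else 0) fun i hi => by
      by_contra his
      simp [his] at hi
    have hy : T (incl w y) = 0 := LinearMap.congr_fun h y
    have hTc : T c = T (c - incl w y) := by rw [map_sub, hy, sub_zero]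
    have hnorm : rdNorm m (c - incl w y) = rdNorm m c - ∑ i ∈ s, ‖c.1 i‖ * (w i : ℝ) ^ m := by
      have h1 : ∀ i, ‖(c - incl w y).1 i‖ * (w i : ℝ) ^ m =
          ‖c.1 i‖ * (w i : ℝ) ^ m - if i ∈ s then ‖c.1 i‖ * (w i : ℝ) ^ m else 0 := by
        intro i
        have : (c - incl w y).1 i = c.1 i - if i ∈ s then c.1 i else 0 := rfl
        rw [this]
        split_ifs <;> simp
      have h2 : HasSum (fun i => if i ∈ s then ‖c.1 i‖ * (w i : ℝ) ^ m else 0)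
          (∑ i ∈ s, ‖c.1 i‖ * (w i : ℝ) ^ m) := by
        have := hasSum_sum_of_ne_finset_zero (L := SummationFilter.unconditional I) (s := s)
          (f := fun i => if i ∈ s then ‖c.1 i‖ * (w i : ℝ) ^ m else 0)
          fun i hi => if_neg hi
        rwa [Finset.sum_congr rfl fun i hi => if_pos hi] at this
      rw [rdNorm, tsum_congr h1]
      exact ((c.2 m).hasSum.sub h2).tsum_eq
    rw [hTc, ← hnorm]
    exact hCm _
  refine le_antisymm ?_ (rdNorm_nonneg _ _)
  have hlim : Filter.Tendsto
      (fun s : Finset I => C * (rdNorm m c - ∑ i ∈ s, ‖c.1 i‖ * (w i : ℝ) ^ m))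
      Filter.atTop (𝓝 (C * (rdNorm m c - rdNorm m c))) :=
    ((c.2 m).hasSum.const_sub _).const_mul _
  rw [sub_self, mul_zero] at hlim
  exact ge_of_tendsto' hlim key

theorem ext (hw : ∀ i, 1 ≤ w i) {T T' : RapidDecay w →ₗ[ℂ] RapidDecay w'} (hT : IsBoundedOp T)
    (hT' : IsBoundedOp T') (h : ∀ y, T (incl w y) = T' (incl w y)) : T = T' :=
  sub_eq_zero.mp ((hT.sub hw hT').eq_zero (LinearMap.ext fun y => by simp [h y]))

end IsBoundedOp

theorem isBoundedOp_push (f : I → J) (hf : ∀ i, w' (f i) ≤ w i) :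
    IsBoundedOp (push f hf) := by
  refine fun k => ⟨1, k, zero_le_one, fun c => ?_⟩
  rw [one_mul]
  have hs : Summable fun p : (Σ j : J, {i // f i = j}) => ‖c.1 p.2‖ * (w p.2 : ℝ) ^ k :=
    (Equiv.sigmaFiberEquiv f).summable_iff.mpr (c.2 k)
  have hs0 : ∀ j, Summable fun i : {i // f i = j} => ‖c.1 i‖ := fun j =>
    (summable_fiber c f j).norm
  have htot : rdNorm k c = ∑' j, ∑' i : {i // f i = j}, ‖c.1 i‖ * (w i : ℝ) ^ k := by
    rw [← hs.tsum_sigma, rdNorm, ← (Equiv.sigmaFiberEquiv f).tsum_eq]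
    rfl
  rw [htot]
  refine ((push f hf c).2 k).tsum_le_tsum (fun j => ?_) hs.sigma
  calc ‖∑' i : {i // f i = j}, c.1 i‖ * (w' j : ℝ) ^ k
      ≤ (∑' i : {i // f i = j}, ‖c.1 i‖) * (w' j : ℝ) ^ k :=
        mul_le_mul_of_nonneg_right (norm_tsum_le_tsum_norm (hs0 j)) (by positivity)
    _ = ∑' i : {i // f i = j}, ‖c.1 i‖ * (w' j : ℝ) ^ k := tsum_mul_right.symm
    _ ≤ ∑' i : {i // f i = j}, ‖c.1 i‖ * (w i : ℝ) ^ k := by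
        refine Summable.tsum_le_tsum (fun i => ?_) ((hs0 j).mul_right _) (hs.sigma_factor j)
        obtain ⟨i, rfl⟩ := i
        have := hf i
        gcongr

/-- The polynomial bounds under which a linear map extends to the completions. -/
def IsBoundedMatrix (w : I → ℕ) (w' : J → ℕ) (A : (I →₀ ℂ) →ₗ[ℂ] (J →₀ ℂ)) : Prop :=
  ∀ k, ∃ (C : ℝ) (m : ℕ), 0 ≤ C ∧
    ∀ i, rdNorm k (incl w' (A (Finsupp.single i 1))) ≤ C * (w i : ℝ) ^ m

/-! ### Continuous extension of matrices with polynomially bounded columns -/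

section Extend

variable {A : (I →₀ ℂ) →ₗ[ℂ] (J →₀ ℂ)}

/-- Summing over the target first gives at most `C * ‖c i‖ * w(i)^m`, which is summable as `c`
decays rapidly. Absolute convergence of the double sum justifies the interchange of sums for the
extension. -/
theorem IsBoundedMatrix.summable (hA : IsBoundedMatrix w w' A) (k : ℕ) (c : RapidDecay w) : Summable fun p : I × J =>
    ‖c.1 p.1‖ * (‖A (Finsupp.single p.1 1) p.2‖ * (w' p.2 : ℝ) ^ k) := by
  obtain ⟨C, m, hC, hCm⟩ := hA k
  have h0 : ∀ i j, 0 ≤ ‖c.1 i‖ * (‖A (Finsupp.single i 1) j‖ * (w' j : ℝ) ^ k) :=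
    fun i j => by positivity
  have h1 : ∀ i, Summable fun j => ‖c.1 i‖ * (‖A (Finsupp.single i 1) j‖ * (w' j : ℝ) ^ k) :=
    fun i => ((incl w' (A (Finsupp.single i 1))).2 k).mul_left _
  have h2 : ∀ i, ∑' j, ‖c.1 i‖ * (‖A (Finsupp.single i 1) j‖ * (w' j : ℝ) ^ k) ≤
      C * (‖c.1 i‖ * (w i : ℝ) ^ m) := fun i => by
    rw [tsum_mul_left]
    calc _ ≤ ‖c.1 i‖ * (C * (w i : ℝ) ^ m) :=
          mul_le_mul_of_nonneg_left (hCm i) (norm_nonneg _)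
      _ = _ := by ring
  exact (summable_prod_of_nonneg fun p => h0 p.1 p.2).mpr ⟨h1,
    Summable.of_nonneg_of_le (fun i => tsum_nonneg (h0 i)) h2 ((c.2 m).mul_left C)⟩

theorem IsBoundedMatrix.summable_entry (hA : IsBoundedMatrix w w' A) (c : RapidDecay w) (j : J) :
    Summable fun i => c.1 i * A (Finsupp.single i 1) j := by
  refine Summable.of_norm ?_
  have := (hA.summable 0 c).prod_symm.prod_factor j
  simpa using this

theorem IsBoundedMatrix.norm_tsum_mul_le (hA : IsBoundedMatrix w w' A) (k : ℕ) (c : RapidDecay w) (j : J) :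
    ‖∑' i, c.1 i * A (Finsupp.single i 1) j‖ * (w' j : ℝ) ^ k ≤
      ∑' i, ‖c.1 i‖ * (‖A (Finsupp.single i 1) j‖ * (w' j : ℝ) ^ k) := by
  refine (mul_le_mul_of_nonneg_right (norm_tsum_le_tsum_norm (hA.summable_entry c j).norm)
    (by positivity)).trans_eq ?_
  rw [← tsum_mul_right]
  exact tsum_congr fun i => by rw [norm_mul, mul_assoc]

/-- The continuous extension of a linear map with polynomial bounds. -/
def extend (hA : IsBoundedMatrix w w' A) : RapidDecay w →ₗ[ℂ] RapidDecay w' where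
  toFun c := ⟨fun j => ∑' i, c.1 i * A (Finsupp.single i 1) j, fun k =>
    Summable.of_nonneg_of_le (fun j => by positivity) (fun j => hA.norm_tsum_mul_le k c j)
      (hA.summable k c).prod_symm.prod⟩
  map_add' a b := Subtype.ext <| funext fun j => by
    refine (tsum_congr fun i => ?_).trans
      ((hA.summable_entry a j).tsum_add (hA.summable_entry b j))
    exact add_mul _ _ _
  map_smul' r a := Subtype.ext <| funext fun j =>
    (tsum_congr fun i => mul_assoc _ _ _).trans tsum_mul_left

theorem extend_apply (hA : IsBoundedMatrix w w' A) (c : RapidDecay w) (j : J) :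
    (extend hA c).1 j = ∑' i, c.1 i * A (Finsupp.single i 1) j := rfl

theorem extend_incl (hA : IsBoundedMatrix w w' A) (y : I →₀ ℂ) : extend hA (incl w y) = incl w' (A y) := by
  classical
  suffices h : extend hA ∘ₗ incl w = incl w' ∘ₗ A from LinearMap.congr_fun h y
  refine Finsupp.lhom_ext' fun i => LinearMap.ext_ring (Subtype.ext (funext fun j => ?_))
  change ∑' i', Finsupp.single i (1 : ℂ) i' * A (Finsupp.single i' 1) j = A (Finsupp.single i 1) j
  rw [tsum_eq_single i]
  · simp
  · intro i' hi'
    rw [Finsupp.single_eq_of_ne hi', zero_mul]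

theorem isBoundedOp_extend (hA : IsBoundedMatrix w w' A) : IsBoundedOp (extend hA) := by
  intro k
  obtain ⟨C, m, hC, hCm⟩ := hA k
  refine ⟨C, m, hC, fun c => ?_⟩
  have hs := hA.summable k c
  calc rdNorm k (extend hA c)
      ≤ ∑' j, ∑' i, ‖c.1 i‖ * (‖A (Finsupp.single i 1) j‖ * (w' j : ℝ) ^ k) :=
        ((extend hA c).2 k).tsum_le_tsum (fun j => hA.norm_tsum_mul_le k c j) hs.prod_symm.prod
    _ = ∑' i, ∑' j, ‖c.1 i‖ * (‖A (Finsupp.single i 1) j‖ * (w' j : ℝ) ^ k) :=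
        Summable.tsum_comm hs
    _ = ∑' i, ‖c.1 i‖ * rdNorm k (incl w' (A (Finsupp.single i 1))) :=
        tsum_congr fun i => tsum_mul_left
    _ ≤ ∑' i, C * (‖c.1 i‖ * (w i : ℝ) ^ m) := by
        have hle : ∀ i, ‖c.1 i‖ * rdNorm k (incl w' (A (Finsupp.single i 1))) ≤
            C * (‖c.1 i‖ * (w i : ℝ) ^ m) := fun i => by
          calc _ ≤ ‖c.1 i‖ * (C * (w i : ℝ) ^ m) :=
                mul_le_mul_of_nonneg_left (hCm i) (norm_nonneg _)
            _ = _ := by ring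
        exact Summable.tsum_le_tsum hle (Summable.of_nonneg_of_le
          (fun i => mul_nonneg (norm_nonneg _) (rdNorm_nonneg _ _)) hle ((c.2 m).mul_left C))
          ((c.2 m).mul_left C)
    _ = C * rdNorm m c := tsum_mul_left

/-- All columns vanish outside one finite set, so every convergent combination of them does too.
This is how completed chains return to the algebraic complex. -/
theorem extend_mem_range_incl (hA : IsBoundedMatrix w w' A) {F : Set J} (hF : F.Finite)
    (h : ∀ i, ∀ j ∉ F, A (Finsupp.single i 1) j = 0) (c : RapidDecay w) :
    extend hA c ∈ LinearMap.range (incl w') := by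
  refine ⟨Finsupp.onFinset hF.toFinset (extend hA c).1 fun j hj => ?_, rfl⟩
  by_contra hjF
  refine hj ?_
  rw [extend_apply, tsum_congr fun i => ?_, tsum_zero]
  rw [h i j (by simpa using hjF), mul_zero]

end Extend

end RapidDecay

/-! ## The comparison map for the class of the neutral element -/

section Comparison

open OrdChain RapidDecay

/-- The value at `1` is the sum of the coefficients, and no power of `d` in `P` exceeds the top one.
-/
theorem Polynomial.eval_nat_le_mul_pow (P : Polynomial ℕ) {d : ℕ} (hd : 1 ≤ d) :
    P.eval d ≤ P.eval 1 * d ^ P.natDegree := by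
  rw [Polynomial.eval_eq_sum_range, Polynomial.eval_eq_sum_range, Finset.sum_mul]
  refine Finset.sum_le_sum fun i hi => ?_
  rw [one_pow, mul_one]
  exact Nat.mul_le_mul_left _ (Nat.pow_le_pow_right hd (Nat.lt_succ_iff.mp (Finset.mem_range.mp hi)))

variable {G : Type u} [Group G] {S : FinSymmGenSet G} {n m : ℕ}

theorem rdNorm_incl_toClass_le {r k : ℕ} {c : OrdChain G (n + 1)}
    (hc : c ∈ supp (tuples (wordBall S r) (n + 1))) :
    rdNorm k (incl (fun g => g.weight S) (toClass c)) ≤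
      ((lOne c * ((1 + 2 * r) ^ (n + 1)) ^ k : ℕ) : ℝ) := by
  have h1 : toClass c =
      ∑ t ∈ c.support, Finsupp.single (toClassTuple t) ((c t : ℤ) : ℂ) := by
    rw [toClass, OrdChain.lift, Finsupp.linearCombination_apply, Finsupp.sum]
    refine Finset.sum_congr rfl fun t _ => ?_
    rw [Finsupp.smul_single, zsmul_one]
  rw [h1, map_sum, lOne_eq_sum, Finset.sum_mul]
  push_cast
  refine (rdNorm_sum_le _ _ _).trans (Finset.sum_le_sum fun t ht => ?_)
  rw [rdNorm_incl_single, Complex.norm_intCast, Nat.cast_natAbs, Int.cast_abs]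
  refine mul_le_mul_of_nonneg_left ?_ (abs_nonneg _)
  have := weight_toClassTuple_le S (hc ht)
  exact_mod_cast Nat.pow_le_pow_left this k

theorem isBoundedMatrix_descend {F : OrdChain G (n + 1) →ₗ[ℤ] OrdChain G (m + 1)}
    (hF : PolyBounded S F) :
    IsBoundedMatrix (fun g => g.weight S) (fun g => g.weight S) (descend F) := by
  intro k
  obtain ⟨P, hP⟩ := hF
  -- `P` bounds the number of terms, and `(1 + 2P)^(m + 1)` the weight of a tuple with entries in
  -- the ball of radius `P`.
  let R : Polynomial ℕ := P * ((1 + 2 * P) ^ (m + 1)) ^ k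
  refine ⟨((R.eval 1 : ℕ) : ℝ), R.natDegree, Nat.cast_nonneg _, fun g => ?_⟩
  obtain ⟨h1, h2⟩ := hP (g.weight S) g.lift (lift_mem_wordBall S g)
  rw [descend_single]
  refine (rdNorm_incl_toClass_le h2).trans ?_
  have h3 : lOne (F (of g.lift)) * ((1 + 2 * P.eval (g.weight S)) ^ (m + 1)) ^ k ≤
      R.eval (g.weight S) := by
    simp only [R, Polynomial.eval_mul, Polynomial.eval_pow, Polynomial.eval_add,
      Polynomial.eval_one, Polynomial.eval_ofNat]
    exact Nat.mul_le_mul_right _ h1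
  exact_mod_cast h3.trans (R.eval_nat_le_mul_pow (one_le_weight S g))

theorem finsupp_hom_ext_toClass {M : Type*} [AddCommGroup M] [Module ℂ M]
    {A A' : (ClassTuple (ConjClasses.mk (1 : G)) n →₀ ℂ) →ₗ[ℂ] M}
    (h : ∀ c, A (toClass c) = A' (toClass c)) : A = A' :=
  Finsupp.lhom_ext' fun g => LinearMap.ext_ring (by
    simpa only [LinearMap.comp_apply, Finsupp.lsingle_apply, single_eq_toClass] using h (of g.lift))

variable (S) in
/-- The boundary of the completed Hochschild complex of class `[e]`. -/
abbrev rdHochschildBd (n : ℕ) :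
    RapidDecay (fun g : ClassTuple (ConjClasses.mk (1 : G)) (n + 1) => g.weight S) →ₗ[ℂ]
      RapidDecay (fun g : ClassTuple (ConjClasses.mk (1 : G)) n => g.weight S) :=
  alternatingSum (M := fun n => RapidDecay (fun g : ClassTuple (ConjClasses.mk (1 : G)) n =>
    g.weight S)) (fun _ j => push (ClassTuple.face j) (ClassTuple.weight_face_le S j)) n

theorem rdHochschildBd_incl (y : ClassTuple (ConjClasses.mk (1 : G)) (n + 1) →₀ ℂ) :
    rdHochschildBd S n (incl _ y) = incl _ (hochschildBd n y) := by
  simp only [rdHochschildBd, hochschildBd, alternatingSum, LinearMap.sum_apply,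
    LinearMap.smul_apply, map_sum, map_smul]
  refine Finset.sum_congr rfl fun j _ => ?_
  congr 1
  exact LinearMap.congr_fun
    (push_comp_incl (ClassTuple.face j) (ClassTuple.weight_face_le S j)) y

theorem isBoundedOp_rdHochschildBd : IsBoundedOp (rdHochschildBd (G := G) S n) := by
  simp only [rdHochschildBd, alternatingSum]
  exact IsBoundedOp.sum (one_le_weight S) _ fun j => (isBoundedOp_push _ _).smul _

/-- A morphism of chain complexes that is invertible up to homotopy in the sense below is an
isomorphism on homology. -/
theorem isIso_homologyMap_of_homotopies {C : Type*} [Category* C] [Abelian C]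
    {K L : ChainComplex C ℕ} (φ : K ⟶ L) (B : ∀ n, L.X n ⟶ K.X n)
    (h : ∀ n, K.X n ⟶ K.X (n + 1)) (H : ∀ n, L.X n ⟶ L.X (n + 1))
    (hB : ∀ n, B (n + 1) ≫ K.d (n + 1) n = L.d (n + 1) n ≫ B n)
    (hK₀ : 𝟙 _ = φ.f 0 ≫ B 0 + h 0 ≫ K.d 1 0)
    (hK : ∀ n, 𝟙 _ = φ.f (n + 1) ≫ B (n + 1) + h (n + 1) ≫ K.d (n + 2) (n + 1) +
      K.d (n + 1) n ≫ h n)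
    (hL₀ : 𝟙 _ = B 0 ≫ φ.f 0 + H 0 ≫ L.d 1 0)
    (hL : ∀ n, 𝟙 _ = B (n + 1) ≫ φ.f (n + 1) + H (n + 1) ≫ L.d (n + 2) (n + 1) +
      L.d (n + 1) n ≫ H n) (n : ℕ) :
    IsIso (HomologicalComplex.homologyMap φ n) := by
  have hK' : ∀ (A : C) (x : A ⟶ K.X n), x ≫ K.d n ((ComplexShape.down ℕ).next n) = 0 →
      x = x ≫ φ.f n ≫ B n + x ≫ h n ≫ K.d (n + 1) n := by
    intro A x hx
    cases n with
    | zero => rw [← Preadditive.comp_add, ← hK₀, Category.comp_id]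
    | succ n =>
      rw [ChainComplex.next_nat_succ] at hx
      have := congrArg (x ≫ ·) (hK n)
      simpa only [Preadditive.comp_add, Category.comp_id, reassoc_of% hx, Limits.zero_comp,
        add_zero] using this
  have hL' : ∀ (A : C) (x : A ⟶ L.X n), x ≫ L.d n ((ComplexShape.down ℕ).next n) = 0 →
      x = x ≫ B n ≫ φ.f n + x ≫ H n ≫ L.d (n + 1) n := by
    intro A x hx
    cases n with
    | zero => rw [← Preadditive.comp_add, ← hL₀, Category.comp_id]
    | succ n =>
      rw [ChainComplex.next_nat_succ] at hx
      have := congrArg (x ≫ ·) (hL n)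
      simpa only [Preadditive.comp_add, Category.comp_id, reassoc_of% hx, Limits.zero_comp,
        add_zero] using this
  have hmono : Mono (HomologicalComplex.homologyMap φ n) := by
    rw [HomologicalComplex.mono_homologyMap_iff_up_to_refinements φ (n + 1) n _ (by simp) rfl]
    intro A x hx y hxy
    -- If `φ x = d y` for a cycle `x`, then `x = B (φ x) + d (h x) = d (B y + h x)`.
    refine ⟨A, 𝟙 A, inferInstance, y ≫ B (n + 1) + x ≫ h n, ?_⟩
    rw [Category.id_comp, Preadditive.add_comp, Category.assoc, Category.assoc, hB, ← Category.assoc,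
      ← hxy, Category.assoc]
    exact hK' A x hx
  have hepi : Epi (HomologicalComplex.homologyMap φ n) := by
    rw [HomologicalComplex.epi_homologyMap_iff_up_to_refinements φ (n + 1) n _ (by simp) rfl]
    intro A y hy
    refine ⟨A, 𝟙 A, inferInstance, y ≫ B n, ?_, y ≫ H n, ?_⟩
    · cases n with
      | zero => simp
      | succ n =>
        rw [ChainComplex.next_nat_succ] at hy ⊢
        rw [Category.assoc, hB, reassoc_of% hy, Limits.zero_comp]
    · rw [Category.id_comp, Category.assoc, Category.assoc]
      exact hL' A y hy
  exact isIso_of_mono_of_epi _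

theorem isIso_HHcomparison_one (S : FinSymmGenSet G)
    (hD : HasPolynomiallyBoundedDehnFunctions G) (n : ℕ) :
    IsIso (HHcomparison S (ConjClasses.mk (1 : G)) n) := by
  classical
  obtain ⟨θ, hθ₀, hθbd, hθG, hθP, hθF⟩ := hD.exists_chainMap S
  let η : ∀ n, OrdChain G n →ₗ[ℤ] OrdChain G (n + 1) := coneHomotopy θ fun _ t => t 0
  have hηG : ∀ n (g : G) c, map (g * ·) (η n c) = η n (map (g * ·) c) := fun n g c =>
    map_coneHomotopy (fun n c => hθG n g c) (fun _ _ => rfl) c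
  have hηP : ∀ n, PolyBounded S (η n) := polyBounded_coneHomotopy S hθP
  have hηbd : ∀ n c, bd (n + 1) (η (n + 1) c) = c - θ (n + 1) c - η n (bd n c) := fun n c =>
    bd_coneHomotopy hθ₀ hθbd c
  let w : ∀ n, ClassTuple (ConjClasses.mk (1 : G)) n → ℕ := fun n g => g.weight S
  have hw : ∀ n i, 1 ≤ w n i := fun n => one_le_weight S
  have hAb : ∀ n, IsBoundedMatrix (w n) (w n) (descend (θ (n + 1))) := fun n =>
    isBoundedMatrix_descend (hθP _)
  have hhb : ∀ n, IsBoundedMatrix (w n) (w (n + 1)) (descend (η (n + 1))) := fun n =>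
    isBoundedMatrix_descend (hηP _)
  have hAbd : ∀ n, hochschildBd n ∘ₗ descend (θ (n + 2)) =
      descend (θ (n + 1)) ∘ₗ hochschildBd n := fun n => finsupp_hom_ext_toClass fun c => by
    simp only [LinearMap.comp_apply, descend_toClass (hθG _), hochschildBd_toClass, hθbd]
  have hhbd₀ : hochschildBd 0 ∘ₗ descend (η 1) = LinearMap.id - descend (θ 1) :=
    finsupp_hom_ext_toClass fun c => by
      have h0 : η 0 = 0 := rfl
      simp only [LinearMap.comp_apply, LinearMap.sub_apply, LinearMap.id_apply,
        descend_toClass (hθG _), descend_toClass (hηG _), hochschildBd_toClass, hηbd, h0,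
        map_sub, LinearMap.zero_apply, sub_zero]
  have hhbd : ∀ n, hochschildBd (n + 1) ∘ₗ descend (η (n + 2)) =
      LinearMap.id - descend (θ (n + 2)) - descend (η (n + 1)) ∘ₗ hochschildBd n := fun n =>
    finsupp_hom_ext_toClass fun c => by
      simp only [LinearMap.comp_apply, LinearMap.sub_apply, LinearMap.id_apply,
        descend_toClass (hθG _), descend_toClass (hηG _), hochschildBd_toClass, hηbd, map_sub]
  -- These identities, and the two that follow, hold on finitely supported chains and pass to the
  -- completion by density, both sides being bounded operators.
  have hEbd : ∀ n, rdHochschildBd S n ∘ₗ extend (hAb (n + 1)) =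
      extend (hAb n) ∘ₗ rdHochschildBd S n := fun n =>
    IsBoundedOp.ext (hw _) (isBoundedOp_rdHochschildBd.comp (isBoundedOp_extend _))
      ((isBoundedOp_extend _).comp isBoundedOp_rdHochschildBd) fun y => by
        have := LinearMap.congr_fun (hAbd n) y
        rw [LinearMap.comp_apply, LinearMap.comp_apply] at this
        rw [LinearMap.comp_apply, LinearMap.comp_apply, extend_incl, rdHochschildBd_incl,
          rdHochschildBd_incl, extend_incl, this]
  have hEhbd₀ : rdHochschildBd S 0 ∘ₗ extend (hhb 0) = LinearMap.id - extend (hAb 0) :=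
    IsBoundedOp.ext (hw _) (isBoundedOp_rdHochschildBd.comp (isBoundedOp_extend _))
      (IsBoundedOp.id.sub (hw _) (isBoundedOp_extend _)) fun y => by
        have := LinearMap.congr_fun hhbd₀ y
        rw [LinearMap.comp_apply, LinearMap.sub_apply, LinearMap.id_apply] at this
        rw [LinearMap.comp_apply, LinearMap.sub_apply, LinearMap.id_apply, extend_incl,
          rdHochschildBd_incl, extend_incl, this, map_sub]
  have hEhbd : ∀ n, rdHochschildBd S (n + 1) ∘ₗ extend (hhb (n + 1)) =
      LinearMap.id - extend (hAb (n + 1)) - extend (hhb n) ∘ₗ rdHochschildBd S n := fun n =>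
    IsBoundedOp.ext (hw _) (isBoundedOp_rdHochschildBd.comp (isBoundedOp_extend _))
      ((IsBoundedOp.id.sub (hw _) (isBoundedOp_extend _)).sub (hw _)
        ((isBoundedOp_extend _).comp isBoundedOp_rdHochschildBd)) fun y => by
        have := LinearMap.congr_fun (hhbd n) y
        simp only [LinearMap.comp_apply, LinearMap.sub_apply, LinearMap.id_apply] at this
        simp only [LinearMap.comp_apply, LinearMap.sub_apply, LinearMap.id_apply]
        rw [extend_incl, rdHochschildBd_incl, rdHochschildBd_incl, extend_incl, extend_incl, this,
          map_sub, map_sub]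
  -- Translates of a tuple have the same image in class `[e]`, so the finitely many orbits hit by
  -- `θ` become a finite set of class tuples.
  have hErange : ∀ n c, extend (hAb n) c ∈ LinearMap.range (incl (w n)) := fun n c => by
    obtain ⟨F, hF⟩ := hθF (n + 1)
    refine extend_mem_range_incl _ (F := toClassTuple '' (F : Set (Fin (n + 1) → G)))
      (F.finite_toSet.image _) (fun g j hj => ?_) c
    rw [descend_single]
    by_contra hne
    refine hj (map_mem_of_mem_supported
      (N := (Finsupp.supported ℂ ℂ (toClassTuple '' (F : Set (Fin (n + 1) → G)))).restrictScalars ℤ)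
      toClass (fun t ht => ?_) (hF (of g.lift)) (Finsupp.mem_support_iff.mpr hne))
    obtain ⟨t', ht', g', rfl⟩ := ht
    rw [toClass_of, toClassTuple_mul]
    exact Finsupp.single_mem_supported ℂ 1 ⟨t', ht', rfl⟩
  -- The homotopy inverse of the inclusion: the extension of `θ`, viewed as a map into finitely
  -- supported chains.
  let B : ∀ n, RapidDecay (w n) →ₗ[ℂ] (ClassTuple (ConjClasses.mk (1 : G)) n →₀ ℂ) := fun n =>
    (LinearEquiv.ofInjective (incl (w n)) (incl_injective _)).symm.toLinearMap ∘ₗ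
      (extend (hAb n)).codRestrict _ (hErange n)
  have hB : ∀ n c, incl (w n) (B n c) = extend (hAb n) c := fun n c =>
    congrArg Subtype.val ((LinearEquiv.ofInjective (incl (w n)) (incl_injective _)).apply_symm_apply
      ((extend (hAb n)).codRestrict _ (hErange n) c))
  have hBincl : ∀ n y, B n (incl (w n) y) = descend (θ (n + 1)) y := fun n y =>
    incl_injective _ (by rw [hB, extend_incl])
  have hK₀ : ∀ y, y = B 0 (incl (w 0) y) + hochschildBd 0 (descend (η 1) y) := fun y => by
    have := LinearMap.congr_fun hhbd₀ y
    simp only [LinearMap.comp_apply, LinearMap.sub_apply, LinearMap.id_apply] at this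
    rw [this, hBincl]
    abel
  have hK : ∀ n y, y = B (n + 1) (incl (w (n + 1)) y) +
      hochschildBd (n + 1) (descend (η (n + 2)) y) +
      descend (η (n + 1)) (hochschildBd n y) := fun n y => by
    have := LinearMap.congr_fun (hhbd n) y
    simp only [LinearMap.comp_apply, LinearMap.sub_apply, LinearMap.id_apply] at this
    rw [this, hBincl]
    abel
  have hL₀ : ∀ c, c = incl (w 0) (B 0 c) + rdHochschildBd S 0 (extend (hhb 0) c) := fun c => by
    have := LinearMap.congr_fun hEhbd₀ c
    simp only [LinearMap.comp_apply, LinearMap.sub_apply, LinearMap.id_apply] at this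
    rw [this, hB]
    abel
  have hL : ∀ n c, c = incl (w (n + 1)) (B (n + 1) c) +
      rdHochschildBd S (n + 1) (extend (hhb (n + 1)) c) +
      extend (hhb n) (rdHochschildBd S n c) := fun n c => by
    have := LinearMap.congr_fun (hEhbd n) c
    simp only [LinearMap.comp_apply, LinearMap.sub_apply, LinearMap.id_apply] at this
    rw [this, hB]
    abel
  have hBbd : ∀ n c, hochschildBd n (B (n + 1) c) = B n (rdHochschildBd S n c) := fun n c =>
    incl_injective (w n) (by
      rw [← rdHochschildBd_incl, hB, hB]
      exact LinearMap.congr_fun (hEbd n) c)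
  have hdK : ∀ n, (hochschildComplex (ConjClasses.mk (1 : G))).d (n + 1) n =
      ModuleCat.ofHom (hochschildBd n) := fun n => by
    simp only [hochschildComplex, alternatingComplex, ChainComplex.of_d, hochschildBd]
  have hdL : ∀ n, (rdHochschildComplex S (ConjClasses.mk (1 : G))).d (n + 1) n =
      ModuleCat.ofHom (rdHochschildBd S n) := fun n => by
    simp only [rdHochschildComplex, alternatingComplex, ChainComplex.of_d, rdHochschildBd]
  refine isIso_homologyMap_of_homotopies (hochschildComparison S (ConjClasses.mk (1 : G)))
    (fun n => ModuleCat.ofHom (B n)) (fun n => ModuleCat.ofHom (descend (η (n + 1))))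
    (fun n => ModuleCat.ofHom (extend (hhb n))) (fun n => ?_) ?_ (fun n => ?_) ?_ (fun n => ?_) n
  · rw [hdK, hdL]
    exact ModuleCat.hom_ext (LinearMap.ext (hBbd n))
  · rw [hdK]
    exact ModuleCat.hom_ext (LinearMap.ext hK₀)
  · rw [hdK, hdK]
    exact ModuleCat.hom_ext (LinearMap.ext (hK n))
  · rw [hdL]
    exact ModuleCat.hom_ext (LinearMap.ext hL₀)
  · rw [hdL, hdL]
    exact ModuleCat.hom_ext (LinearMap.ext (hL n))

end Comparison

end

theorem mainTheorem5 {G : Type u} [Group G] (S : FinSymmGenSet G)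
    (hF : IsTypeFInfty G) (hD : HasPolynomiallyBoundedDehnFunctions G) (n : ℕ) :
    IsIso (HHcomparison S (ConjClasses.mk (1 : G)) n) :=
  isIso_HHcomparison_one S hD n
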